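/- **Setting.** All data lie in $[0,1]$. For $D\in\mathbb R^m$ let $r_D(x)=\#\{i: D_i<x\}$, and for probability distributions $\chi_1,\dots,\chi_m$ on $[0,1]$ let $r_\chi(x)=\mathbb E[r_D(x)]$, where the $D_i\sim\chi_i$ are independent. A *learner* $\mathcal A$ maps a sample $D$ of any size $m$ to a model $\hat r=\mathcal A(D):\mathbb R\to\mathbb R$ (everything measurable). A class $\mathfrak Y$ of distributions on $[0,1]$ is *distribution learnable* (for the rank operation) by $\mathcal A$ with parameters $\mathcal T_m,\mathcal S_m,\mathcal B_m$ and constants $\varkappa_1,\varkappa_2>0$ if for every $m\ge1$: (i) for all $\chi_1,\dots,\chi_m\in\mathfrak Y$ and $\epsilon\ge\sqrt m$, $\ \mathbb P_{D\sim\chi}\big[\sup_{x\in[0,1]}|r_\chi(x)-\hat r(x)|\ge\epsilon\big]\le\varkappa_1e^{-\varkappa_2(\epsilon/\sqrt m-1)^2}$; (ii) on data in $[0,1]$, evaluating $\hat r$ at a point of $[0,1]$ takes at most $\mathcal T_m$ operations and storing $\hat r$ takes at most $\mathcal S_m$ bits; (iii) on data in $[0,1]$, computing $\hat r$ from $D$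 takes at most $m\mathcal B_m$ operations. For a class $\mathfrak X$ of distributions on $[0,1]$, $\bar{\mathfrak X}$ denotes the set of all normalized conditional distributions: the laws of $(X-a)/(b-a)$ given $X\in R$, where $X\sim\chi\in\mathfrak X$, $R$ is an interval (with or without its end points) with end points $a<b$ in $[0,1]$, and $\mathbb P(X\in R)>0$. *Machine.* Random access machine with words of $O(\log n)$ bits and unit-cost word arithmetic, branching and memory access, a constant number of registers and one model slot. The keys of the read-only input array are accessible only by comparing two of them (one operation), by training a model on a list of $m$ keys, affinely rescaled with respect to two keys or end points of $[0,1]$ (the operations of the learner, plus $m$), by evaluating the current model at a so rescaled key, the result being rounded to an integer in $\{0,\dots,m\}$ (the operations of the evaluation, plus one), and by copying a key to the write-only output. Every instruction also takes one operation, plus one for each node of the expressions in it. Space is counted in bits: registers, memory, and the largest model stored; input and output are not counted. **Theorem.** For all $\varkappa_1,\varkappa_2>0$ there are a program $P$ for this machine, which uses the learner as an oracle, and a constant $C$ such that the following holds for every class $\mathfrak X$ of distributions on $[0,1]$ and every learner by which $\bar{\mathfrak X}$ is distribution learnable with constants $\varkappa_1,\varkappa_2$ and parameters $\mathcal T_m\ge1$,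 $\mathcal S_m$, $\mathcal B_m$ for which $\mathcal T_m$, $\mathcal S_m$ and the total training cost $m\mathcal B_m$ are nondecreasing in $m$. * For every $n$ and every array $A\in[0,1]^n$, $P$ halts on $A$ and outputs the entries of $A$ in sorted order. If $n\ge4$, it uses at most $C\,(\mathcal S_{\sqrt n}+n\log_2 n)$ bits of space. * If $n\ge4$ and the entries of $A$ are i.i.d. with a distribution in $\mathfrak X$, the expected number of operations is at most $$C\Big(\mathcal T_{\sqrt n}\,n\log_2\log_2 n+\sqrt n\,\mathcal B_{\sqrt n}+\sum_{i=0}^{\lfloor\log_{5/4}\log_2 n\rfloor}n^{1-\frac12(\frac45)^i}\,\mathcal B_{n^{\frac12(\frac45)^i}}\Big),$$ where indices of $\mathcal T,\mathcal S,\mathcal B$ are rounded down to integers. -/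

import Mathlib

open MeasureTheory ProbabilityTheory Set
open scoped ENNReal

namespace LearnedSort

noncomputable section

/-! ### Rank functions and classes of data distributions -/

/-- The rank function of a data set: the number of data points smaller than `x`. -/
def rank {m : ℕ} (D : Fin m → ℝ) (x : ℝ) : ℕ :=
  (Finset.univ.filter fun i => D i < x).card

/-- The distribution rank function: the expected rank of `x` in a data set whose `i`-th point is
drawn, independently of the others, from `χ i`. -/
def expectedRank {m : ℕ} (χ : Fin m → ProbabilityMeasure ℝ) (x : ℝ) : ℝ :=
  ∫ D, (rank D x : ℝ) ∂(Measure.pi fun i => (χ i : Measure ℝ))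

/-- The affine map that takes the interval with end points `a`, `b` to the unit interval. -/
def rescale (a b x : ℝ) : ℝ := (x - a) / (b - a)

/-- The closure of a distribution class: all normalized conditional distributions of its members,
given an interval of positive probability with end points `a < b` in `[0, 1]`; the interval may or
may not contain its end points. -/
def condClosure (X : Set (ProbabilityMeasure ℝ)) : Set (ProbabilityMeasure ℝ) :=
  {ν | ∃ χ ∈ X, ∃ (a b : ℝ) (R : Set ℝ), 0 ≤ a ∧ a < b ∧ b ≤ 1 ∧
    Ioo a b ⊆ R ∧ R ⊆ Icc a b ∧ (χ : Measure ℝ) R ≠ 0 ∧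
    (ν : Measure ℝ) = (ProbabilityTheory.cond (χ : Measure ℝ) R).map (rescale a b)}

/-! ### Learning algorithms and distribution learnability -/

/-- A learning algorithm: from `m` observations it computes a model, that is, a real function.
It comes with the number of operations that training takes, the number of operations that
evaluating the model at a point takes, and the number of bits that storing the model takes.
These costs may depend on the observations and on the point; nothing but measurability is
required of them here. -/
structure Learner where
  fit : (m : ℕ) → (Fin m → ℝ) → ℝ → ℝ
  trainTime : (m : ℕ) → (Fin m → ℝ) → ℕ
  evalTime : (m : ℕ) → (Fin m → ℝ) → ℝ → ℕ
  modelSize : (m : ℕ) → (Fin m → ℝ) → ℕ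
  measurable_fit : ∀ m, Measurable fun p : (Fin m → ℝ) × ℝ => fit m p.1 p.2
  measurable_trainTime : ∀ m, Measurable (trainTime m)
  measurable_evalTime : ∀ m, Measurable fun p : (Fin m → ℝ) × ℝ => evalTime m p.1 p.2

/-- The learning algorithm `L` shows that the class `X` of distributions on `[0, 1]` is
distribution learnable for the rank operation, with parameters `T` (inference), `S` (space),
`B` (amortized training) and constants `κ₁`, `κ₂`. The observations are independent, with
possibly different distributions from `X`. -/
structure Learner.Learns (L : Learner) (κ₁ κ₂ : ℝ) (X : Set (ProbabilityMeasure ℝ))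
    (T S B : ℕ → ℝ) : Prop where
  accuracy : ∀ m : ℕ, 1 ≤ m → ∀ χ : Fin m → ProbabilityMeasure ℝ, (∀ i, χ i ∈ X) →
    ∀ ε : ℝ, Real.sqrt m ≤ ε →
      (Measure.pi fun i => (χ i : Measure ℝ))
          {D | ENNReal.ofReal ε ≤ ⨆ x ∈ Icc (0 : ℝ) 1, ‖expectedRank χ x - L.fit m D x‖ₑ} ≤
        ENNReal.ofReal (κ₁ * Real.exp (-κ₂ * (ε / Real.sqrt m - 1) ^ 2))
  inference : ∀ m : ℕ, 1 ≤ m → ∀ D : Fin m → ℝ, (∀ i, D i ∈ Icc (0 : ℝ) 1) →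
    ∀ x ∈ Icc (0 : ℝ) 1, (L.evalTime m D x : ℝ) ≤ T m
  space : ∀ m : ℕ, 1 ≤ m → ∀ D : Fin m → ℝ, (∀ i, D i ∈ Icc (0 : ℝ) 1) →
    (L.modelSize m D : ℝ) ≤ S m
  training : ∀ m : ℕ, 1 ≤ m → ∀ D : Fin m → ℝ, (∀ i, D i ∈ Icc (0 : ℝ) 1) →
    (L.trainTime m D : ℝ) ≤ m * B m

/-! ### The machine

A random access machine with `w`-bit words, `k` registers, `M` memory cells, one slot for a
trained model, a read-only input array of keys and a write-only output. The keys are accessible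
only through comparisons, through the learning algorithm and the current model, and by being
copied to the output; the machine computes with words, which serve as numbers and as references
to keys. -/

/-- Word expressions: constants, registers, memory access, arithmetic (modulo the word length;
subtraction is truncated), comparison of words, and comparison of the keys that two words
refer to. Comparisons have the value 1 if they hold and 0 otherwise. -/
inductive Expr (k : ℕ) where
  | const (c : ℕ)
  | reg (x : Fin k)
  | load (e : Expr k)
  | add (e₁ e₂ : Expr k)
  | sub (e₁ e₂ : Expr k)
  | mul (e₁ e₂ : Expr k)
  | div (e₁ e₂ : Expr k)
  | lt (e₁ e₂ : Expr k)
  | keyLt (e₁ e₂ : Expr k)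

/-- Programs. `assign x e` and `store a e` write the word `e` to a register and to the memory
cell with address `a`; `train lo hi a m` trains a model, `query x e` evaluates it at the key that
`e` refers to, `emit e` appends that key to the output. -/
inductive Cmd (k : ℕ) where
  | skip
  | assign (x : Fin k) (e : Expr k)
  | store (a e : Expr k)
  | train (lo hi a m : Expr k)
  | query (x : Fin k) (e : Expr k)
  | emit (e : Expr k)
  | seq (p q : Cmd k)
  | ite (e : Expr k) (p q : Cmd k)
  | while (e : Expr k) (p : Cmd k)

/-- What stays fixed during a run: the learning algorithm, the input array, the word length in
bits and the number of memory cells. -/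
structure Env where
  L : Learner
  n : ℕ
  A : Fin n → ℝ
  w : ℕ
  M : ℕ

/-- A trained model: the (rescaled) observations it was computed from, and the end points of the
interval that was rescaled to the unit interval. -/
structure Model where
  m : ℕ
  D : Fin m → ℝ
  lo : ℝ
  hi : ℝ

/-- A state of the machine. `time` counts the operations so far, `peak` is the largest number of
bits that a model has taken so far. -/
structure State (k : ℕ) where
  reg : Fin k → ℕ
  mem : ℕ → ℕ
  model : Model
  out : List ℝ
  time : ℕ
  peak : ℕ

variable {k : ℕ}

/-- Reduction to a word. -/
def Env.word (E : Env) (v : ℕ) : ℕ := v % 2 ^ E.w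

/-- The key that a word refers to: the words below `n` refer to the entries of the input array;
`n` refers to the end point 0 of the data domain, all other words to its end point 1. -/
def Env.key (E : Env) (i : ℕ) : ℝ :=
  if h : i < E.n then E.A ⟨i, h⟩ else if i = E.n then 0 else 1

/-- The content of a memory cell; outside the memory the machine reads 0. -/
def Env.read (E : Env) (σ : State k) (a : ℕ) : ℕ := if a < E.M then σ.mem a else 0

open Classical in
/-- The value of an expression. -/
def Expr.val (E : Env) (σ : State k) : Expr k → ℕ
  | .const c => E.word c
  | .reg x => σ.reg x
  | .load e => E.read σ (e.val E σ)
  | .add e₁ e₂ => E.word (e₁.val E σ + e₂.val E σ)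
  | .sub e₁ e₂ => E.word (e₁.val E σ - e₂.val E σ)
  | .mul e₁ e₂ => E.word (e₁.val E σ * e₂.val E σ)
  | .div e₁ e₂ => E.word (e₁.val E σ / e₂.val E σ)
  | .lt e₁ e₂ => E.word (if e₁.val E σ < e₂.val E σ then 1 else 0)
  | .keyLt e₁ e₂ => E.word (if E.key (e₁.val E σ) < E.key (e₂.val E σ) then 1 else 0)

/-- Evaluating an expression takes one operation for each of its nodes. -/
def Expr.cost : Expr k → ℕ
  | .const _ => 1
  | .reg _ => 1
  | .load e => e.cost + 1
  | .add e₁ e₂ => e₁.cost + e₂.cost + 1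
  | .sub e₁ e₂ => e₁.cost + e₂.cost + 1
  | .mul e₁ e₂ => e₁.cost + e₂.cost + 1
  | .div e₁ e₂ => e₁.cost + e₂.cost + 1
  | .lt e₁ e₂ => e₁.cost + e₂.cost + 1
  | .keyLt e₁ e₂ => e₁.cost + e₂.cost + 1

/-- Let `t` operations pass. -/
def State.tick (σ : State k) (t : ℕ) : State k := { σ with time := σ.time + t }

def State.setReg (σ : State k) (x : Fin k) (v : ℕ) : State k :=
  { σ with reg := Function.update σ.reg x v }

/-- Write to memory; a write outside the memory has no effect. -/
def Env.write (E : Env) (σ : State k) (a v : ℕ) : State k :=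
  if a < E.M then { σ with mem := Function.update σ.mem a v } else σ

/-- The model trained on the `m` keys that the memory cells `a, a + 1, …, a + m - 1` refer to,
after rescaling the interval between the keys `lo` and `hi` to the unit interval. -/
def Env.newModel (E : Env) (σ : State k) (lo hi a m : ℕ) : Model where
  m := m
  D := fun j => rescale (E.key lo) (E.key hi) (E.key (E.read σ (a + j)))
  lo := E.key lo
  hi := E.key hi

/-- Train a model and put it in place of the current one. Besides the operations of the learning
algorithm this takes one operation for each observation. -/
def Env.train (E : Env) (σ : State k) (lo hi a m : ℕ) : State k :=
  let F := E.newModel σ lo hi a m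
  { σ with
    model := F
    time := σ.time + E.L.trainTime F.m F.D + m
    peak := max σ.peak (E.L.modelSize F.m F.D) }

/-- Evaluate the current model at a key, and round the estimated rank down to one of the numbers
`0, …, m`, where `m` is the number of observations the model was trained on. -/
def Env.query (E : Env) (σ : State k) (x : Fin k) (i : ℕ) : State k :=
  let F := σ.model
  let y := rescale F.lo F.hi (E.key i)
  (σ.setReg x (E.word (min F.m ⌊E.L.fit F.m F.D y⌋₊))).tick (E.L.evalTime F.m F.D y)

/-- `Exec E p σ τ`: in the environment `E`, the program `p`, started in the state `σ`, halts in
the state `τ`. -/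
inductive Exec (E : Env) : Cmd k → State k → State k → Prop
  | skip (σ) : Exec E .skip σ (σ.tick 1)
  | assign (σ x e) : Exec E (.assign x e) σ ((σ.setReg x (e.val E σ)).tick (e.cost + 1))
  | store (σ a e) : Exec E (.store a e) σ
      ((E.write σ (a.val E σ) (e.val E σ)).tick (a.cost + e.cost + 1))
  | train (σ lo hi a m) : Exec E (.train lo hi a m) σ
      ((E.train σ (lo.val E σ) (hi.val E σ) (a.val E σ) (m.val E σ)).tick
        (lo.cost + hi.cost + a.cost + m.cost + 1))
  | query (σ x e) : Exec E (.query x e) σ ((E.query σ x (e.val E σ)).tick (e.cost + 1))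
  | emit (σ e) : Exec E (.emit e) σ
      (({ σ with out := σ.out ++ [E.key (e.val E σ)] } : State k).tick (e.cost + 1))
  | seq {σ τ υ p q} : Exec E p σ τ → Exec E q τ υ → Exec E (.seq p q) σ υ
  | ite_true {σ τ e p q} : e.val E σ ≠ 0 → Exec E p (σ.tick (e.cost + 1)) τ →
      Exec E (.ite e p q) σ τ
  | ite_false {σ τ e p q} : e.val E σ = 0 → Exec E q (σ.tick (e.cost + 1)) τ →
      Exec E (.ite e p q) σ τ
  | while_true {σ τ υ e p} : e.val E σ ≠ 0 → Exec E p (σ.tick (e.cost + 1)) τ →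
      Exec E (.while e p) τ υ → Exec E (.while e p) σ υ
  | while_false {σ e p} : e.val E σ = 0 → Exec E (.while e p) σ (σ.tick (e.cost + 1))

/-- The initial state: register 0 contains the length of the input array, everything else is
empty. -/
def Env.init (E : Env) : State (k + 1) where
  reg := fun x => if x = 0 then E.word E.n else 0
  mem := fun _ => 0
  model := ⟨0, fun i => i.elim0, 0, 1⟩
  out := []
  time := 0
  peak := 0

/-- The machine on input `A`, with `c n + c` memory cells and words of `c (⌊log₂ n⌋ + 1) + c`
bits. -/
def envOf (c : ℕ) (L : Learner) {n : ℕ} (A : Fin n → ℝ) : Env where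
  L := L
  n := n
  A := A
  w := c * (Nat.log 2 n + 1) + c
  M := c * n + c

/-- The space of a run, in bits: registers, memory, and the largest model. The read-only input and
the write-only output are not counted. -/
def Env.space (E : Env) (σ : State k) : ℕ := (k + E.M) * E.w + σ.peak

/-- The claimed order of the running time. The sum ranges over those `i` for which
`n ^ ((4/5) ^ i)` is at least 2, that is, over `i ≤ log_{5/4} log_2 n`. Indices are rounded
down. -/
def timeBound (T B : ℕ → ℝ) (n : ℕ) : ℝ :=
  T (Nat.sqrt n) * n * Real.logb 2 (Real.logb 2 n) + Real.sqrt n * B (Nat.sqrt n) +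
    ∑ i ∈ Finset.range (⌊Real.logb (5 / 4) (Real.logb 2 n)⌋₊ + 1),
      (n : ℝ) ^ (1 - (1 / 2 : ℝ) * (4 / 5 : ℝ) ^ i) *
        B ⌊(n : ℝ) ^ ((1 / 2 : ℝ) * (4 / 5 : ℝ) ^ i)⌋₊

/-- The claimed order of the space. -/
def spaceBound (S : ℕ → ℝ) (n : ℕ) : ℝ := S (Nat.sqrt n) + n * Real.logb 2 n

end

end LearnedSort

/-! The program is a sample sort in which a model predicts the cell of an entry. A bucket consists
of all entries strictly between two keys, in array order, and carries a parameter `u`, roughly the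
tenth root of its size. Its first `u ^ 5` entries form the sample: they are merge sorted, every `u ^
3`-th of them becomes a pivot, and a model is trained on them. For each entry of the bucket the
model estimates its rank in the sample; this rank divided by `u ^ 3` is a guess for the cell, and a
walk along the pivots corrects it. The cells between pivots become buckets with parameter `next u`,
about `u ^ (4/5)`; copies of a pivot form cells of their own, which are in order already. Below
`threshold n`, of order `(log n) ^ 2`, buckets are merge sorted. Correctness holds for every array,
since a bad model only lengthens the walks.

Time is accounted for by a potential (`Params.pot`, `wp_refineCmd`). An entry pays a query and a
walk on each of the `O(log log n)` levels and, at the end, the logarithm of the size of a small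
bucket, which is again `O(log log n)`. Training and the work on samples are paid per node of a
recursion tree with `u ^ 2` children (`tree_le`). At depth `i` this amounts to at most `n / n ^
((4/5) ^ i)` nodes with samples of at most `n ^ ((4/5) ^ i / 2)` keys, which gives the sum in the
bound.

For random arrays two things can go wrong: a model errs by more than `3 * u ^ 3` at a key outside
its sample, or a child is too large although few sample keys lie in it. Buckets depend on the data,
but only through the two keys that bound them. So the indices of these keys, and of the queried key,
are fixed; given the entries there, the other entries are still independent, and those that fall
into the interval are independent with the conditional law (`measure_hitEvent_le`). That law,
rescaled, belongs to the closure of the class, so learnability applies to a sample of size `u ^ 5`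
with `ε = u ^ 3`, that is, `ε / √m = √u`. Together with Hoeffding's inequality at the queried key
this gives `Learner.Learns.accurate`; Hoeffding's inequality alone gives `measure_large_child_le`.
Since `√u` exceeds `log n` above the threshold, the failure probabilities are smaller than any power
of `n`, and a union bound over at most six indices leaves `O(1 / n)` (`measure_badEvent_le`).

Every run, typical or not, satisfies the same accounting with trivial parameters, which costs at
most `O(n ^ 2 log log n)` more (`regime_params` with `b = false`, `runTime_false_le`). Multiplied by
`O(1 / n)`, this is absorbed in the main term. -/

namespace LearnedSort

/-! ### A layer of arrays on top of the machine

The memory is divided into nine rows of `n + 1` cells. Commands with array access are compiled to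
machine commands; `wp` is a calculus for total correctness with time budgets, in which everything
that a command does not write to is known to be unchanged. -/

/-- Expressions with access to nine arrays. -/
inductive AExpr (k : ℕ) where
  | const (c : ℕ)
  | reg (x : Fin k)
  | arr (r : Fin 9) (e : AExpr k)
  | add (e₁ e₂ : AExpr k)
  | sub (e₁ e₂ : AExpr k)
  | mul (e₁ e₂ : AExpr k)
  | div (e₁ e₂ : AExpr k)
  | lt (e₁ e₂ : AExpr k)
  | and (e₁ e₂ : AExpr k)
  | keyLt (e₁ e₂ : AExpr k)

/-- Commands with access to nine arrays. -/
inductive ACmd (k : ℕ) where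
  | skip
  | assign (x : Fin k) (e : AExpr k)
  | store (r : Fin 9) (i e : AExpr k)
  | train (lo hi : AExpr k) (r : Fin 9) (a m : AExpr k)
  | query (x : Fin k) (e : AExpr k)
  | emit (e : AExpr k)
  | seq (p q : ACmd k)
  | ite (e : AExpr k) (p q : ACmd k)
  | while (e : AExpr k) (p : ACmd k)

/-- States with nine arrays; time is accounted for separately. -/
structure AState (k : ℕ) where
  reg : Fin k → ℕ
  arr : Fin 9 → ℕ → ℕ
  model : Model
  out : List ℝ
  peak : ℕ

variable {k : ℕ}

def AState.setReg (s : AState k) (x : Fin k) (v : ℕ) : AState k :=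
  { s with reg := Function.update s.reg x v }

def AState.setArr (s : AState k) (r : Fin 9) (i v : ℕ) : AState k :=
  { s with arr := Function.update s.arr r (Function.update (s.arr r) i v) }

def AState.emit (s : AState k) (x : ℝ) : AState k := { s with out := s.out ++ [x] }

section simps
variable (s : AState k) (x y : Fin k) (v i : ℕ) (r r' : Fin 9) (z : ℝ)

@[simp] theorem AState.reg_setReg : (s.setReg x v).reg y = if y = x then v else s.reg y := by
  simp [AState.setReg, Function.update_apply]
@[simp] theorem AState.arr_setReg : (s.setReg x v).arr = s.arr := rfl
@[simp] theorem AState.model_setReg : (s.setReg x v).model = s.model := rfl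
@[simp] theorem AState.out_setReg : (s.setReg x v).out = s.out := rfl
@[simp] theorem AState.peak_setReg : (s.setReg x v).peak = s.peak := rfl
@[simp] theorem AState.reg_setArr : (s.setArr r i v).reg = s.reg := rfl
@[simp] theorem AState.arr_setArr : (s.setArr r i v).arr r' =
    if r' = r then Function.update (s.arr r) i v else s.arr r' := by
  by_cases h : r' = r
  · subst h; simp [AState.setArr]
  · simp [AState.setArr, h]
@[simp] theorem AState.out_setArr : (s.setArr r i v).out = s.out := rfl
@[simp] theorem AState.peak_setArr : (s.setArr r i v).peak = s.peak := rfl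
@[simp] theorem AState.out_emit : (s.emit z).out = s.out ++ [z] := rfl
@[simp] theorem AState.peak_emit : (s.emit z).peak = s.peak := rfl
end simps

open Classical in
/-- The value of an expression, computed with natural numbers. -/
noncomputable def AExpr.eval (E : Env) (s : AState k) : AExpr k → ℕ
  | .const c => c
  | .reg x => s.reg x
  | .arr r e => s.arr r (e.eval E s)
  | .add e₁ e₂ => e₁.eval E s + e₂.eval E s
  | .sub e₁ e₂ => e₁.eval E s - e₂.eval E s
  | .mul e₁ e₂ => e₁.eval E s * e₂.eval E s
  | .div e₁ e₂ => e₁.eval E s / e₂.eval E s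
  | .lt e₁ e₂ => if e₁.eval E s < e₂.eval E s then 1 else 0
  | .and e₁ e₂ => if e₁.eval E s ≠ 0 ∧ e₂.eval E s ≠ 0 then 1 else 0
  | .keyLt e₁ e₂ => if E.key (e₁.eval E s) < E.key (e₂.eval E s) then 1 else 0

/-- All intermediate values are words, and all array indices are valid. -/
def AExpr.Ok (E : Env) (s : AState k) : AExpr k → Prop
  | .const c => c < 2 ^ E.w
  | .reg _ => True
  | .arr _ e => e.Ok E s ∧ e.eval E s ≤ E.n
  | .add e₁ e₂ => e₁.Ok E s ∧ e₂.Ok E s ∧ e₁.eval E s + e₂.eval E s < 2 ^ E.w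
  | .sub e₁ e₂ => e₁.Ok E s ∧ e₂.Ok E s ∧ e₁.eval E s - e₂.eval E s < 2 ^ E.w
  | .mul e₁ e₂ => e₁.Ok E s ∧ e₂.Ok E s ∧ e₁.eval E s * e₂.eval E s < 2 ^ E.w
  | .div e₁ e₂ => e₁.Ok E s ∧ e₂.Ok E s ∧ e₁.eval E s / e₂.eval E s < 2 ^ E.w
  | .lt e₁ e₂ => e₁.Ok E s ∧ e₂.Ok E s
  | .and e₁ e₂ => e₁.Ok E s ∧ e₂.Ok E s
  | .keyLt e₁ e₂ => e₁.Ok E s ∧ e₂.Ok E s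

/-- The address of a cell of an array, given the length of the input in register 0. -/
def cellExpr (r : Fin 9) (e : Expr (k + 1)) : Expr (k + 1) :=
  .add (.mul (.const r) (.add (.reg 0) (.const 1))) e

/-- Compilation of expressions. -/
def AExpr.toExpr : AExpr (k + 1) → Expr (k + 1)
  | .const c => .const c
  | .reg x => .reg x
  | .arr r e => .load (cellExpr r e.toExpr)
  | .add e₁ e₂ => .add e₁.toExpr e₂.toExpr
  | .sub e₁ e₂ => .sub e₁.toExpr e₂.toExpr
  | .mul e₁ e₂ => .mul e₁.toExpr e₂.toExpr
  | .div e₁ e₂ => .div e₁.toExpr e₂.toExpr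
  | .lt e₁ e₂ => .lt e₁.toExpr e₂.toExpr
  | .and e₁ e₂ => .mul (.lt (.const 0) e₁.toExpr) (.lt (.const 0) e₂.toExpr)
  | .keyLt e₁ e₂ => .keyLt e₁.toExpr e₂.toExpr

/-- The number of operations that evaluating a compiled expression takes. -/
def AExpr.cost (e : AExpr (k + 1)) : ℕ := e.toExpr.cost

/-- Compilation of commands. -/
def ACmd.toCmd : ACmd (k + 1) → Cmd (k + 1)
  | .skip => .skip
  | .assign x e => .assign x e.toExpr
  | .store r i e => .store (cellExpr r i.toExpr) e.toExpr
  | .train lo hi r a m => .train lo.toExpr hi.toExpr (cellExpr r a.toExpr) m.toExpr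
  | .query x e => .query x e.toExpr
  | .emit e => .emit e.toExpr
  | .seq p q => .seq p.toCmd q.toCmd
  | .ite e p q => .ite e.toExpr p.toCmd q.toCmd
  | .while e p => .while e.toExpr p.toCmd

/-! ### Frame conditions. -/

/-- The registers that a command may write to. -/
def ACmd.writesReg (x : Fin k) : ACmd k → Bool
  | .assign y _ => x == y
  | .query y _ => x == y
  | .seq p q => p.writesReg x || q.writesReg x
  | .ite _ p q => p.writesReg x || q.writesReg x
  | .while _ p => p.writesReg x
  | _ => false

/-- The arrays that a command may write to. -/
def ACmd.writesArr (r : Fin 9) : ACmd k → Bool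
  | .store r' _ _ => r == r'
  | .seq p q => p.writesArr r || q.writesArr r
  | .ite _ p q => p.writesArr r || q.writesArr r
  | .while _ p => p.writesArr r
  | _ => false

/-- Whether a command may train a model. -/
def ACmd.trains : ACmd k → Bool
  | .train .. => true
  | .seq p q => p.trains || q.trains
  | .ite _ p q => p.trains || q.trains
  | .while _ p => p.trains
  | _ => false

/-- Whether a command may write to the output. -/
def ACmd.emits : ACmd k → Bool
  | .emit .. => true
  | .seq p q => p.emits || q.emits
  | .ite _ p q => p.emits || q.emits
  | .while _ p => p.emits
  | _ => false

/-- What the command does not write to is unchanged. -/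
structure Frame (p : ACmd k) (s s' : AState k) : Prop where
  reg : ∀ x, p.writesReg x = false → s'.reg x = s.reg x
  arr : ∀ r, p.writesArr r = false → s'.arr r = s.arr r
  model : p.trains = false → s'.model = s.model
  peak : p.trains = false → s'.peak = s.peak
  out : p.emits = false → s'.out = s.out

theorem Frame.refl (p : ACmd k) (s : AState k) : Frame p s s := by
  constructor <;> intros <;> rfl

theorem Frame.trans {p : ACmd k} {s s' s'' : AState k} (h : Frame p s s') (h' : Frame p s' s'') :
    Frame p s s'' where
  reg x hx := (h'.reg x hx).trans (h.reg x hx)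
  arr x hx := (h'.arr x hx).trans (h.arr x hx)
  model hx := (h'.model hx).trans (h.model hx)
  peak hx := (h'.peak hx).trans (h.peak hx)
  out hx := (h'.out hx).trans (h.out hx)

theorem Frame.seq {p q : ACmd k} {s s' s'' : AState k} (h : Frame p s s') (h' : Frame q s' s'') :
    Frame (.seq p q) s s'' where
  reg x hx := by
    simp only [ACmd.writesReg, Bool.or_eq_false_iff] at hx
    exact (h'.reg x hx.2).trans (h.reg x hx.1)
  arr x hx := by
    simp only [ACmd.writesArr, Bool.or_eq_false_iff] at hx
    exact (h'.arr x hx.2).trans (h.arr x hx.1)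
  model hx := by
    simp only [ACmd.trains, Bool.or_eq_false_iff] at hx
    exact (h'.model hx.2).trans (h.model hx.1)
  peak hx := by
    simp only [ACmd.trains, Bool.or_eq_false_iff] at hx
    exact (h'.peak hx.2).trans (h.peak hx.1)
  out hx := by
    simp only [ACmd.emits, Bool.or_eq_false_iff] at hx
    exact (h'.out hx.2).trans (h.out hx.1)

theorem Frame.ite_left {e : AExpr k} {p q : ACmd k} {s s' : AState k} (h : Frame p s s') :
    Frame (.ite e p q) s s' where
  reg x hx := by
    simp only [ACmd.writesReg, Bool.or_eq_false_iff] at hx; exact h.reg x hx.1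
  arr x hx := by
    simp only [ACmd.writesArr, Bool.or_eq_false_iff] at hx; exact h.arr x hx.1
  model hx := by
    simp only [ACmd.trains, Bool.or_eq_false_iff] at hx; exact h.model hx.1
  peak hx := by
    simp only [ACmd.trains, Bool.or_eq_false_iff] at hx; exact h.peak hx.1
  out hx := by
    simp only [ACmd.emits, Bool.or_eq_false_iff] at hx; exact h.out hx.1

theorem Frame.ite_right {e : AExpr k} {p q : ACmd k} {s s' : AState k} (h : Frame q s s') :
    Frame (.ite e p q) s s' where
  reg x hx := by
    simp only [ACmd.writesReg, Bool.or_eq_false_iff] at hx; exact h.reg x hx.2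
  arr x hx := by
    simp only [ACmd.writesArr, Bool.or_eq_false_iff] at hx; exact h.arr x hx.2
  model hx := by
    simp only [ACmd.trains, Bool.or_eq_false_iff] at hx; exact h.model hx.2
  peak hx := by
    simp only [ACmd.trains, Bool.or_eq_false_iff] at hx; exact h.peak hx.2
  out hx := by
    simp only [ACmd.emits, Bool.or_eq_false_iff] at hx; exact h.out hx.2

theorem Frame.while {e : AExpr k} {p : ACmd k} {s s' : AState k} (h : Frame p s s') :
    Frame (.while e p) s s' :=
  ⟨fun x hx => h.reg x hx, fun x hx => h.arr x hx, fun hx => h.model hx, fun hx => h.peak hx,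
    fun hx => h.out hx⟩

theorem Frame.setReg (s : AState k) (x : Fin k) (e : AExpr k) (v : ℕ) :
    Frame (.assign x e) s (s.setReg x v) := by
  constructor <;> intros <;> try rfl
  rename_i y hy
  simp only [ACmd.writesReg, beq_eq_false_iff_ne, ne_eq] at hy
  simp [hy]

/-! ### Soundness of the compilation and the calculus of time budgets. -/

/-- The memory has room for the arrays, and words have room for addresses. -/
structure Env.Roomy (E : Env) : Prop where
  mem : 9 * (E.n + 1) ≤ E.M
  word : E.M < 2 ^ E.w

/-- The machine state `σ` represents the state `s` with arrays. -/
structure Rep (E : Env) (σ : State (k + 1)) (s : AState (k + 1)) : Prop where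
  reg : σ.reg = s.reg
  reg_zero : s.reg 0 = E.n
  arr : ∀ (r : Fin 9) (i : ℕ), i ≤ E.n → σ.mem (r * (E.n + 1) + i) = s.arr r i
  model : σ.model = s.model
  out : σ.out = s.out
  peak : σ.peak = s.peak

theorem Rep.tick {E : Env} {σ : State (k + 1)} {s : AState (k + 1)} (h : Rep E σ s) (t : ℕ) :
    Rep E (σ.tick t) s := ⟨h.reg, h.reg_zero, h.arr, h.model, h.out, h.peak⟩

theorem cell_lt {n i : ℕ} (r : Fin 9) (hi : i ≤ n) : r * (n + 1) + i < 9 * (n + 1) := by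
  have : (r : ℕ) + 1 ≤ 9 := r.isLt
  nlinarith

/-- Row and column are quotient and remainder of the address modulo `n + 1`. -/
theorem cell_inj {n i i' : ℕ} {r r' : Fin 9} (hi : i ≤ n) (hi' : i' ≤ n)
    (h : r * (n + 1) + i = r' * (n + 1) + i') : r = r' ∧ i = i' := by
  have h1 : (r * (n + 1) + i) / (n + 1) = r := by
    rw [mul_comm, Nat.mul_add_div (by omega), Nat.div_eq_of_lt (by omega), add_zero]
  have h2 : (r' * (n + 1) + i') / (n + 1) = r' := by
    rw [mul_comm, Nat.mul_add_div (by omega), Nat.div_eq_of_lt (by omega), add_zero]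
  have h3 : (r : ℕ) = r' := by rw [← h1, h, h2]
  refine ⟨Fin.ext h3, ?_⟩
  rw [h3] at h
  omega

section sound
variable {E : Env} {σ : State (k + 1)} {s : AState (k + 1)}

theorem Env.word_eq {v : ℕ} (h : v < 2 ^ E.w) : E.word v = v := Nat.mod_eq_of_lt h

/-- All intermediate results are at most the memory size, which is below `2 ^ w`, so that no
reduction modulo the word length takes place. -/
theorem cellExpr_val (hE : E.Roomy) (h : Rep E σ s) (r : Fin 9) (e : Expr (k + 1)) {i : ℕ}
    (he : e.val E σ = i) (hi : i ≤ E.n) : (cellExpr r e).val E σ = r * (E.n + 1) + i := by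
  have h1 := hE.mem
  have h2 := hE.word
  have h3 := cell_lt r hi
  have hr := r.isLt
  have h4 : (r : ℕ) * (E.n + 1) ≤ r * (E.n + 1) + i := Nat.le_add_right _ _
  have h0 : σ.reg 0 = E.n := by rw [h.reg, h.reg_zero]
  simp only [cellExpr, Expr.val, he, h0]
  rw [Env.word_eq (v := 1) (by omega), Env.word_eq (v := (r : ℕ)) (by omega),
    Env.word_eq (v := E.n + 1) (by omega), Env.word_eq (v := _ * _) (by omega),
    Env.word_eq (by omega)]

theorem AExpr.val_eq (hE : E.Roomy) (h : Rep E σ s) (e : AExpr (k + 1)) (he : e.Ok E s) :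
    e.toExpr.val E σ = e.eval E s := by
  have h1 := hE.mem
  have h2 := hE.word
  induction e with
  | const c => exact Env.word_eq he
  | reg x => simp [AExpr.toExpr, Expr.val, AExpr.eval, h.reg]
  | arr r e ih =>
    have := cell_lt r he.2
    simp only [AExpr.toExpr, Expr.val, AExpr.eval, cellExpr_val hE h r _ (ih he.1) he.2, Env.read]
    rw [if_pos (by omega), h.arr r _ he.2]
  | add a b iha ihb =>
    simp only [AExpr.toExpr, Expr.val, AExpr.eval, iha he.1, ihb he.2.1]
    exact Env.word_eq he.2.2
  | sub a b iha ihb =>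
    simp only [AExpr.toExpr, Expr.val, AExpr.eval, iha he.1, ihb he.2.1]
    exact Env.word_eq he.2.2
  | mul a b iha ihb =>
    simp only [AExpr.toExpr, Expr.val, AExpr.eval, iha he.1, ihb he.2.1]
    exact Env.word_eq he.2.2
  | div a b iha ihb =>
    simp only [AExpr.toExpr, Expr.val, AExpr.eval, iha he.1, ihb he.2.1]
    exact Env.word_eq he.2.2
  | lt a b iha ihb =>
    simp only [AExpr.toExpr, Expr.val, AExpr.eval, iha he.1, ihb he.2]
    exact Env.word_eq (by split_ifs <;> omega)
  | and a b iha ihb =>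
    simp only [AExpr.toExpr, Expr.val, AExpr.eval, iha he.1, ihb he.2,
      Env.word_eq (E := E) (v := 0) (by omega), Nat.pos_iff_ne_zero]
    rw [Env.word_eq (v := ite _ _ _) (by split_ifs <;> omega),
      Env.word_eq (v := ite _ _ _) (by split_ifs <;> omega)]
    rw [Env.word_eq]
    · split_ifs <;> simp_all
    · split_ifs <;> omega
  | keyLt a b iha ihb =>
    simp only [AExpr.toExpr, Expr.val, AExpr.eval, iha he.1, ihb he.2]
    exact Env.word_eq (by split_ifs <;> omega)

/-- Started in `s`, the compiled command halts within `t` operations in a state with `Q`. -/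
def wp (E : Env) (p : ACmd (k + 1)) (t : ℕ) (Q : AState (k + 1) → Prop) (s : AState (k + 1)) :
    Prop :=
  ∀ σ, Rep E σ s → ∃ τ s', Exec E p.toCmd σ τ ∧ Rep E τ s' ∧ Frame p s s' ∧ Q s' ∧
    τ.time ≤ σ.time + t

variable {p q : ACmd (k + 1)} {t t' : ℕ} {Q Q' : AState (k + 1) → Prop}

/-- The frame is available in the implication; postconditions therefore need to mention only what a
command changes. -/
theorem wp.mono (h : wp E p t Q s) (ht : t ≤ t') (hQ : ∀ s', Frame p s s' → Q s' → Q' s') :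
    wp E p t' Q' s := by
  intro σ hσ
  obtain ⟨τ, s', h1, h2, h3, h4, h5⟩ := h σ hσ
  exact ⟨τ, s', h1, h2, h3, hQ s' h3 h4, by omega⟩

theorem wp_seq (h : wp E p t (fun s' => wp E q t' Q s') s) : wp E (.seq p q) (t + t') Q s := by
  intro σ hσ
  obtain ⟨τ, s', h1, h2, h3, h4, h5⟩ := h σ hσ
  obtain ⟨τ', s'', g1, g2, g3, g4, g5⟩ := h4 τ h2
  exact ⟨τ', s'', .seq h1 g1, g2, h3.seq g3, g4, by omega⟩

theorem wp_assign (hE : E.Roomy) {x : Fin (k + 1)} {e : AExpr (k + 1)} (hx : x ≠ 0)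
    (he : e.Ok E s) (hQ : Q (s.setReg x (e.eval E s))) :
    wp E (.assign x e) (e.cost + 1) Q s := by
  intro σ hσ
  refine ⟨_, s.setReg x (e.eval E s), .assign σ x e.toExpr, ?_, Frame.setReg _ _ _ _, hQ, ?_⟩
  · refine Rep.tick ?_ _
    refine ⟨?_, ?_, hσ.arr, hσ.model, hσ.out, hσ.peak⟩
    · simp [State.setReg, AState.setReg, e.val_eq hE hσ he, hσ.reg]
    · simp [hx.symm, hσ.reg_zero]
  · simp [State.tick, State.setReg, AExpr.cost]

theorem wp_store (hE : E.Roomy) {r : Fin 9} {i e : AExpr (k + 1)} (hi : i.Ok E s)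
    (he : e.Ok E s) (hin : i.eval E s ≤ E.n) (hQ : Q (s.setArr r (i.eval E s) (e.eval E s))) :
    wp E (.store r i e) (i.cost + e.cost + 7) Q s := by
  intro σ hσ
  have h1 := hE.mem
  have h3 := cell_lt r hin
  refine ⟨_, s.setArr r (i.eval E s) (e.eval E s), .store σ _ e.toExpr, ?_, ?_, hQ, ?_⟩
  · refine Rep.tick ?_ _
    rw [e.val_eq hE hσ he, cellExpr_val hE hσ r _ (i.val_eq hE hσ hi) hin, Env.write,
      if_pos (by omega)]
    refine ⟨hσ.reg, hσ.reg_zero, fun r' j hj => ?_, hσ.model, hσ.out, hσ.peak⟩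
    by_cases hrj : r' = r ∧ j = i.eval E s
    · obtain ⟨rfl, rfl⟩ := hrj
      simp
    · have : (r' : ℕ) * (E.n + 1) + j ≠ r * (E.n + 1) + i.eval E s :=
        fun h => hrj (cell_inj hj hin h)
      simp only [AState.arr_setArr]
      rw [Function.update_of_ne this, hσ.arr r' j hj]
      by_cases hr : r' = r
      · subst hr
        have : j ≠ i.eval E s := fun h => hrj ⟨rfl, h⟩
        simp [this]
      · simp [hr]
  · constructor <;> intros <;> try rfl
    rename_i y hy
    simp only [ACmd.writesArr, beq_eq_false_iff_ne, ne_eq] at hy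
    simp [hy]
  · have ht : ∀ a v, (E.write σ a v).time = σ.time := fun a v => by
      rw [Env.write]; split_ifs <;> rfl
    simp only [State.tick, ht, AExpr.cost, cellExpr, Expr.cost]
    omega

theorem wp_emit (hE : E.Roomy) {e : AExpr (k + 1)} (he : e.Ok E s)
    (hQ : Q (s.emit (E.key (e.eval E s)))) : wp E (.emit e) (e.cost + 1) Q s := by
  intro σ hσ
  refine ⟨_, s.emit (E.key (e.eval E s)), .emit σ e.toExpr, ?_, ?_, hQ, ?_⟩
  · refine Rep.tick ?_ _
    refine ⟨hσ.reg, hσ.reg_zero, hσ.arr, hσ.model, ?_, hσ.peak⟩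
    simp [e.val_eq hE hσ he, hσ.out]
  · constructor <;> intros <;> first | rfl | simp_all [ACmd.emits]
  · simp [State.tick, AExpr.cost]

theorem wp_skip (hQ : Q s) : wp E .skip 1 Q s := fun σ hσ =>
  ⟨_, s, .skip σ, hσ.tick 1, Frame.refl _ _, hQ, le_rfl⟩

/-- The state after training a model. -/
noncomputable def AState.train (E : Env) (s : AState k) (lo hi : ℕ) (r : Fin 9) (a m : ℕ) :
    AState k :=
  let D : Fin m → ℝ := fun j => rescale (E.key lo) (E.key hi) (E.key (s.arr r (a + j)))
  { s with model := ⟨m, D, E.key lo, E.key hi⟩, peak := max s.peak (E.L.modelSize m D) }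

/-- The machine reads the sample from consecutive memory cells; by `ham` these stay within one row.
-/
theorem wp_train (hE : E.Roomy) {lo hi a m : AExpr (k + 1)} {r : Fin 9} (hlo : lo.Ok E s)
    (hhi : hi.Ok E s) (ha : a.Ok E s) (hm : m.Ok E s) (ham : a.eval E s + m.eval E s ≤ E.n)
    (hQ : Q (s.train E (lo.eval E s) (hi.eval E s) r (a.eval E s) (m.eval E s))) :
    wp E (.train lo hi r a m) (lo.cost + hi.cost + a.cost + m.cost + 7 + m.eval E s +
      E.L.trainTime (m.eval E s) (fun j => rescale (E.key (lo.eval E s)) (E.key (hi.eval E s))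
        (E.key (s.arr r (a.eval E s + j))))) Q s := by
  intro σ hσ
  have hF : E.newModel σ (lo.toExpr.val E σ) (hi.toExpr.val E σ)
      ((cellExpr r a.toExpr).val E σ) (m.toExpr.val E σ) =
      (s.train E (lo.eval E s) (hi.eval E s) r (a.eval E s) (m.eval E s)).model := by
    rw [lo.val_eq hE hσ hlo, hi.val_eq hE hσ hhi, m.val_eq hE hσ hm,
      cellExpr_val hE hσ r _ (a.val_eq hE hσ ha) (by omega)]
    simp only [Env.newModel, AState.train, Model.mk.injEq, heq_eq_eq, true_and, and_true]
    funext j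
    have hj : a.eval E s + j ≤ E.n := by omega
    have h1 := cell_lt r hj
    have h2 := hE.mem
    rw [add_assoc, Env.read, if_pos (by omega), hσ.arr r _ hj]
  refine ⟨_, _, .train σ _ _ _ _, ?_, ?_, hQ, ?_⟩
  · refine Rep.tick ?_ _
    rw [Env.train, hF]
    exact ⟨hσ.reg, hσ.reg_zero, hσ.arr, rfl, hσ.out, by simp [AState.train, hσ.peak]⟩
  · constructor <;> intros <;> first | rfl | simp_all [ACmd.trains]
  · rw [Env.train, hF]
    simp only [State.tick, AState.train, m.val_eq hE hσ hm, AExpr.cost, cellExpr, Expr.cost]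
    omega

/-- The sample size occurs in the type of the sample, where it is awkward to rewrite; here the
values are variables from the start. -/
theorem wp_train_of_eq (hE : E.Roomy) {lo hi a m : AExpr (k + 1)} {r : Fin 9} {vl vh va vm : ℕ}
    (hlo : lo.Ok E s) (hhi : hi.Ok E s) (ha : a.Ok E s) (hm : m.Ok E s) (h₁ : lo.eval E s = vl)
    (h₂ : hi.eval E s = vh) (h₃ : a.eval E s = va) (h₄ : m.eval E s = vm) (ham : va + vm ≤ E.n)
    (hQ : Q (s.train E vl vh r va vm)) :
    wp E (.train lo hi r a m) (lo.cost + hi.cost + a.cost + m.cost + 7 + vm +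
      E.L.trainTime vm (fun j => rescale (E.key vl) (E.key vh) (E.key (s.arr r (va + j))))) Q s := by
  subst h₁ h₂ h₃ h₄
  exact wp_train hE hlo hhi ha hm ham hQ

theorem wp_query (hE : E.Roomy) {x : Fin (k + 1)} {e : AExpr (k + 1)} (hx : x ≠ 0)
    (he : e.Ok E s) (hm : s.model.m < 2 ^ E.w)
    (hQ : Q (s.setReg x (min s.model.m ⌊E.L.fit s.model.m s.model.D
      (rescale s.model.lo s.model.hi (E.key (e.eval E s)))⌋₊))) :
    wp E (.query x e) (e.cost + 1 + E.L.evalTime s.model.m s.model.D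
      (rescale s.model.lo s.model.hi (E.key (e.eval E s)))) Q s := by
  intro σ hσ
  have hw : E.word (min s.model.m ⌊E.L.fit s.model.m s.model.D
      (rescale s.model.lo s.model.hi (E.key (e.eval E s)))⌋₊) = _ :=
    Env.word_eq ((min_le_left _ _).trans_lt hm)
  have hq : E.query σ x (e.toExpr.val E σ) = (σ.setReg x (min s.model.m ⌊E.L.fit s.model.m
      s.model.D (rescale s.model.lo s.model.hi (E.key (e.eval E s)))⌋₊)).tick
        (E.L.evalTime s.model.m s.model.D
          (rescale s.model.lo s.model.hi (E.key (e.eval E s)))) := by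
    rw [Env.query, hσ.model, e.val_eq hE hσ he, hw]
  refine ⟨_, _, .query σ x e.toExpr, ?_, ?_, hQ, ?_⟩
  · rw [hq]
    refine Rep.tick (Rep.tick ?_ _) _
    refine ⟨?_, ?_, hσ.arr, hσ.model, hσ.out, hσ.peak⟩
    · simp [State.setReg, AState.setReg, hσ.reg]
    · simp [hx.symm, hσ.reg_zero]
  · constructor <;> intros <;> try rfl
    rename_i y hy
    simp only [ACmd.writesReg, beq_eq_false_iff_ne, ne_eq] at hy
    simp [hy]
  · rw [hq]
    simp only [State.tick, State.setReg, AExpr.cost]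
    omega

theorem wp_ite (hE : E.Roomy) {e : AExpr (k + 1)} (he : e.Ok E s)
    (hp : e.eval E s ≠ 0 → wp E p t Q s) (hq : e.eval E s = 0 → wp E q t Q s) :
    wp E (.ite e p q) (t + (e.cost + 1)) Q s := by
  intro σ hσ
  have hv := e.val_eq hE hσ he
  by_cases h : e.eval E s = 0
  · obtain ⟨τ, s', h1, h2, h3, h4, h5⟩ := hq h _ (hσ.tick (e.cost + 1))
    refine ⟨τ, s', .ite_false (hv.trans h) h1, h2, h3.ite_right, h4, ?_⟩
    simp only [State.tick] at h5
    omega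
  · obtain ⟨τ, s', h1, h2, h3, h4, h5⟩ := hp h _ (hσ.tick (e.cost + 1))
    refine ⟨τ, s', .ite_true (by rwa [hv]) h1, h2, h3.ite_left, h4, ?_⟩
    simp only [State.tick] at h5
    omega

/-- Loops: the invariant `I b s` says that a budget of `b` operations suffices from the state `s`
on. -/
theorem wp_while (hE : E.Roomy) {e : AExpr (k + 1)} (I : ℕ → AState (k + 1) → Prop) {b₀ : ℕ}
    {s₀ : AState (k + 1)} (h₀ : I b₀ s₀)
    (he : ∀ b s, Frame p s₀ s → I b s → e.Ok E s)
    (hstep : ∀ b s, Frame p s₀ s → I b s → e.eval E s ≠ 0 →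
      ∃ t, wp E p t (fun s' => ∃ b', t + b' + (e.cost + 1) ≤ b ∧ I b' s') s)
    (hexit : ∀ b s, Frame p s₀ s → I b s → e.eval E s = 0 → e.cost + 1 ≤ b ∧ Q s) :
    wp E (.while e p) b₀ Q s₀ := by
  suffices H : ∀ b s, Frame p s₀ s → I b s → ∀ σ, Rep E σ s → ∃ τ s',
      Exec E (ACmd.while e p).toCmd σ τ ∧ Rep E τ s' ∧ Frame p s₀ s' ∧ Q s' ∧
        τ.time ≤ σ.time + b by
    intro σ hσ
    obtain ⟨τ, s', h1, h2, h3, h4, h5⟩ := H b₀ s₀ (Frame.refl _ _) h₀ σ hσ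
    exact ⟨τ, s', h1, h2, h3.while, h4, h5⟩
  intro b
  -- Each round spends at least the cost of its test, so the remaining budget decreases and
  -- termination comes with the time bound.
  induction b using Nat.strong_induction_on with
  | _ b ih =>
    intro s hF hI σ hσ
    have hv := e.val_eq hE hσ (he b s hF hI)
    by_cases h : e.eval E s = 0
    · obtain ⟨h1, h2⟩ := hexit b s hF hI h
      refine ⟨_, s, .while_false (hv.trans h), hσ.tick _, hF, h2, ?_⟩
      simp only [State.tick, AExpr.cost] at *
      omega
    · obtain ⟨t, ht⟩ := hstep b s hF hI h
      obtain ⟨τ, s', h1, h2, h3, ⟨b', h4, h4'⟩, h5⟩ := ht _ (hσ.tick (e.cost + 1))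
      obtain ⟨τ', s'', g1, g2, g3, g4, g5⟩ := ih b' (by omega) s' (hF.trans h3) h4' τ h2
      refine ⟨τ', s'', .while_true (by rwa [hv]) h1 g1, g2, g3, g4, ?_⟩
      simp only [State.tick] at h5
      omega

/-- The verification condition of a command without loops and models. -/
def ACmd.vc (E : Env) : ACmd (k + 1) → (AState (k + 1) → Prop) → AState (k + 1) → Prop
  | .skip, Q, s => Q s
  | .assign x e, Q, s => x ≠ 0 ∧ e.Ok E s ∧ Q (s.setReg x (e.eval E s))
  | .store r i e, Q, s => i.Ok E s ∧ e.Ok E s ∧ i.eval E s ≤ E.n ∧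
      Q (s.setArr r (i.eval E s) (e.eval E s))
  | .emit e, Q, s => e.Ok E s ∧ Q (s.emit (E.key (e.eval E s)))
  | .seq p q, Q, s => p.vc E (q.vc E Q) s
  | .ite e p q, Q, s => e.Ok E s ∧ (e.eval E s ≠ 0 → p.vc E Q s) ∧
      (e.eval E s = 0 → q.vc E Q s)
  | _, _, _ => False

/-- The largest number of operations that a command without loops and models may take. -/
def ACmd.maxCost : ACmd (k + 1) → ℕ
  | .skip => 1
  | .assign _ e => e.cost + 1
  | .store _ i e => i.cost + e.cost + 7
  | .emit e => e.cost + 1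
  | .seq p q => p.maxCost + q.maxCost
  | .ite e p q => max p.maxCost q.maxCost + (e.cost + 1)
  | _ => 0

/-- Turns loop-free code into a single proposition, which unfolding and linear arithmetic can
settle; the budget takes the more expensive branch everywhere. -/
theorem wp_of_vc (hE : E.Roomy) (p : ACmd (k + 1)) {Q : AState (k + 1) → Prop}
    {s : AState (k + 1)} (h : p.vc E Q s) : wp E p p.maxCost Q s := by
  induction p generalizing Q s with
  | skip => exact wp_skip h
  | assign x e => exact wp_assign hE h.1 h.2.1 h.2.2
  | store r i e => exact wp_store hE h.1 h.2.1 h.2.2.1 h.2.2.2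
  | emit e => exact wp_emit hE h.1 h.2
  | seq p q ihp ihq => exact wp_seq ((ihp h).mono le_rfl fun s' _ hs' => ihq hs')
  | ite e p q ihp ihq =>
    exact wp_ite hE h.1 (fun he => (ihp (h.2.1 he)).mono (le_max_left _ _) fun _ _ h => h)
      (fun he => (ihq (h.2.2 he)).mono (le_max_right _ _) fun _ _ h => h)
  | _ => exact h.elim

end sound

/-! ### Counting loops. -/

section forloop
variable {k : ℕ} {E : Env}

/-- `for x in x .. y - 1 do body`. -/
def ACmd.forUp (x y : Fin k) (body : ACmd k) : ACmd k :=
  .while (.lt (.reg x) (.reg y)) (.seq body (.assign x (.add (.reg x) (.const 1))))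

/-- Since the body writes neither the counter nor the limit, the number of rounds is known in
advance. The test and the increment take 4 operations each, whence 8 per round and 4 for the last
test. By `hJ`, the invariant speaks about the counter only through its index. -/
theorem wp_forUp (hE : E.Roomy) {x y : Fin (k + 1)} {body : ACmd (k + 1)} (hx : x ≠ 0)
    (hxy : y ≠ x) (hxb : body.writesReg x = false) (hyb : body.writesReg y = false)
    (J : ℕ → AState (k + 1) → Prop) (c : ℕ → ℕ) {a b : ℕ} {s₀ : AState (k + 1)}
    (ha : s₀.reg x = a) (hb : s₀.reg y = b) (hab : a ≤ b) (hbw : b < 2 ^ E.w) (h₀ : J a s₀)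
    (hJ : ∀ i s v, J i s → J i (s.setReg x v))
    (hstep : ∀ i s, a ≤ i → i < b → Frame (.forUp x y body) s₀ s → s.reg x = i → J i s →
      wp E body (c i) (J (i + 1)) s) :
    wp E (.forUp x y body) (∑ i ∈ Finset.Ico a b, (c i + 8) + 4)
      (fun s => J b s ∧ s.reg x = b) s₀ := by
  have hcond : (AExpr.lt (.reg x) (.reg y)).cost = 3 := rfl
  have hinc : (AExpr.add (.reg x) (.const 1)).cost = 3 := rfl
  have h1w : 1 < 2 ^ E.w := lt_of_le_of_lt (by have := hE.mem; omega) hE.word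
  refine wp_while hE (fun B s => ∃ i, a ≤ i ∧ i ≤ b ∧ s.reg x = i ∧ J i s ∧
    ∑ i ∈ Finset.Ico i b, (c i + 8) + 4 ≤ B) ⟨a, le_rfl, hab, ha, h₀, le_rfl⟩ ?_ ?_ ?_
  · intros; exact ⟨trivial, trivial⟩
  · rintro B s hF ⟨i, hai, hib, hi, hJi, hB⟩ he
    have hy : s.reg y = b := by
      rw [hF.reg y (by simp [ACmd.writesReg, hyb, hxy]), hb]
    have hlt : i < b := by
      by_contra hcon
      exact he (by simp [AExpr.eval, hi, hy, hcon])
    refine ⟨c i + 4, wp_seq ((hstep i s hai hlt hF.while hi hJi).mono le_rfl ?_)⟩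
    intro s' hF' hJ'
    have hi' : s'.reg x = i := by rw [hF'.reg x hxb, hi]
    refine wp_assign hE hx ⟨trivial, h1w, ?_⟩ ?_
    · simp only [AExpr.eval, hi']; omega
    · refine ⟨∑ i ∈ Finset.Ico (i + 1) b, (c i + 8) + 4, ?_, i + 1, by omega, hlt, ?_,
        hJ _ _ _ hJ', le_rfl⟩
      · rw [Finset.sum_eq_sum_Ico_succ_bot hlt] at hB
        rw [hcond]; omega
      · simp [AExpr.eval, hi']
  · rintro B s hF ⟨i, hai, hib, hi, hJi, hB⟩ he
    have hy : s.reg y = b := by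
      rw [hF.reg y (by simp [ACmd.writesReg, hyb, hxy]), hb]
    have : i = b := by
      by_contra hcon
      have : i < b := by omega
      simp [AExpr.eval, hi, hy, this] at he
    subst this
    exact ⟨by rw [hcond]; omega, hJi, hi⟩

theorem wp_forUp_const (hE : E.Roomy) {x y : Fin (k + 1)} {body : ACmd (k + 1)} (hx : x ≠ 0)
    (hxy : y ≠ x) (hxb : body.writesReg x = false) (hyb : body.writesReg y = false)
    (J : ℕ → AState (k + 1) → Prop) (c : ℕ) {a b : ℕ} {s₀ : AState (k + 1)}
    (ha : s₀.reg x = a) (hb : s₀.reg y = b) (hab : a ≤ b) (hbw : b < 2 ^ E.w) (h₀ : J a s₀)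
    (hJ : ∀ i s v, J i s → J i (s.setReg x v))
    (hstep : ∀ i s, a ≤ i → i < b → Frame (.forUp x y body) s₀ s → s.reg x = i → J i s →
      wp E body c (J (i + 1)) s) :
    wp E (.forUp x y body) ((b - a) * (c + 8) + 4) (fun s => J b s ∧ s.reg x = b) s₀ :=
  (wp_forUp hE hx hxy hxb hyb J (fun _ => c) ha hb hab hbw h₀ hJ hstep).mono (by simp)
    fun _ _ h => h

end forloop

/-! ### Integer tenth roots -/

/-- The integer part of the tenth root. -/
def root (B : ℕ) : ℕ := Nat.findGreatest (fun v => v ^ 10 ≤ B) B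

theorem root_pow_le (B : ℕ) : root B ^ 10 ≤ B :=
  Nat.findGreatest_spec (P := fun v => v ^ 10 ≤ B) (Nat.zero_le B) (by simp)

theorem lt_root_succ_pow (B : ℕ) : B < (root B + 1) ^ 10 := by
  by_contra h
  push Not at h
  have h1 : root B + 1 ≤ B := (Nat.le_self_pow (by norm_num) _).trans h
  exact Nat.findGreatest_is_greatest (P := fun v => v ^ 10 ≤ B) (Nat.lt_succ_self _) h1 h

theorem le_root {v B : ℕ} (h : v ^ 10 ≤ B) : v ≤ root B := by
  by_contra hlt
  push Not at hlt
  exact absurd (lt_root_succ_pow B) (not_lt.2 ((Nat.pow_le_pow_left hlt 10).trans h))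

/-- The fifth power of an expression. -/
def AExpr.pow5 {k : ℕ} (e : AExpr k) : AExpr k := .mul (.mul (.mul e e) (.mul e e)) e

theorem AExpr.eval_pow5 {k : ℕ} (E : Env) (s : AState k) (e : AExpr k) :
    e.pow5.eval E s = e.eval E s ^ 5 := by simp only [pow5, eval]; ring

theorem AExpr.ok_pow5 {k : ℕ} (E : Env) (s : AState k) (e : AExpr k) (he : e.Ok E s)
    (h0 : 1 ≤ e.eval E s) (h : e.eval E s ^ 5 < 2 ^ E.w) : e.pow5.Ok E s := by
  have key : ∀ i ≤ 5, e.eval E s ^ i < 2 ^ E.w := fun i hi =>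
    (Nat.pow_le_pow_right h0 hi).trans_lt h
  have h2 := key 2 (by norm_num)
  have h4 := key 4 (by norm_num)
  refine ⟨⟨⟨he, he, ?_⟩, ⟨he, he, ?_⟩, ?_⟩, he, ?_⟩
  · rwa [← sq]
  · rwa [← sq]
  · simp only [eval]; convert h4 using 1; ring
  · simp only [eval]; convert h using 1; ring

-- Names of registers and arrays, and the root command.

notation "rN" => (0 : Fin 24)
notation "rThr" => (1 : Fin 24)
notation "rPos" => (2 : Fin 24)
notation "rEnd" => (3 : Fin 24)
notation "rU" => (4 : Fin 24)
notation "rV" => (5 : Fin 24)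
notation "rM" => (6 : Fin 24)
notation "rStep" => (7 : Fin 24)
notation "rCells" => (8 : Fin 24)
notation "rLo" => (9 : Fin 24)
notation "rHi" => (10 : Fin 24)
notation "rB" => (11 : Fin 24)
notation "rF" => (12 : Fin 24)
notation "rWidth" => (13 : Fin 24)
notation "rA" => (14 : Fin 24)
notation "rMid" => (15 : Fin 24)
notation "rH" => (16 : Fin 24)
notation "rI" => (17 : Fin 24)
notation "rJ" => (18 : Fin 24)
notation "rK" => (19 : Fin 24)
notation "rC" => (20 : Fin 24)
notation "rX" => (21 : Fin 24)
notation "rW" => (22 : Fin 24)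
notation "rLim" => (23 : Fin 24)
-- `aP` holds the indices of the entries in their current order, `aS` sorted samples, `aQ` the
-- output of merging; `aEnd`, `aLo`, `aHi`, `aU` hold the header of a bucket at the position of its
-- first entry; `aHead` and `aNext` hold linked lists, one for each cell.
notation "aP" => (0 : Fin 9)
notation "aS" => (1 : Fin 9)
notation "aQ" => (2 : Fin 9)
notation "aEnd" => (3 : Fin 9)
notation "aLo" => (4 : Fin 9)
notation "aHi" => (5 : Fin 9)
notation "aU" => (6 : Fin 9)
notation "aHead" => (7 : Fin 9)
notation "aNext" => (8 : Fin 9)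
infixr:60 " ;; " => ACmd.seq

/-- `v := root B`. -/
def rootCmd : ACmd 24 :=
  .assign rV (.const 0) ;;
  .while (.lt (.mul (AExpr.pow5 (.add (.reg rV) (.const 1))) (AExpr.pow5 (.add (.reg rV) (.const 1))))
      (.add (.reg rB) (.const 1)))
    (.assign rV (.add (.reg rV) (.const 1)))

/-- Words are long enough for the numbers that occur in the algorithm. -/
structure Env.Wide (E : Env) : Prop extends E.Roomy where
  wide : 2 ^ 20 * (E.n + 1) ≤ 2 ^ E.w

/-- A linear search is affordable: the budget of a bucket with parameter `u` contains a multiple of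
`u ^ 10` anyway. -/
theorem wp_rootCmd {E : Env} (hE : E.Wide) {s : AState 24} (hB : s.reg rB ≤ E.n) :
    wp E rootCmd (60 * (root (s.reg rB) + 2)) (fun s' => s'.reg rV = root (s.reg rB)) s := by
  have hw := hE.wide
  have hE' := hE.toRoomy
  -- The search tests one candidate beyond the root; as `v + 1 ≤ 2 * v`, this costs a factor `2 ^
  -- 10`, for which the words have room.
  have hpow : ∀ v, v ^ 10 ≤ s.reg rB → (v + 1) ^ 10 < 2 ^ E.w := by
    intro v hv
    refine lt_of_lt_of_le ?_ hw
    rcases Nat.eq_zero_or_pos v with rfl | h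
    · simp; omega
    · calc (v + 1) ^ 10 ≤ (2 * v) ^ 10 := Nat.pow_le_pow_left (by omega) _
        _ = 2 ^ 10 * v ^ 10 := by ring
        _ < _ := by omega
  have hpow5 : ∀ v, v ^ 10 ≤ s.reg rB → (v + 1) ^ 5 < 2 ^ E.w := fun v hv =>
    (Nat.pow_le_pow_right (by omega) (by norm_num)).trans_lt (hpow v hv)
  have hpow1 : ∀ v, v ^ 10 ≤ s.reg rB → v + 1 < 2 ^ E.w := fun v hv =>
    (Nat.le_self_pow (by norm_num) _).trans_lt (hpow v hv)
  refine (wp_seq (t := 2) (wp_assign hE' (by decide) ?_ (wp_while hE' (fun b s' =>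
    s'.reg rV ^ 10 ≤ s.reg rB ∧ 60 * (root (s.reg rB) - s'.reg rV) + 60 ≤ b)
    (b₀ := 60 * root (s.reg rB) + 60) ?_ ?_ ?_ ?_))).mono (by omega) fun _ _ h => h
  · simp only [AExpr.Ok]; omega
  · simp [AExpr.eval]
  · rintro b s' hF ⟨h1, h2⟩
    have hB' : s'.reg rB = s.reg rB := by rw [hF.reg rB rfl]; rfl
    have h3 := hpow1 _ h1
    refine ⟨⟨?_, ?_, ?_⟩, trivial, ?_, ?_⟩
    · exact AExpr.ok_pow5 _ _ _ ⟨trivial, by simp only [AExpr.Ok]; omega, h3⟩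
        (by simp [AExpr.eval]) (hpow5 _ h1)
    · exact AExpr.ok_pow5 _ _ _ ⟨trivial, by simp only [AExpr.Ok]; omega, h3⟩
        (by simp [AExpr.eval]) (hpow5 _ h1)
    · rw [AExpr.eval_pow5, ← pow_add]; exact hpow _ h1
    · simp only [AExpr.Ok]; omega
    · simp only [AExpr.eval, hB']; omega
  · rintro b s' hF ⟨h1, h2⟩ he
    have hB' : s'.reg rB = s.reg rB := by rw [hF.reg rB rfl]; rfl
    have h3 := hpow1 _ h1
    have h4 : (s'.reg rV + 1) ^ 10 ≤ s.reg rB := by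
      simp only [AExpr.eval, AExpr.eval_pow5, ← pow_add, hB', Nat.reduceAdd] at he
      by_contra hcon
      rw [if_neg (by omega)] at he
      exact he rfl
    have h5 := le_root h4
    refine ⟨_, wp_assign hE' (by decide) ⟨trivial, ?_, h3⟩
      ⟨60 * (root (s.reg rB) - (s'.reg rV + 1)) + 60, ?_, ?_, ?_⟩⟩
    · simp only [AExpr.Ok]; omega
    · have : ∀ a b : ℕ, a = 4 → b + 1 ≤ 56 → a + (60 * (root (s.reg rB) - (s'.reg rV + 1)) + 60) +
          (b + 1) ≤ 60 * (root (s.reg rB) - s'.reg rV) + 60 := by omega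
      exact (this _ _ rfl (by decide)).trans h2
    · simpa [AExpr.eval] using h4
    · simp [AExpr.eval]
  · rintro b s' hF ⟨h1, h2⟩ he
    have hB' : s'.reg rB = s.reg rB := by rw [hF.reg rB rfl]; rfl
    have h4 : s.reg rB < (s'.reg rV + 1) ^ 10 := by
      simp only [AExpr.eval, AExpr.eval_pow5, ← pow_add, hB', Nat.reduceAdd] at he
      by_contra hcon
      rw [if_pos (by omega)] at he
      exact one_ne_zero he
    refine ⟨le_trans ?_ ((Nat.le_add_left 60 _).trans h2), le_antisymm (le_root h1) ?_⟩
    · decide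
    · by_contra hcon
      have := Nat.pow_le_pow_left (show s'.reg rV + 1 ≤ root (s.reg rB) by omega) 10
      have := root_pow_le (s.reg rB)
      omega

/-! ### Array segments -/

/-- The entries `f a, …, f (b - 1)`. -/
def seg (f : ℕ → ℕ) (a b : ℕ) : List ℕ := (List.range' a (b - a)).map f

@[simp] theorem length_seg (f : ℕ → ℕ) (a b : ℕ) : (seg f a b).length = b - a := by simp [seg]

theorem seg_self (f : ℕ → ℕ) (a : ℕ) : seg f a a = [] := by simp [seg]

theorem seg_cons (f : ℕ → ℕ) {a b : ℕ} (h : a < b) : seg f a b = f a :: seg f (a + 1) b := by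
  obtain ⟨d, rfl⟩ := Nat.exists_eq_add_of_lt h
  rw [seg, seg, show a + d + 1 - a = d + 1 by omega, List.range'_succ,
    show a + d + 1 - (a + 1) = d by omega]
  rfl

theorem seg_append (f : ℕ → ℕ) {a b c : ℕ} (h : a ≤ b) (h' : b ≤ c) :
    seg f a c = seg f a b ++ seg f b c := by
  rw [seg, seg, seg, ← List.map_append, show List.range' b (c - b) = List.range' (a + (b - a))
    (c - b) by congr 1; omega, List.range'_append_1]
  congr 2; omega

theorem seg_succ (f : ℕ → ℕ) {a b : ℕ} (h : a ≤ b) : seg f a (b + 1) = seg f a b ++ [f b] := by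
  rw [seg_append f h (Nat.le_succ b), seg_cons f (Nat.lt_succ_self b), seg_self]

theorem seg_congr {f g : ℕ → ℕ} {a b : ℕ} (h : ∀ i, a ≤ i → i < b → f i = g i) :
    seg f a b = seg g a b := by
  refine List.map_congr_left fun i hi => ?_
  rw [List.mem_range'_1] at hi
  exact h i hi.1 (by omega)

theorem seg_update (f : ℕ → ℕ) {a b i : ℕ} (v : ℕ) (h : i < a ∨ b ≤ i) :
    seg (Function.update f i v) a b = seg f a b :=
  seg_congr fun j _ _ => Function.update_of_ne (by omega) _ _

theorem seg_update_succ (f : ℕ → ℕ) {a b : ℕ} (v : ℕ) (h : a ≤ b) :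
    seg (Function.update f b v) a (b + 1) = seg f a b ++ [v] := by
  rw [seg_succ _ h, seg_update _ _ (.inr le_rfl), Function.update_self]

theorem mem_seg {f : ℕ → ℕ} {a b x : ℕ} : x ∈ seg f a b ↔ ∃ i, a ≤ i ∧ i < b ∧ f i = x := by
  simp only [seg, List.mem_map, List.mem_range'_1]
  constructor
  · rintro ⟨i, ⟨h1, h2⟩, h3⟩; exact ⟨i, h1, by omega, h3⟩
  · rintro ⟨i, h1, h2, h3⟩; exact ⟨i, ⟨h1, by omega⟩, h3⟩

theorem seg_getElem (f : ℕ → ℕ) {a b i : ℕ} (h : i < (seg f a b).length) :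
    (seg f a b)[i] = f (a + i) := by
  simp [seg]

theorem pairwise_seg {R : ℕ → ℕ → Prop} {f : ℕ → ℕ} {a b : ℕ} :
    (seg f a b).Pairwise R ↔ ∀ i j, a ≤ i → i < j → j < b → R (f i) (f j) := by
  rw [List.pairwise_iff_getElem]
  constructor
  · intro h i j hi hij hj
    have := h (i - a) (j - a) (by simp; omega) (by simp; omega) (by omega)
    rw [seg_getElem, seg_getElem] at this
    rwa [show a + (i - a) = i by omega, show a + (j - a) = j by omega] at this
  · intro h i j hi hj hij
    rw [seg_getElem, seg_getElem]
    rw [length_seg] at hi hj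
    exact h _ _ (by omega) (by omega) (by omega)

/-! ### Merge sort -/

/-- The order of the input array on indices. -/
noncomputable def Env.le (E : Env) (x y : ℕ) : Bool := decide (E.key x ≤ E.key y)

theorem Env.le_iff {E : Env} {x y : ℕ} : E.le x y = true ↔ E.key x ≤ E.key y := by simp [Env.le]

def mergeStep : ACmd 24 :=
  .ite (.and (.lt (.reg rI) (.reg rMid)) (.lt (.and (.lt (.reg rJ) (.reg rH))
      (.keyLt (.arr aS (.reg rJ)) (.arr aS (.reg rI)))) (.const 1)))
    (.store aQ (.reg rK) (.arr aS (.reg rI)) ;; .assign rI (.add (.reg rI) (.const 1)))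
    (.store aQ (.reg rK) (.arr aS (.reg rJ)) ;; .assign rJ (.add (.reg rJ) (.const 1)))

/-- The invariant: what has been written, followed by the merge of the two remainders, is the merge
of the two halves. Ties are taken from the left, as `List.merge` does. -/
theorem wp_mergeLoop {E : Env} (hE : E.Wide) {s : AState 24} {a mid h : ℕ} (hI : s.reg rI = a)
    (hJ : s.reg rJ = mid) (hK : s.reg rK = a) (hM : s.reg rMid = mid) (hH : s.reg rH = h)
    (h1 : a ≤ mid) (h2 : mid ≤ h) (h3 : h ≤ E.n) :
    wp E (.forUp rK rH mergeStep) ((h - a) * 100 + 4) (fun s' =>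
      seg (s'.arr aQ) a h = (seg (s.arr aS) a mid).merge (seg (s.arr aS) mid h) E.le ∧
      ∀ x, x < a ∨ h ≤ x → s'.arr aQ x = s.arr aQ x) s := by
  have hw := hE.wide
  have hE' := hE.toRoomy
  refine (wp_forUp_const hE' (by decide) (by decide) rfl rfl (fun c s' =>
    ∃ i j, s'.reg rI = i ∧ s'.reg rJ = j ∧ a ≤ i ∧ i ≤ mid ∧ mid ≤ j ∧ j ≤ h ∧ i + j = c + mid ∧
      seg (s'.arr aQ) a c ++ (seg (s.arr aS) i mid).merge (seg (s.arr aS) j h) E.le =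
        (seg (s.arr aS) a mid).merge (seg (s.arr aS) mid h) E.le ∧
      ∀ x, x < a ∨ h ≤ x → s'.arr aQ x = s.arr aQ x) 92 hK hH (h1.trans h2) (by omega)
    ⟨a, mid, hI, hJ, le_rfl, h1, le_rfl, h2, rfl, by simp [seg_self], fun _ _ => rfl⟩ ?_ ?_).mono
    (by omega) ?_
  · intro i s v hs; simpa using hs
  · rintro c s' hc1 hc2 hF hc ⟨i, j, hi, hj, h4, h5, h6, h7, h8, h9, h10⟩
    have hS : s'.arr aS = s.arr aS := hF.arr aS rfl
    have hmid : s'.reg rMid = mid := by rw [hF.reg rMid rfl, hM]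
    have hh : s'.reg rH = h := by rw [hF.reg rH rfl, hH]
    refine (wp_of_vc hE' mergeStep ?_).mono (by decide) fun _ _ h => h
    simp only [mergeStep, ACmd.vc, AExpr.Ok, AExpr.eval, AState.reg_setReg, AState.arr_setArr,
      AState.arr_setReg, AState.reg_setArr, hi, hj, hmid, hh, hS, hc]
    refine ⟨by simp only [true_and, and_true]; omega, ?_, ?_⟩
    · intro hcond
      have hcond' : i < mid ∧ ¬ (j < h ∧ E.key (s.arr aS j) < E.key (s.arr aS i)) := by
        simpa using hcond
      obtain ⟨hlt, hn⟩ := hcond'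
      refine ⟨trivial, by simp; omega, by omega, by decide, ⟨trivial, by omega, by omega⟩, ?_⟩
      refine ⟨i + 1, j, by simp, by simp, by omega, hlt, h6, h7, by omega, ?_, ?_⟩
      · rw [← h9]
        simp only [if_true]
        rw [seg_update_succ _ _ hc1, List.append_assoc]
        congr 1
        rw [seg_cons (s.arr aS) hlt]
        rcases h7.lt_or_eq with hj' | rfl
        · rw [seg_cons (s.arr aS) hj', List.cons_merge_cons_pos]
          · rfl
          · rw [Env.le_iff]; exact not_lt.1 fun hcon => hn ⟨hj', hcon⟩
        · simp [seg_self]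
      · intro x hx
        simp only [if_true]
        rw [Function.update_of_ne (by omega), h10 x hx]
    · intro hcond
      have hcond' : i < mid → (j < h ∧ E.key (s.arr aS j) < E.key (s.arr aS i)) := by
        simpa using hcond
      have hjh : j < h := by
        by_cases hi' : i < mid
        · exact (hcond' hi').1
        · omega
      refine ⟨trivial, by simp; omega, by omega, by decide, ⟨trivial, by omega, by omega⟩, ?_⟩
      refine ⟨i, j + 1, by simp, by simp, h4, h5, by omega, hjh, by omega, ?_, ?_⟩
      · rw [← h9]
        simp only [if_true]
        rw [seg_update_succ _ _ hc1, List.append_assoc]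
        congr 1
        rw [seg_cons (s.arr aS) hjh]
        rcases h5.lt_or_eq with hi' | rfl
        · rw [seg_cons (s.arr aS) hi', List.cons_merge_cons_neg]
          · rfl
          · rw [Env.le_iff]; exact not_le.2 (hcond' hi').2
        · simp [seg_self]
      · intro x hx
        simp only [if_true]
        rw [Function.update_of_ne (by omega), h10 x hx]
  · rintro s' hF ⟨⟨i, j, hi, hj, h4, h5, h6, h7, h8, h9, h10⟩, -⟩
    obtain rfl : i = mid := by omega
    obtain rfl : j = h := by omega
    refine ⟨?_, h10⟩
    simpa [seg_self] using h9

def minCmd : ACmd 24 :=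
  .assign rMid (.add (.reg rA) (.reg rWidth)) ;;
  .ite (.lt (.reg rF) (.reg rMid)) (.assign rMid (.reg rF)) .skip ;;
  .assign rH (.add (.reg rMid) (.reg rWidth)) ;;
  .ite (.lt (.reg rF) (.reg rH)) (.assign rH (.reg rF)) .skip ;;
  .assign rI (.reg rA) ;; .assign rJ (.reg rMid) ;; .assign rK (.reg rA)

theorem wp_minCmd {E : Env} (hE : E.Wide) {s : AState 24} {a w f : ℕ} (hA : s.reg rA = a)
    (hW : s.reg rWidth = w) (hF : s.reg rF = f) (hf : f ≤ E.n) (ha : a ≤ f) (hwn : w ≤ E.n) :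
    wp E minCmd 50 (fun s' => s'.reg rMid = min (a + w) f ∧ s'.reg rH = min (a + 2 * w) f ∧
      s'.reg rI = a ∧ s'.reg rJ = min (a + w) f ∧ s'.reg rK = a) s := by
  have hw := hE.wide
  refine (wp_of_vc hE.toRoomy minCmd ?_).mono (by decide) fun _ _ h => h
  simp only [minCmd, ACmd.vc, AExpr.Ok, AExpr.eval, AState.reg_setReg, hA, hW, hF]
  simp only [Fin.reduceEq, ne_eq, not_false_eq_true, true_and, and_true, if_true, if_false,
    ite_eq_right_iff, one_ne_zero, imp_false, not_lt, not_le]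
  refine ⟨by omega, fun h => ?_, fun h => ?_⟩
  · refine ⟨by omega, fun h' => ?_, fun h' => ?_⟩ <;> omega
  · refine ⟨by omega, fun h' => ?_, fun h' => ?_⟩ <;> omega

/-- The part of `g` between `p` and `f` consists of sorted blocks of length `w`. -/
def Env.Blocks (E : Env) (g : ℕ → ℕ) (p f w : ℕ) : Prop :=
  ∀ x y, p ≤ x → x < y → y < f → (x - p) / w = (y - p) / w → E.key (g x) ≤ E.key (g y)

def passCmd : ACmd 24 :=
  .assign rA (.reg rPos) ;;
  .while (.lt (.reg rA) (.reg rF)) (minCmd ;; .forUp rK rH mergeStep ;; .assign rA (.reg rH))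

theorem pairwise_merge_seg {E : Env} {l l' : List ℕ}
    (h : l.Pairwise fun x y => E.key x ≤ E.key y) (h' : l'.Pairwise fun x y => E.key x ≤ E.key y) :
    (l.merge l' E.le).Pairwise fun x y => E.key x ≤ E.key y := by
  refine (List.pairwise_merge (le := E.le) ?_ ?_ l l' ?_ ?_).imp fun h => Env.le_iff.1 h
  · intro a b c
    simp only [Env.le_iff]
    exact le_trans
  · intro a b
    simpa [Env.le] using le_total _ _
  · exact h.imp fun h => Env.le_iff.2 h
  · exact h'.imp fun h => Env.le_iff.2 h

/-- After `c` rounds the blocks of length `2 * w` are complete up to `min (p + 2 * w * c) f`; the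
minimum covers a last block that is short or has no partner. -/
theorem wp_passCmd {E : Env} (hE : E.Wide) {s : AState 24} {p w f : ℕ} (hP : s.reg rPos = p)
    (hW : s.reg rWidth = w) (hF : s.reg rF = f) (hf : f ≤ E.n) (hp : p ≤ f) (hwn : w ≤ E.n)
    (hw0 : 0 < w) (hS : E.Blocks (s.arr aS) p f w) :
    wp E passCmd (200 * (f - p) + 20) (fun s' => E.Blocks (s'.arr aQ) p f (2 * w) ∧
      (seg (s'.arr aQ) p f).Perm (seg (s.arr aS) p f)) s := by
  have hw := hE.wide
  have hE' := hE.toRoomy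
  refine (wp_seq (t := 2) (wp_assign hE' (by decide) (by exact trivial) (wp_while hE' (fun b s' => ∃ a c,
    s'.reg rA = a ∧ a = min (p + 2 * w * c) f ∧ E.Blocks (s'.arr aQ) p a (2 * w) ∧
    (seg (s'.arr aQ) p a).Perm (seg (s.arr aS) p a) ∧ 200 * (f - a) + 10 ≤ b)
    (b₀ := 200 * (f - p) + 10) ?_ ?_ ?_ ?_))).mono (by omega) fun _ _ h => h
  · exact ⟨p, 0, by simp [AExpr.eval, hP], by simp [hp], fun x y h1 h2 h3 => by omega,
      by simp [seg_self], le_rfl⟩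
  · intros; exact ⟨trivial, trivial⟩
  · rintro b s' hFr ⟨a, c, ha, hac, hbl, hperm, hb⟩ he
    have hP' : s'.reg rPos = p := by rw [hFr.reg rPos rfl]; simpa using hP
    have hW' : s'.reg rWidth = w := by rw [hFr.reg rWidth rfl]; simpa using hW
    have hF' : s'.reg rF = f := by rw [hFr.reg rF rfl]; simpa using hF
    have hS' : s'.arr aS = s.arr aS := by rw [hFr.arr aS rfl]; simp
    have haf : a < f := by simpa [AExpr.eval, ha, hF'] using he
    obtain ⟨h, hh⟩ : ∃ h, h = min (a + 2 * w) f := ⟨_, rfl⟩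
    obtain ⟨mid, hmid⟩ : ∃ mid, mid = min (a + w) f := ⟨_, rfl⟩
    have hah : a < h := by omega
    refine ⟨50 + (((h - a) * 100 + 4) + 2), wp_seq ((wp_minCmd hE ha hW' hF' hf haf.le
      hwn).mono le_rfl ?_)⟩
    rintro s1 hFr1 ⟨h1, h2, h3, h4, h5⟩
    rw [← hmid] at h1 h4
    rw [← hh] at h2
    refine wp_seq ((wp_mergeLoop hE h3 h4 h5 h1 h2 (by omega) (by omega) (by omega)).mono le_rfl ?_)
    rintro s2 hFr2 ⟨g1, g2⟩
    refine wp_assign hE' (by decide) trivial ?_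
    have hS1 : s1.arr aS = s.arr aS := by rw [hFr1.arr aS rfl, hS']
    have hQ1 : s1.arr aQ = s'.arr aQ := hFr1.arr aQ rfl
    have hh2 : s2.reg rH = h := by rw [hFr2.reg rH rfl, h2]
    rw [hS1] at g1
    rw [hQ1] at g2
    refine ⟨200 * (f - h) + 10, ?_, h, c + 1, by simp [AExpr.eval, hh2], ?_, ?_, ?_, le_rfl⟩
    · have : (AExpr.lt (.reg rA) (.reg rF) : AExpr 24).cost = 3 := rfl
      omega
    · have : 2 * w * (c + 1) = 2 * w * c + 2 * w := by ring
      omega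
    · have hpa : a = p + 2 * w * c := by omega
      have hdiv : ∀ x, a ≤ x → x < h → (x - p) / (2 * w) = c := fun x h1 h2 =>
        Nat.div_eq_of_lt_le (by rw [mul_comm]; omega) (by
          have : (c + 1) * (2 * w) = 2 * w * c + 2 * w := by ring
          omega)
      have hdiv1 : ∀ x, a ≤ x → x < mid → (x - p) / w = 2 * c := fun x h1 h2 =>
        Nat.div_eq_of_lt_le (by
          have : 2 * c * w = 2 * w * c := by ring
          omega) (by
          have : (2 * c + 1) * w = 2 * w * c + w := by ring
          omega)
      have hdiv2 : ∀ x, mid ≤ x → x < h → (x - p) / w = 2 * c + 1 := fun x h1 h2 =>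
        Nat.div_eq_of_lt_le (by
          have : (2 * c + 1) * w = 2 * w * c + w := by ring
          omega) (by
          have : (2 * c + 1 + 1) * w = 2 * w * c + 2 * w := by ring
          omega)
      have hsort : (seg (s2.arr aQ) a h).Pairwise fun x y => E.key x ≤ E.key y := by
        rw [g1]
        refine pairwise_merge_seg ?_ ?_ <;> rw [pairwise_seg] <;> intro i j hi hij hj
        · exact hS i j (by omega) hij (by omega) (by rw [hdiv1 i hi (by omega), hdiv1 j (by omega) hj])
        · exact hS i j (by omega) hij (by omega) (by rw [hdiv2 i hi (by omega), hdiv2 j (by omega) hj])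
      rw [pairwise_seg] at hsort
      intro x y hx hxy hy hxy'
      simp only [AState.arr_setReg]
      rcases lt_or_ge x a with hxa | hxa
      -- An index from `a` on has block number `c`, one below `a` has a smaller block number.
      · have hya : y < a := by
          by_contra hcon
          rw [hdiv y (by omega) hy, Nat.div_eq_iff (by omega)] at hxy'
          have : c * (2 * w) = 2 * w * c := by ring
          omega
        rw [g2 x (.inl hxa), g2 y (.inl hya)]
        exact hbl x y hx hxy hya hxy'
      · exact hsort x y hxa hxy hy
    · simp only [AState.arr_setReg]
      rw [seg_append _ (show p ≤ a by omega) hah.le, seg_append _ (show p ≤ a by omega) hah.le]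
      refine List.Perm.append ?_ ?_
      · rw [seg_congr (g := s'.arr aQ) fun i _ hi => g2 i (.inl hi)]
        exact hperm
      · rw [g1, seg_append (s.arr aS) (show a ≤ mid by omega) (show mid ≤ h by omega)]
        exact List.merge_perm_append _
  · rintro b s' hFr ⟨a, c, ha, hac, hbl, hperm, hb⟩ he
    have hF' : s'.reg rF = f := by rw [hFr.reg rF rfl]; simpa using hF
    have haf : f ≤ a := by simpa [AExpr.eval, ha, hF'] using he
    obtain rfl : a = f := by omega
    have : (AExpr.lt (.reg rA) (.reg rF) : AExpr 24).cost = 3 := rfl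
    exact ⟨by omega, hbl, hperm⟩

/-- Copy the current segment from one array to another. -/
def copyCmd (r r' : Fin 9) : ACmd 24 :=
  .assign rI (.reg rPos) ;; .forUp rI rF (.store r' (.reg rI) (.arr r (.reg rI)))

theorem wp_copyCmd {E : Env} (hE : E.Wide) {r r' : Fin 9} (hr : r ≠ r') {s : AState 24} {p f : ℕ}
    (hP : s.reg rPos = p) (hF : s.reg rF = f) (hf : f ≤ E.n) (hp : p ≤ f) :
    wp E (copyCmd r r') (30 * (f - p) + 10) (fun s' =>
      (∀ x, p ≤ x → x < f → s'.arr r' x = s.arr r x) ∧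
      ∀ x, x < p ∨ f ≤ x → s'.arr r' x = s.arr r' x) s := by
  have hw := hE.wide
  have hE' := hE.toRoomy
  have hrw : (ACmd.forUp rI rF (.store r' (.reg rI) (.arr r (.reg rI)))).writesArr r = false := by
    simp [ACmd.forUp, ACmd.writesArr, hr]
  refine (wp_seq (t := 2) (wp_assign hE' (by decide) (by exact trivial)
    ((wp_forUp_const (x := rI) (y := rF) hE' (by decide) (by decide) rfl rfl (fun c s' => (∀ x, p ≤ x → x < c → s'.arr r' x = s.arr r x) ∧
      ∀ x, x < p ∨ c ≤ x → s'.arr r' x = s.arr r' x) 22 (a := p) (b := f) ?_ ?_ hp (by omega)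
      ?_ ?_ ?_).mono le_rfl fun _ _ h => h.1))).mono
      (t := 2 + ((f - p) * (22 + 8) + 4)) (by omega) fun _ _ h => h
  · simp [AExpr.eval, hP]
  · simp [hF]
  · exact ⟨fun x _ _ => by omega, fun _ _ => rfl⟩
  · intro i s v hs; simpa using hs
  · rintro c s' h1 h2 hFr hc ⟨h3, h4⟩
    have hr1 : s'.arr r = s.arr r := by rw [hFr.arr r hrw]; simp
    refine (wp_store (r := r') (i := .reg rI) (e := .arr r (.reg rI)) hE' trivial ⟨trivial, ?_⟩
      ?_ ?_).mono 
      (by simp [AExpr.cost, AExpr.toExpr, cellExpr, Expr.cost]) fun _ _ h => h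
    · simp only [AExpr.eval, hc]; omega
    · simp only [AExpr.eval, hc]; omega
    · simp only [AExpr.eval, hc, AState.arr_setArr, if_true, hr1]
      refine ⟨fun x hx hx' => ?_, fun x hx => ?_⟩
      · rcases (Nat.lt_succ_iff.1 hx').lt_or_eq with h | rfl
        · rw [Function.update_of_ne (by omega)]
          exact h3 x hx h
        · simp
      · rw [Function.update_of_ne (by omega)]
        exact h4 x (by omega)

/-- Sort the current segment of the array `aP` into the array `aS`. -/
def sortCmd : ACmd 24 :=
  copyCmd aP aS ;; .assign rWidth (.const 1) ;;
  .while (.lt (.reg rWidth) (.sub (.reg rF) (.reg rPos)))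
    (passCmd ;; copyCmd aQ aS ;; .assign rWidth (.add (.reg rWidth) (.reg rWidth)))

/-- The width is `2 ^ e` after `e` passes, and it is below the length of the segment exactly for `e
< Nat.clog 2 (f - p)`; this is the number of passes. At the end there is only one block. -/
theorem wp_sortCmd {E : Env} (hE : E.Wide) {s : AState 24} {p f : ℕ}
    (hP : s.reg rPos = p) (hF : s.reg rF = f) (hf : f ≤ E.n) (hp : p ≤ f) :
    wp E sortCmd (300 * ((f - p) * (Nat.clog 2 (f - p) + 1) + 1)) (fun s' =>
      (seg (s'.arr aS) p f).Pairwise (fun x y => E.key x ≤ E.key y) ∧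
      (seg (s'.arr aS) p f).Perm (seg (s.arr aP) p f)) s := by
  have hw := hE.wide
  have hE' := hE.toRoomy
  set N := f - p with hN
  have hbud : ∀ w' w : ℕ, N * (w' + 1) ≤ N * w →
      300 * (N * w') + 300 * N ≤ 300 * (N * w) := by
    intro w' w h
    have : N * (w' + 1) = N * w' + N := by ring
    omega
  refine (wp_seq (t := 30 * N + 10) ((wp_copyCmd hE (by decide) hP hF hf hp).mono le_rfl ?_)).mono
    (t := 30 * N + 10 + (2 + (300 * (N * Nat.clog 2 N) + 10))) ?_ fun _ _ h => h
  · rintro s1 hFr1 ⟨h1, -⟩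
    have hP1 : s1.reg rPos = p := by rw [hFr1.reg rPos rfl, hP]
    have hF1 : s1.reg rF = f := by rw [hFr1.reg rF rfl, hF]
    refine wp_seq (wp_assign hE' (by decide) (by simp only [AExpr.Ok]; omega) (wp_while hE'
      (fun b s' => ∃ e, s'.reg rWidth = 2 ^ e ∧ E.Blocks (s'.arr aS) p f (2 ^ e) ∧
        (seg (s'.arr aS) p f).Perm (seg (s.arr aP) p f) ∧
        300 * (N * (Nat.clog 2 N - e)) + 10 ≤ b) ?_ ?_ ?_ ?_))
    · refine ⟨0, by simp [AExpr.eval], ?_, ?_, le_rfl⟩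
      · intro x y hx hxy hy h
        simp only [pow_zero, Nat.div_one] at h
        omega
      · rw [seg_congr (g := s.arr aP)]
        intro i hi hi'
        simpa using h1 i hi hi'
    · rintro b s' hFr ⟨e, he, -⟩
      have hP' : s'.reg rPos = p := by rw [hFr.reg rPos rfl]; simpa using hP1
      have hF' : s'.reg rF = f := by rw [hFr.reg rF rfl]; simpa using hF1
      refine ⟨trivial, trivial, trivial, ?_⟩
      simp only [AExpr.eval, hP', hF']; omega
    · rintro b s' hFr ⟨e, he, hbl, hperm, hb⟩ hc
      have hP' : s'.reg rPos = p := by rw [hFr.reg rPos rfl]; simpa using hP1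
      have hF' : s'.reg rF = f := by rw [hFr.reg rF rfl]; simpa using hF1
      have hlt : 2 ^ e < N := by
        have : 2 ^ e + p < f := by simpa [AExpr.eval, hP', hF', he] using hc
        omega
      have hclog := (Nat.lt_clog_iff_pow_lt one_lt_two).2 hlt
      refine ⟨200 * N + 20 + (30 * N + 10 + 4), wp_seq ((wp_passCmd hE hP' he hF' hf hp (by omega)
        (by positivity) hbl).mono le_rfl ?_)⟩
      rintro s2 hFr2 ⟨g1, g2⟩
      refine wp_seq ((wp_copyCmd hE (by decide) (by rw [hFr2.reg rPos rfl, hP'])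
        (by rw [hFr2.reg rF rfl, hF']) hf hp).mono le_rfl ?_)
      rintro s3 hFr3 ⟨k1, -⟩
      have he3 : s3.reg rWidth = 2 ^ e := by rw [hFr3.reg rWidth rfl, hFr2.reg rWidth rfl, he]
      refine wp_assign hE' (by decide) ⟨trivial, trivial, ?_⟩ ?_
      · simp only [AExpr.eval, he3]; omega
      · refine ⟨300 * (N * (Nat.clog 2 N - (e + 1))) + 10, ?_, e + 1, ?_, ?_, ?_, le_rfl⟩
        · have : (AExpr.lt (.reg rWidth) (.sub (.reg rF) (.reg rPos)) : AExpr 24).cost = 5 := rfl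
          have := hbud (Nat.clog 2 N - (e + 1)) (Nat.clog 2 N - e)
            (Nat.mul_le_mul_left _ (by omega))
          have : 0 < 2 ^ e := by positivity
          omega
        · simp [AExpr.eval, he3, pow_succ]; ring
        · intro x y hx hxy hy h
          simp only [AState.arr_setReg]
          rw [k1 x hx (by omega), k1 y (by omega) hy]
          refine g1 x y hx hxy hy ?_
          rwa [← pow_succ']
        · simp only [AState.arr_setReg]
          rw [seg_congr k1]
          exact g2.trans hperm
    · rintro b s' hFr ⟨e, he, hbl, hperm, hb⟩ hc
      have hP' : s'.reg rPos = p := by rw [hFr.reg rPos rfl]; simpa using hP1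
      have hF' : s'.reg rF = f := by rw [hFr.reg rF rfl]; simpa using hF1
      have hlt : N ≤ 2 ^ e := by simpa [AExpr.eval, hP', hF', he, hN] using hc
      have : (AExpr.lt (.reg rWidth) (.sub (.reg rF) (.reg rPos)) : AExpr 24).cost = 5 := rfl
      refine ⟨by omega, ?_, hperm⟩
      rw [pairwise_seg]
      intro i j hi hij hj
      exact hbl i j hi hij hj (by rw [Nat.div_eq_of_lt (by omega), Nat.div_eq_of_lt (by omega)])
  · have : N * (Nat.clog 2 N + 1) = N * Nat.clog 2 N + N := by ring
    omega

/-! ### Distribution to cells -/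

section cells
variable (E : Env) (pv : ℕ → ℕ) (t : ℕ)

open Classical in
/-- The number of pivots among `pv 1, …, pv (t - 1)` that are smaller than `x`. -/
noncomputable def Env.slot (x : ℕ) : ℕ :=
  Nat.findGreatest (fun c => c = 0 ∨ E.key (pv c) < E.key x) (t - 1)

open Classical in
/-- The number of the cell of `x`: even cells lie between two pivots, odd cells consist of copies
of a pivot. -/
noncomputable def Env.cellNo (x : ℕ) : ℕ :=
  if E.slot pv t x + 1 < t ∧ ¬ E.key x < E.key (pv (E.slot pv t x + 1))
    then 2 * E.slot pv t x + 1 else 2 * E.slot pv t x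

/-- The pivots are in order. -/
def Env.PivotsMono : Prop :=
  ∀ c c', 1 ≤ c → c ≤ c' → c' < t → E.key (pv c) ≤ E.key (pv c')

variable {E pv t} {x c : ℕ}

theorem Env.slot_le : E.slot pv t x ≤ t - 1 := Nat.findGreatest_le _

theorem Env.slot_spec : E.slot pv t x = 0 ∨ E.key (pv (E.slot pv t x)) < E.key x := by
  classical
  exact Nat.findGreatest_spec (P := fun c => c = 0 ∨ E.key (pv c) < E.key x) (Nat.zero_le _)
    (.inl rfl)

theorem Env.not_lt_of_slot_lt (h : E.slot pv t x < c) (h' : c < t) :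
    ¬ E.key (pv c) < E.key x := fun hcon => by
  classical
  exact Nat.findGreatest_is_greatest (P := fun c => c = 0 ∨ E.key (pv c) < E.key x) h (by omega)
    (.inr hcon)

/-- This is where the order of the pivots enters: it makes the greatest smaller pivot bound all
earlier ones. -/
theorem Env.lt_of_le_slot (hm : E.PivotsMono pv t) (h : 1 ≤ c) (h' : c ≤ E.slot pv t x) :
    E.key (pv c) < E.key x := by
  have h1 := E.slot_le (pv := pv) (t := t) (x := x)
  rcases E.slot_spec (pv := pv) (t := t) (x := x) with h2 | h2
  · omega
  · exact (hm c _ h h' (by omega)).trans_lt h2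

theorem Env.slot_eq (hm : E.PivotsMono pv t) (hc : c < t) (h1 : c = 0 ∨ E.key (pv c) < E.key x)
    (h2 : c + 1 < t → ¬ E.key (pv (c + 1)) < E.key x) : E.slot pv t x = c := by
  have h3 := E.slot_le (pv := pv) (t := t) (x := x)
  apply le_antisymm
  · by_contra hcon
    exact h2 (by omega) (E.lt_of_le_slot hm (by omega) (by omega))
  · by_contra hcon
    rcases h1 with h1 | h1
    · omega
    · exact E.not_lt_of_slot_lt (not_le.1 hcon) hc h1

theorem Env.cellNo_lt (ht : 0 < t) : E.cellNo pv t x < 2 * t := by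
  have h3 := E.slot_le (pv := pv) (t := t) (x := x)
  unfold cellNo
  split_ifs <;> omega

end cells

def locateCmd : ACmd 24 :=
  .while (.and (.lt (.add (.reg rC) (.const 1)) (.reg rCells))
      (.keyLt (.arr aS (.add (.reg rPos) (.mul (.add (.reg rC) (.const 1)) (.reg rStep)))) (.reg rX)))
    (.assign rC (.add (.reg rC) (.const 1))) ;;
  .while (.and (.lt (.const 0) (.reg rC))
      (.lt (.keyLt (.arr aS (.add (.reg rPos) (.mul (.reg rC) (.reg rStep)))) (.reg rX)) (.const 1)))
    (.assign rC (.sub (.reg rC) (.const 1))) ;;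
  .ite (.and (.lt (.add (.reg rC) (.const 1)) (.reg rCells)) (.lt (.keyLt (.reg rX)
      (.arr aS (.add (.reg rPos) (.mul (.add (.reg rC) (.const 1)) (.reg rStep))))) (.const 1)))
    (.assign rC (.add (.mul (.const 2) (.reg rC)) (.const 1)))
    (.assign rC (.mul (.const 2) (.reg rC)))

/-- From the guess `g`, the first loop moves up to `max g slot` and the second down to `slot`, so
only the distance is paid for; one more comparison separates the keys that equal the next pivot. The
result does not depend on the guess. -/
theorem wp_locateCmd {E : Env} (hE : E.Wide) {s : AState 24} {p t d x g : ℕ}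
    (hP : s.reg rPos = p) (hT : s.reg rCells = t) (hD : s.reg rStep = d) (hX : s.reg rX = x)
    (hC : s.reg rC = g) (hg : g < t) (hd : 1 ≤ d) (hn : p + t * d ≤ E.n)
    (hm : E.PivotsMono (fun c => s.arr aS (p + c * d)) t) :
    wp E locateCmd (100 * ((E.slot (fun c => s.arr aS (p + c * d)) t x - g) +
        (g - E.slot (fun c => s.arr aS (p + c * d)) t x)) + 300)
      (fun s' => s'.reg rC = E.cellNo (fun c => s.arr aS (p + c * d)) t x) s := by
  have hw := hE.wide
  have hE' := hE.toRoomy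
  set pv : ℕ → ℕ := fun c => s.arr aS (p + c * d) with hpv
  have hsl := E.slot_le (pv := pv) (t := t) (x := x)
  set o := E.slot pv t x with ho
  have hidx : ∀ c, c ≤ t → c * d ≤ t * d := fun c hc => Nat.mul_le_mul_right _ hc
  have htd : t ≤ t * d := Nat.le_mul_of_pos_right _ hd
  refine (wp_seq (t := 100 * (o - g) + 100) (t' := 100 * (g - o) + 100 + 100) ((wp_while hE'
    (fun b s' => ∃ c, s'.reg rC = c ∧ g ≤ c ∧ c ≤ max g o ∧ 100 * (o - c) + 100 ≤ b) ?_ ?_ ?_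
    (Q := fun s' => s'.reg rC = max g o) ?_).mono le_rfl ?_)).mono (by omega) fun _ _ h => h
  · exact ⟨g, hC, le_rfl, le_max_left _ _, le_rfl⟩
  · rintro b s' hF ⟨c, hc, h1, h2, h3⟩
    have e1 : s'.reg rPos = p := by rw [hF.reg rPos rfl, hP]
    have e3 : s'.reg rStep = d := by rw [hF.reg rStep rfl, hD]
    -- Conjunctions evaluate both sides, so the pivot is read even for `c + 1 = t`. The index is
    -- then `p + t * d ≤ n`, which is still valid because rows have `n + 1` cells.
    have := hidx (c + 1) (by omega)
    simp only [AExpr.Ok, AExpr.eval, hc, e1, e3, true_and, and_true]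
    omega
  · rintro b s' hF ⟨c, hc, h1, h2, h3⟩ he
    have e1 : s'.reg rPos = p := by rw [hF.reg rPos rfl, hP]
    have e2 : s'.reg rCells = t := by rw [hF.reg rCells rfl, hT]
    have e3 : s'.reg rStep = d := by rw [hF.reg rStep rfl, hD]
    have e4 : s'.reg rX = x := by rw [hF.reg rX rfl, hX]
    have e5 : s'.arr aS = s.arr aS := hF.arr aS rfl
    have hcond : c + 1 < t ∧ E.key (pv (c + 1)) < E.key x := by
      simpa [AExpr.eval, hc, e1, e2, e3, e4, e5, hpv] using he
    have hco : c < o := by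
      by_contra hcon
      exact E.not_lt_of_slot_lt (pv := pv) (t := t) (x := x) (c := c + 1) (by omega) hcond.1 hcond.2
    refine ⟨4, wp_assign hE' (by decide) ⟨trivial, ?_, ?_⟩ ⟨100 * (o - (c + 1)) + 100, ?_, c + 1,
      ?_, by omega, by omega, le_rfl⟩⟩
    · simp only [AExpr.Ok]; omega
    · simp only [AExpr.eval, hc]; omega
    · refine le_trans ?_ h3
      have : ∀ z : ℕ, z ≤ 90 → 4 + (100 * (o - (c + 1)) + 100) + z ≤ 100 * (o - c) + 100 := by omega
      exact this _ (by decide)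
    · simp [AExpr.eval, hc]
  · rintro b s' hF ⟨c, hc, h1, h2, h3⟩ he
    have e1 : s'.reg rPos = p := by rw [hF.reg rPos rfl, hP]
    have e2 : s'.reg rCells = t := by rw [hF.reg rCells rfl, hT]
    have e3 : s'.reg rStep = d := by rw [hF.reg rStep rfl, hD]
    have e4 : s'.reg rX = x := by rw [hF.reg rX rfl, hX]
    have e5 : s'.arr aS = s.arr aS := hF.arr aS rfl
    have hcond : c + 1 < t → ¬ E.key (pv (c + 1)) < E.key x := by
      simpa [AExpr.eval, hc, e1, e2, e3, e4, e5, hpv] using he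
    refine ⟨le_trans ?_ ((Nat.le_add_left 100 _).trans h3), ?_⟩
    · decide
    · rw [hc]
      by_contra hcon
      exact hcond (by omega) (E.lt_of_le_slot hm (by omega) (by omega))
  · intro s1 hF1 hc1
    refine wp_seq ((wp_while hE'
      (fun b s' => ∃ c, s'.reg rC = c ∧ o ≤ c ∧ c < t ∧ 100 * (c - o) + 100 ≤ b) ?_ ?_ ?_
      (Q := fun s' => s'.reg rC = o) ?_).mono le_rfl ?_)
    · exact ⟨max g o, hc1, le_max_right _ _, by omega, by omega⟩
    · rintro b s' hF ⟨c, hc, h1, h2, h3⟩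
      have e1 : s'.reg rPos = p := by rw [hF.reg rPos rfl, hF1.reg rPos rfl, hP]
      have e3 : s'.reg rStep = d := by rw [hF.reg rStep rfl, hF1.reg rStep rfl, hD]
      have := hidx c (by omega)
      simp only [AExpr.Ok, AExpr.eval, hc, e1, e3, true_and, and_true]
      omega
    · rintro b s' hF ⟨c, hc, h1, h2, h3⟩ he
      have e1 : s'.reg rPos = p := by rw [hF.reg rPos rfl, hF1.reg rPos rfl, hP]
      have e3 : s'.reg rStep = d := by rw [hF.reg rStep rfl, hF1.reg rStep rfl, hD]
      have e4 : s'.reg rX = x := by rw [hF.reg rX rfl, hF1.reg rX rfl, hX]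
      have e5 : s'.arr aS = s.arr aS := (hF.arr aS rfl).trans (hF1.arr aS rfl)
      have hcond : 0 < c ∧ ¬ E.key (pv c) < E.key x := by
        simpa [AExpr.eval, hc, e1, e3, e4, e5, hpv, Nat.pos_iff_ne_zero] using he
      have hco : o < c := by
        by_contra hcon
        exact hcond.2 (E.lt_of_le_slot hm (by omega) (by omega))
      refine ⟨4, wp_assign hE' (by decide) ⟨trivial, ?_, ?_⟩ ⟨100 * (c - 1 - o) + 100, ?_, c - 1,
        ?_, by omega, by omega, le_rfl⟩⟩
      · simp only [AExpr.Ok]; omega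
      · simp only [AExpr.eval, hc]; omega
      · refine le_trans ?_ h3
        have : ∀ z : ℕ, z ≤ 90 → 4 + (100 * (c - 1 - o) + 100) + z ≤ 100 * (c - o) + 100 := by omega
        exact this _ (by decide)
      · simp [AExpr.eval, hc]
    · rintro b s' hF ⟨c, hc, h1, h2, h3⟩ he
      have e1 : s'.reg rPos = p := by rw [hF.reg rPos rfl, hF1.reg rPos rfl, hP]
      have e3 : s'.reg rStep = d := by rw [hF.reg rStep rfl, hF1.reg rStep rfl, hD]
      have e4 : s'.reg rX = x := by rw [hF.reg rX rfl, hF1.reg rX rfl, hX]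
      have e5 : s'.arr aS = s.arr aS := (hF.arr aS rfl).trans (hF1.arr aS rfl)
      have hcond : 0 < c → E.key (pv c) < E.key x := by
        simpa [AExpr.eval, hc, e1, e3, e4, e5, hpv, Nat.pos_iff_ne_zero] using he
      refine ⟨le_trans ?_ ((Nat.le_add_left 100 _).trans h3), ?_⟩
      · decide
      · rw [hc]
        by_contra hcon
        exact E.not_lt_of_slot_lt (pv := pv) (t := t) (x := x) (c := c) (by omega) h2
          (hcond (by omega))
    · intro s2 hF2 hc2
      have e1 : s2.reg rPos = p := by rw [hF2.reg rPos rfl, hF1.reg rPos rfl, hP]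
      have e2 : s2.reg rCells = t := by rw [hF2.reg rCells rfl, hF1.reg rCells rfl, hT]
      have e3 : s2.reg rStep = d := by rw [hF2.reg rStep rfl, hF1.reg rStep rfl, hD]
      have e4 : s2.reg rX = x := by rw [hF2.reg rX rfl, hF1.reg rX rfl, hX]
      have e5 : s2.arr aS = s.arr aS := (hF2.arr aS rfl).trans (hF1.arr aS rfl)
      have := hidx (o + 1) (by omega)
      refine (wp_of_vc hE' _ ?_).mono (by decide) fun _ _ h => h
      simp only [ACmd.vc, AExpr.Ok, AExpr.eval, AState.reg_setReg, hc2, e1, e2, e3, e4, e5]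
      refine ⟨by simp only [true_and, and_true]; omega, ?_, ?_⟩
      · intro hcond
        have hcond' : o + 1 < t ∧ ¬ E.key x < E.key (pv (o + 1)) := by simpa [hpv] using hcond
        refine ⟨by decide, by simp only [true_and]; omega, ?_⟩
        rw [Env.cellNo, ← ho, if_pos hcond']; simp
      · intro hcond
        have hcond' : ¬ (o + 1 < t ∧ ¬ E.key x < E.key (pv (o + 1))) := by
          rw [not_and, not_not]; simpa [hpv] using hcond
        refine ⟨by decide, by simp only [true_and]; omega, ?_⟩
        rw [Env.cellNo, ← ho, if_neg hcond']; simp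

/-- The linked list that starts with `h` has the entries `l`. -/
def Linked (n : ℕ) (next : ℕ → ℕ) : ℕ → List ℕ → Prop
  | h, [] => h = n
  | h, x :: l => h = x ∧ x < n ∧ Linked n next (next x) l

theorem Linked.update {n : ℕ} {next : ℕ → ℕ} {h : ℕ} {l : List ℕ} (hl : Linked n next h l)
    {x : ℕ} (hx : x ∉ l) (v : ℕ) : Linked n (Function.update next x v) h l := by
  induction l generalizing h with
  | nil => exact hl
  | cons y l ih =>
    refine ⟨hl.1, hl.2.1, ?_⟩
    rw [Function.update_of_ne (fun h => hx (by simp [h]))]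
    exact ih hl.2.2 (fun h => hx (by simp [h]))

/-- The estimate of the rank of a key by a model. -/
noncomputable def Env.est (E : Env) (md : Model) (x : ℕ) : ℕ :=
  min md.m ⌊E.L.fit md.m md.D (rescale md.lo md.hi (E.key x))⌋₊

/-- The distance between the cell that the model predicts and the right one. -/
noncomputable def Env.walk (E : Env) (md : Model) (pv : ℕ → ℕ) (d t x : ℕ) : ℕ :=
  (E.slot pv t x - min (E.est md x / d) (t - 1)) + (min (E.est md x / d) (t - 1) - E.slot pv t x)

/-- The number of operations for evaluating a model at a key. -/
noncomputable def Env.queryTime (E : Env) (md : Model) (x : ℕ) : ℕ :=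
  E.L.evalTime md.m md.D (rescale md.lo md.hi (E.key x))

/-- All lists start out empty; the word `n`, which is not the index of an entry, ends a list. -/
def headsCmd : ACmd 24 :=
  .assign rC (.const 0) ;; .assign rLim (.mul (.const 2) (.reg rCells)) ;;
  .forUp rC rLim (.store aHead (.reg rC) (.reg rN))

theorem wp_headsCmd {E : Env} (hE : E.Wide) {s : AState 24} {t : ℕ} (hN : s.reg rN = E.n)
    (hT : s.reg rCells = t) (ht : 2 * t ≤ E.n) :
    wp E headsCmd (60 * t + 20) (fun s' => s'.reg rLim = 2 * t ∧ ∀ c < 2 * t, s'.arr aHead c = E.n)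
      s := by
  have hw := hE.wide
  have hE' := hE.toRoomy
  refine (wp_seq (t := 2) (t' := 4 + ((2 * t - 0) * (9 + 8) + 4)) (wp_assign hE' (by decide)
    (by simp only [AExpr.Ok]; omega)
    (wp_seq (wp_assign hE' (by decide) (by simp [AExpr.Ok, AExpr.eval, hT]; omega)
      ((wp_forUp_const (x := rC) (y := rLim) hE' (by decide) (by decide) rfl rfl
        (fun i s' => s'.reg rLim = 2 * t ∧ ∀ c < i, s'.arr aHead c = E.n) 9 (a := 0) (b := 2 * t)
        ?_ ?_ (by omega) (by omega) ?_ ?_ ?_).mono le_rfl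
          fun _ _ h => h.1))))).mono (by omega) fun _ _ h => h
  · simp [AExpr.eval]
  · simp [AExpr.eval, hT]
  · simp [AExpr.eval, hT]
  · intro i s v hs; simpa using hs
  · rintro i s' - hi hF hi' ⟨h1, h2⟩
    have hN' : s'.reg rN = E.n := by rw [hF.reg rN rfl]; simpa using hN
    refine (wp_store hE' (by exact trivial) (by exact trivial) ?_ ?_).mono (by decide)
      fun _ _ h => h
    · simp only [AExpr.eval, hi']; omega
    · simp only [AExpr.eval, hi', hN', AState.reg_setArr, AState.arr_setArr, if_true, h1, true_and]
      intro c hc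
      rcases (Nat.lt_succ_iff.1 hc).lt_or_eq with h | rfl
      · rw [Function.update_of_ne (by omega)]; exact h2 c h
      · simp

def guessCmd : ACmd 24 :=
  .assign rC (.div (.reg rC) (.reg rStep)) ;;
  .ite (.lt (.reg rC) (.reg rCells)) .skip (.assign rC (.sub (.reg rCells) (.const 1)))

def linkCmd : ACmd 24 :=
  .store aNext (.reg rX) (.arr aHead (.reg rC)) ;; .store aHead (.reg rC) (.reg rX)

/-- The bucket is traversed backwards: entries are put in front of their lists, so that in the end
each list is in array order. This keeps the sample of every bucket equal to the first entries of the
array that fall into its interval, as the probabilistic analysis requires. -/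
def scatterCmd : ACmd 24 :=
  .assign rI (.reg rEnd) ;;
  .while (.lt (.reg rPos) (.reg rI))
    (.assign rI (.sub (.reg rI) (.const 1)) ;; .assign rX (.arr aP (.reg rI)) ;;
      .query rC (.reg rX) ;; guessCmd ;; locateCmd ;; linkCmd)

theorem wp_scatterCmd {E : Env} (hE : E.Wide) {s : AState 24} {p e t d : ℕ}
    (hP : s.reg rPos = p) (hEnd : s.reg rEnd = e) (hT : s.reg rCells = t) (hD : s.reg rStep = d)
    (ht : 1 ≤ t) (hd : 1 ≤ d) (hn : p + t * d ≤ E.n) (ht' : 2 * t ≤ E.n) (hp : p ≤ e)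
    (he : e ≤ E.n) (hmd : s.model.m ≤ E.n)
    (hm : E.PivotsMono (fun c => s.arr aS (p + c * d)) t)
    (hnd : (seg (s.arr aP) p e).Nodup) (hlt : ∀ x ∈ seg (s.arr aP) p e, x < E.n)
    (hh : ∀ c < 2 * t, s.arr aHead c = E.n) :
    wp E scatterCmd (((seg (s.arr aP) p e).map fun x => E.queryTime s.model x +
        (100 * E.walk s.model (fun c => s.arr aS (p + c * d)) d t x + 500)).sum + 10)
      (fun s' => ∀ c < 2 * t, Linked E.n (s'.arr aNext) (s'.arr aHead c)
        ((seg (s.arr aP) p e).filter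
          fun x => E.cellNo (fun c => s.arr aS (p + c * d)) t x = c)) s := by
  have hw := hE.wide
  have hE' := hE.toRoomy
  set pv : ℕ → ℕ := fun c => s.arr aS (p + c * d) with hpv
  set cost : ℕ → ℕ := fun x => E.queryTime s.model x + (100 * E.walk s.model pv d t x + 500)
    with hcost
  refine (wp_seq (t := 2) (t' := ((seg (s.arr aP) p e).map cost).sum + 8)
    (wp_assign hE' (by decide) (by exact trivial) (wp_while hE' (fun b s' => ∃ i,
      s'.reg rI = i ∧ p ≤ i ∧ i ≤ e ∧ (∀ c < 2 * t, Linked E.n (s'.arr aNext) (s'.arr aHead c)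
        ((seg (s.arr aP) i e).filter fun x => E.cellNo pv t x = c)) ∧
      ((seg (s.arr aP) p i).map cost).sum + 8 ≤ b) ?_ ?_ ?_ ?_))).mono (by omega) fun _ _ h => h
  · exact ⟨e, by simp [AExpr.eval, hEnd], hp, le_rfl, fun c hc => by simp [seg_self, Linked, hh c hc],
      le_rfl⟩
  · intros; exact ⟨trivial, trivial⟩
  · rintro b s' hF ⟨i, hi, hpi, hie, hl, hb⟩ hc
    have e1 : s'.reg rPos = p := by rw [hF.reg rPos rfl]; simpa using hP
    have e2 : s'.reg rCells = t := by rw [hF.reg rCells rfl]; simpa using hT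
    have e3 : s'.reg rStep = d := by rw [hF.reg rStep rfl]; simpa using hD
    have e4 : s'.arr aP = s.arr aP := by rw [hF.arr aP rfl]; simp
    have e5 : s'.arr aS = s.arr aS := by rw [hF.arr aS rfl]; simp
    have e6 : s'.model = s.model := by rw [hF.model rfl]; simp
    have hpi' : p < i := by simpa [AExpr.eval, hi, e1] using hc
    obtain ⟨i, rfl⟩ : ∃ i', i = i' + 1 := ⟨i - 1, by omega⟩
    obtain ⟨x, hx⟩ : ∃ x, x = s.arr aP i := ⟨_, rfl⟩
    have hxn : x < E.n := hlt x (mem_seg.2 ⟨i, by omega, by omega, hx.symm⟩)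
    -- Redirecting the successor of `x` thus leaves all lists built so far intact.
    have hxnot : x ∉ seg (s.arr aP) (i + 1) e := by
      rw [seg_append _ (show p ≤ i by omega) (show i ≤ e by omega),
        seg_cons _ (show i < e by omega), ← hx] at hnd
      exact (List.nodup_cons.1 (List.nodup_append.1 hnd).2.1).1
    have htd : t ≤ t * d := Nat.le_mul_of_pos_right _ hd
    refine ⟨4 + (10 + ((2 + E.queryTime s.model x) + (40 +
      ((100 * E.walk s.model pv d t x + 300) + 60)))), wp_seq (wp_assign hE' (by decide) ?_
      (wp_seq ((wp_assign hE' (by decide) ?_ (wp_seq ((wp_query hE' (by decide) (by exact trivial)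
        ?_ (wp_seq ((wp_of_vc hE' guessCmd (Q := fun s' => s'.reg rC =
          min (E.est s.model x / d) (t - 1) ∧ s'.reg rX = x ∧ s'.reg rI = i) ?_).mono (by decide) ?_))).mono ?_
          fun _ _ h => h))).mono (by decide) fun _ _ h => h)))⟩
    · simp only [AExpr.Ok, AExpr.eval, hi, true_and]; omega
    · simp only [AExpr.Ok, AExpr.eval, hi, AState.reg_setReg, true_and, if_true]; omega
    · simp only [AState.model_setReg, e6]; omega
    · have hq : min (s'.setReg rI i).model.m ⌊E.L.fit (s'.setReg rI i).model.m
        (s'.setReg rI i).model.D (rescale (s'.setReg rI i).model.lo (s'.setReg rI i).model.hi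
          (E.key x))⌋₊ = E.est s.model x := by
        simp only [AState.model_setReg]; rw [e6]; rfl
      simp only [AExpr.eval, hi, e4, AState.reg_setReg, AState.arr_setReg, Nat.add_sub_cancel,
        AState.model_setReg, if_true, ← hx] at hq ⊢
      rw [hq]
      have hest : E.est s.model x / d ≤ E.est s.model x := Nat.div_le_self _ _
      have hest' : E.est s.model x ≤ E.n := (min_le_left _ _).trans hmd
      simp only [guessCmd, ACmd.vc, AExpr.Ok, AExpr.eval, AState.reg_setReg, e2, e3]
      simp only [Fin.reduceEq, ne_eq, not_false_eq_true, true_and, and_true, if_true, if_false,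
        ite_eq_right_iff, one_ne_zero, imp_false, not_lt, not_le]
      omega
    · rintro s1 hF1 ⟨h1, h2, h3⟩
      refine wp_seq ((wp_locateCmd (p := p) (t := t) (d := d) (x := x) hE ?_ ?_ ?_ h2 h1 (by omega)
        hd hn ?_).mono ?_ ?_)
      · rw [hF1.reg rPos rfl]; simpa using e1
      · rw [hF1.reg rCells rfl]; simpa using e2
      · rw [hF1.reg rStep rfl]; simpa using e3
      · rw [hF1.arr aS rfl]; simpa [e5] using hm
      · rw [hF1.arr aS rfl]; simp only [AState.arr_setReg, e5]; exact le_rfl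
      · intro s2 hF2 hc2
        have g0 : s2.reg rX = x := by rw [hF2.reg rX rfl, h2]
        have gI : s2.reg rI = i := by rw [hF2.reg rI rfl, h3]
        have g1 : s2.arr aNext = s'.arr aNext := by
          rw [hF2.arr aNext rfl, hF1.arr aNext rfl]; simp
        have g2 : s2.arr aHead = s'.arr aHead := by
          rw [hF2.arr aHead rfl, hF1.arr aHead rfl]; simp
        have g3 : s2.reg rC = E.cellNo pv t x := by
          rw [hc2, hF1.arr aS rfl]; simp only [AState.arr_setReg, e5]; rfl
        have hcell := E.cellNo_lt (pv := pv) (x := x) (t := t) ht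
        refine (wp_of_vc hE' linkCmd ?_).mono (by decide) fun _ _ h => h
        simp only [linkCmd, ACmd.vc, AExpr.Ok, AExpr.eval, AState.reg_setArr, AState.arr_setArr,
          g0, g1, g2, g3]
        refine ⟨trivial, ⟨trivial, by omega⟩, by omega, trivial, trivial, by omega,
          ((seg (s.arr aP) p i).map cost).sum + 8, ?_, i, ?_, by omega, by omega, ?_, le_rfl⟩
        · rw [seg_succ _ (show p ≤ i by omega), ← hx, List.map_append, List.sum_append] at hb
          simp only [hcost, List.map_cons, List.map_nil, List.sum_cons, List.sum_nil] at hb ⊢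
          have : (AExpr.lt (.reg rPos) (.reg rI) : AExpr 24).cost = 3 := rfl
          omega
        · exact gI
        · intro c hc
          rw [seg_cons _ (show i < e by omega), ← hx]
          simp only [Fin.reduceEq, if_true, if_false]
          by_cases hcx : E.cellNo pv t x = c
          · rw [List.filter_cons_of_pos (by simpa using hcx)]
            rw [hcx, Function.update_self]
            refine ⟨rfl, hxn, ?_⟩
            rw [Function.update_self]
            exact (hl c hc).update (fun h => hxnot (List.mem_of_mem_filter h)) _
          · rw [List.filter_cons_of_neg (by simpa using hcx),
              Function.update_of_ne (Ne.symm hcx)]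
            exact (hl c hc).update (fun h => hxnot (List.mem_of_mem_filter h)) _
    · simp only [AExpr.eval, hi, e4, AState.reg_setReg, AState.arr_setReg, Nat.add_sub_cancel,
        AState.model_setReg, if_true, ← hx, Env.queryTime]
      rw [e6]
      exact Nat.add_le_add_right (by decide) _
  · rintro b s' hF ⟨i, hi, hpi, hie, hl, hb⟩ hc
    have e1 : s'.reg rPos = p := by rw [hF.reg rPos rfl]; simpa using hP
    have hpi' : i ≤ p := by simpa [AExpr.eval, hi, e1] using hc
    obtain rfl : i = p := by omega
    have : (AExpr.lt (.reg rPos) (.reg rI) : AExpr 24).cost = 3 := rfl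
    exact ⟨by omega, hl⟩

/-! ### Buckets as array segments. -/

/-- A bucket: the entries between two keys, given by the words `lo` and `hi`, and the parameter
`u` of its level; `u = 0` means that the entries are in order already. -/
structure Bucket where
  lo : ℕ
  hi : ℕ
  u : ℕ
  els : List ℕ

/-- The segment between `p` and `f` consists of the given buckets. -/
def Stored (arr : Fin 9 → ℕ → ℕ) : ℕ → List Bucket → ℕ → Prop
  | p, [], f => p = f
  | p, b :: bs, f => b.els ≠ [] ∧ arr aEnd p = p + b.els.length ∧ arr aU p = b.u ∧
      (b.u ≠ 0 → arr aLo p = b.lo ∧ arr aHi p = b.hi) ∧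
      seg (arr aP) p (p + b.els.length) = b.els ∧ Stored arr (p + b.els.length) bs f

theorem Stored.le {arr : Fin 9 → ℕ → ℕ} {p f : ℕ} {bs : List Bucket} (h : Stored arr p bs f) :
    p ≤ f := by
  induction bs generalizing p with
  | nil => exact le_of_eq h
  | cons b bs ih => exact (Nat.le_add_right _ _).trans (ih h.2.2.2.2.2)

/-- Buckets are nonempty, so their headers lie within their segments; work elsewhere does not affect
them. -/
theorem Stored.congr {arr arr' : Fin 9 → ℕ → ℕ} {p f : ℕ} {bs : List Bucket}
    (h : Stored arr p bs f)
    (hP : ∀ r, (r = aP ∨ r = aEnd ∨ r = aLo ∨ r = aHi ∨ r = aU) → ∀ x, p ≤ x → x < f →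
      arr' r x = arr r x) : Stored arr' p bs f := by
  induction bs generalizing p with
  | nil => exact h
  | cons b bs ih =>
    obtain ⟨h1, h2, h3, h4, h5, h6⟩ := h
    have hpos : 0 < b.els.length := List.length_pos_iff.2 h1
    have hle := h6.le
    refine ⟨h1, ?_, ?_, ?_, ?_, ih h6 fun r hr x hx hx' => hP r hr x (by omega) hx'⟩
    · rw [hP aEnd (by simp) p le_rfl (by omega), h2]
    · rw [hP aU (by simp) p le_rfl (by omega), h3]
    · rw [hP aLo (by simp) p le_rfl (by omega), hP aHi (by simp) p le_rfl (by omega)]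
      exact h4
    · rw [seg_congr fun x hx hx' => hP aP (by simp) x hx (by omega), h5]

theorem Stored.append {arr : Fin 9 → ℕ → ℕ} {p q f : ℕ} {bs bs' : List Bucket}
    (h : Stored arr p bs q) (h' : Stored arr q bs' f) : Stored arr p (bs ++ bs') f := by
  induction bs generalizing p with
  | nil => obtain rfl : p = q := h; exact h'
  | cons b bs ih =>
    obtain ⟨h1, h2, h3, h4, h5, h6⟩ := h
    exact ⟨h1, h2, h3, h4, h5, ih h6⟩

/-- The bucket of the cell `c`. -/
def cellBucket (pv : ℕ → ℕ) (t lo hi v c : ℕ) (l : List ℕ) : Bucket where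
  lo := if c < 2 then lo else pv (c / 2)
  hi := if c / 2 + 1 < t then pv (c / 2 + 1) else hi
  u := if 2 * (c / 2) < c then 0 else v
  els := l

/-- The nonempty buckets of the first `c` cells. -/
def cellBuckets (pv : ℕ → ℕ) (t lo hi v : ℕ) (l : ℕ → List ℕ) (c : ℕ) : List Bucket :=
  ((List.range c).map fun c => cellBucket pv t lo hi v c (l c)).filter fun b => b.els ≠ []

def unlinkCmd : ACmd 24 :=
  .while (.lt (.reg rX) (.reg rN))
    (.store aP (.reg rW) (.reg rX) ;; .assign rW (.add (.reg rW) (.const 1)) ;;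
      .assign rX (.arr aNext (.reg rX)))

/-- The invariant splits the list into the part that has been written and the part that the current
link still reaches. -/
theorem wp_unlinkCmd {E : Env} (hE : E.Wide) {s : AState 24} {a : ℕ} {l : List ℕ}
    (hN : s.reg rN = E.n) (hW : s.reg rW = a) (hl : Linked E.n (s.arr aNext) (s.reg rX) l)
    (ha : a + l.length ≤ E.n) :
    wp E unlinkCmd (40 * l.length + 10) (fun s' => s'.reg rW = a + l.length ∧
      seg (s'.arr aP) a (a + l.length) = l ∧
      ∀ x, x < a ∨ a + l.length ≤ x → s'.arr aP x = s.arr aP x) s := by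
  have hw := hE.wide
  have hE' := hE.toRoomy
  refine wp_while hE' (fun b s' => ∃ l₁ l₂, l = l₁ ++ l₂ ∧ s'.reg rW = a + l₁.length ∧
    Linked E.n (s.arr aNext) (s'.reg rX) l₂ ∧ seg (s'.arr aP) a (a + l₁.length) = l₁ ∧
    (∀ x, x < a ∨ a + l₁.length ≤ x → s'.arr aP x = s.arr aP x) ∧ 40 * l₂.length + 10 ≤ b) ?_ ?_ ?_ ?_
  · exact ⟨[], l, rfl, hW, hl, by simp [seg_self], fun _ _ => rfl, le_rfl⟩
  · intros; exact ⟨trivial, trivial⟩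
  · rintro b s' hF ⟨l₁, l₂, rfl, hw', hl', hs, hx, hb⟩ hc
    have hN' : s'.reg rN = E.n := by rw [hF.reg rN rfl, hN]
    have hnx : s'.arr aNext = s.arr aNext := hF.arr aNext rfl
    cases l₂ with
    | nil =>
      have : s'.reg rX = E.n := hl'
      simp [AExpr.eval, this, hN'] at hc
    | cons y l₂ =>
      obtain ⟨hy, hyn, hl''⟩ := hl'
      simp only [List.length_append, List.length_cons] at ha hb
      refine ⟨_, (wp_of_vc hE' _ ?_)⟩
      simp only [ACmd.vc, AExpr.Ok, AExpr.eval, AState.reg_setReg, AState.arr_setArr,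
        AState.arr_setReg, AState.reg_setArr, hw', hy, hnx]
      refine ⟨trivial, trivial, by omega, by decide, ⟨trivial, by omega, by omega⟩, by decide,
        ⟨trivial, ?_⟩, 40 * l₂.length + 10, ?_, l₁ ++ [y], l₂, by simp, ?_, ?_, ?_, ?_, le_rfl⟩
      · simp only [Fin.reduceEq, if_false]; omega
      · refine le_trans ?_ hb
        have : ∀ z z' : ℕ, z + z' ≤ 40 → z + (40 * l₂.length + 10) + z' ≤
          40 * (l₂.length + 1) + 10 := by omega
        exact this _ _ (by decide)
      · simp; ring
      · simpa using hl''
      · simp only [if_true, List.length_append, List.length_singleton]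
        rw [← add_assoc, seg_update_succ _ _ (by omega), hs]
      · intro x hx'
        simp only [List.length_append, List.length_singleton] at hx'
        simp only [if_true]
        rw [Function.update_of_ne (by omega), hx x (by omega)]
  · rintro b s' hF ⟨l₁, l₂, rfl, hw', hl', hs, hx, hb⟩ hc
    have hN' : s'.reg rN = E.n := by rw [hF.reg rN rfl, hN]
    cases l₂ with
    | nil =>
      have : (AExpr.lt (.reg rX) (.reg rN) : AExpr 24).cost = 3 := rfl
      simp only [List.append_nil]
      exact ⟨by omega, hw', hs, hx⟩
    | cons y l₂ =>
      have h1 := hl'.1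
      have h2 := hl'.2.1
      simp [AExpr.eval, hN', h1, h2] at hc

def recordCmd : ACmd 24 :=
  .store aEnd (.reg rA) (.reg rW) ;;
  .ite (.lt (.reg rC) (.const 2)) (.store aLo (.reg rA) (.reg rLo)) (.store aLo (.reg rA)
    (.arr aS (.add (.reg rPos) (.mul (.div (.reg rC) (.const 2)) (.reg rStep))))) ;;
  .ite (.lt (.add (.div (.reg rC) (.const 2)) (.const 1)) (.reg rCells)) (.store aHi (.reg rA)
    (.arr aS (.add (.reg rPos) (.mul (.add (.div (.reg rC) (.const 2)) (.const 1)) (.reg rStep)))))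
    (.store aHi (.reg rA) (.reg rHi)) ;;
  .ite (.lt (.mul (.const 2) (.div (.reg rC) (.const 2))) (.reg rC))
    (.store aU (.reg rA) (.const 0)) (.store aU (.reg rA) (.reg rV))

theorem wp_recordCmd {E : Env} (hE : E.Wide) {s : AState 24} {p t d lo hi v c a f : ℕ}
    (hP : s.reg rPos = p) (hT : s.reg rCells = t) (hD : s.reg rStep = d) (hLo : s.reg rLo = lo)
    (hHi : s.reg rHi = hi) (hV : s.reg rV = v) (hC : s.reg rC = c) (hA : s.reg rA = a)
    (hW : s.reg rW = f) (hc : c < 2 * t) (hd : 1 ≤ d) (hn : p + t * d ≤ E.n) (ha : a ≤ E.n)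
    (l : List ℕ) :
    wp E recordCmd 130 (fun s' =>
      s'.arr aEnd = Function.update (s.arr aEnd) a f ∧
      s'.arr aLo = Function.update (s.arr aLo) a
        (cellBucket (fun c => s.arr aS (p + c * d)) t lo hi v c l).lo ∧
      s'.arr aHi = Function.update (s.arr aHi) a
        (cellBucket (fun c => s.arr aS (p + c * d)) t lo hi v c l).hi ∧
      s'.arr aU = Function.update (s.arr aU) a
        (cellBucket (fun c => s.arr aS (p + c * d)) t lo hi v c l).u) s := by
  have hw := hE.wide
  have htd : t ≤ t * d := Nat.le_mul_of_pos_right _ hd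
  have hidx : ∀ c, c ≤ t → c * d ≤ t * d := fun c hc => Nat.mul_le_mul_right _ hc
  have h1 := hidx (c / 2) (by omega)
  have h2 := hidx (c / 2 + 1) (by omega)
  refine (wp_of_vc hE.toRoomy _ (?_ : ACmd.vc E recordCmd _ s)).mono (by decide) fun _ _ h => h
  simp only [recordCmd, ACmd.vc, AExpr.Ok, AExpr.eval, AState.arr_setArr, AState.reg_setArr, hP,
    hT, hD, hLo, hHi, hV, hC, hA, hW]
  have h0 : 0 < 2 ^ E.w := by positivity
  by_cases h3 : c < 2 <;> by_cases h4 : c / 2 + 1 < t <;> by_cases h5 : 2 * (c / 2) < c <;>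
    simp only [h3, h4, h5, Fin.reduceEq, ne_eq, true_and, and_true, if_true, if_false,
      one_ne_zero, cellBucket, not_true, false_imp_iff, true_imp_iff, not_false_eq_true] <;> omega

/-- Empty cells are skipped: a header sits at the position of the first entry, and an empty bucket
has none. -/
def gatherBody : ACmd 24 :=
  .assign rX (.arr aHead (.reg rC)) ;;
  .ite (.lt (.reg rX) (.reg rN)) (.assign rA (.reg rW) ;; unlinkCmd ;; recordCmd) .skip

def gatherCmd : ACmd 24 :=
  .assign rW (.reg rPos) ;; .assign rC (.const 0) ;; .forUp rC rLim gatherBody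

theorem cellBuckets_succ (pv : ℕ → ℕ) (t lo hi v : ℕ) (l : ℕ → List ℕ) (c : ℕ) :
    cellBuckets pv t lo hi v l (c + 1) = cellBuckets pv t lo hi v l c ++
      if l c = [] then [] else [cellBucket pv t lo hi v c (l c)] := by
  rw [cellBuckets, cellBuckets, List.range_succ, List.map_append, List.filter_append]
  congr 1
  by_cases h : l c = [] <;> simp [h, cellBucket]

/-- The linked lists hold all entries by now, so the segment in `aP` may be overwritten cell by
cell. -/
theorem wp_gatherCmd {E : Env} (hE : E.Wide) {s : AState 24} {p t d lo hi v : ℕ}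
    (hP : s.reg rPos = p) (hT : s.reg rCells = t) (hD : s.reg rStep = d) (hLo : s.reg rLo = lo)
    (hHi : s.reg rHi = hi) (hV : s.reg rV = v) (hN : s.reg rN = E.n) (hLim : s.reg rLim = 2 * t)
    (hd : 1 ≤ d) (hn : p + t * d ≤ E.n) (ht : 2 * t ≤ E.n) (l : ℕ → List ℕ)
    (hl : ∀ c < 2 * t, Linked E.n (s.arr aNext) (s.arr aHead c) (l c))
    (hlen : p + ∑ c ∈ Finset.range (2 * t), (l c).length ≤ E.n) :
    wp E gatherCmd (400 * t + 40 * (∑ c ∈ Finset.range (2 * t), (l c).length) + 20) (fun s' =>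
      Stored s'.arr p (cellBuckets (fun c => s.arr aS (p + c * d)) t lo hi v l (2 * t))
        (p + ∑ c ∈ Finset.range (2 * t), (l c).length) ∧
      ∀ r x, x < p ∨ p + ∑ c ∈ Finset.range (2 * t), (l c).length ≤ x → s'.arr r x = s.arr r x)
      s := by
  have hw := hE.wide
  have hE' := hE.toRoomy
  set pv : ℕ → ℕ := fun c => s.arr aS (p + c * d) with hpv
  set len : ℕ → ℕ := fun c => ∑ c ∈ Finset.range c, (l c).length with hlendef
  have hmono : ∀ c ≤ 2 * t, len c ≤ len (2 * t) := fun c hc =>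
    Finset.sum_le_sum_of_subset (Finset.range_mono hc)
  have hsucc : ∀ c, len (c + 1) = len c + (l c).length := fun c => Finset.sum_range_succ _ _
  change p + len (2 * t) ≤ E.n at hlen
  refine (wp_seq (t := 2) (t' := 2 + (∑ c ∈ Finset.Ico 0 (2 * t), (40 * (l c).length + 190 + 8) + 4))
    (wp_assign hE' (by decide) (by exact trivial) (wp_seq (wp_assign hE' (by decide)
    (by simp only [AExpr.Ok]; omega) ((wp_forUp (x := rC) (y := rLim) hE' (by decide) (by decide)
      rfl rfl (fun c s' => s'.reg rW = p + len c ∧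
        Stored s'.arr p (cellBuckets pv t lo hi v l c) (p + len c) ∧
        ∀ r x, x < p ∨ p + len c ≤ x → s'.arr r x = s.arr r x)
        (fun c => 40 * (l c).length + 190) (a := 0) (b := 2 * t)
        ?_ ?_ (by omega) (by omega) ?_ ?_ ?_).mono le_rfl ?_))))).mono ?_ fun _ _ h => h
  · simp [AExpr.eval]
  · simp [AExpr.eval, hLim]
  · refine ⟨by simp [AExpr.eval, hP, hlendef], ?_, fun r x _ => by simp⟩
    simp [cellBuckets, Stored, hlendef]
  · intro i s v hs; simpa using hs
  · rintro c s' - hc hF hc' ⟨h1, h2, h3⟩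
    have e1 : s'.reg rPos = p := by rw [hF.reg rPos rfl]; simpa using hP
    have e2 : s'.reg rCells = t := by rw [hF.reg rCells rfl]; simpa using hT
    have e3 : s'.reg rStep = d := by rw [hF.reg rStep rfl]; simpa using hD
    have e4 : s'.reg rLo = lo := by rw [hF.reg rLo rfl]; simpa using hLo
    have e5 : s'.reg rHi = hi := by rw [hF.reg rHi rfl]; simpa using hHi
    have e6 : s'.reg rV = v := by rw [hF.reg rV rfl]; simpa using hV
    have e7 : s'.reg rN = E.n := by rw [hF.reg rN rfl]; simpa using hN
    have e8 : s'.arr aS = s.arr aS := by rw [hF.arr aS rfl]; simp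
    have e9 : s'.arr aHead = s.arr aHead := by rw [hF.arr aHead rfl]; simp
    have e10 : s'.arr aNext = s.arr aNext := by rw [hF.arr aNext rfl]; simp
    have hlc := hl c hc
    have hlen' : p + len (c + 1) ≤ p + len (2 * t) := Nat.add_le_add_left (hmono (c + 1) hc) _
    rw [hsucc] at hlen' ⊢
    have hcost : (AExpr.lt (.reg rX) (.reg rN) : AExpr 24).cost = 3 := rfl
    refine (wp_seq (t := 10) (t' := 40 * (l c).length + 160 +
      ((AExpr.lt (.reg rX) (.reg rN) : AExpr 24).cost + 1)) ((wp_assign hE' (by decide) ?_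
      (wp_ite (e := .lt (.reg rX) (.reg rN)) hE' ⟨trivial, trivial⟩ ?_ ?_)).mono
        (by decide) fun _ _ h => h)).mono (by omega) fun _ _ h => h
    · simp only [AExpr.Ok, AExpr.eval, hc', true_and]; omega
    · intro hx
      have hx' : s.arr aHead c < E.n := by simpa [AExpr.eval, hc', e7, e9] using hx
      have hne : l c ≠ [] := by
        intro h
        rw [h] at hlc
        have : s.arr aHead c = E.n := hlc
        omega
      refine (wp_seq (t := 2) (t' := (40 * (l c).length + 10) + 130) (wp_assign hE' (by decide)
        (by exact trivial) (wp_seq ((wp_unlinkCmd (l := l c) (a := p + len c) hE ?_ ?_ ?_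
          (by omega)).mono le_rfl ?_)))).mono (by omega) fun _ _ h => h
      · simpa using e7
      · simpa using h1
      · simpa [AExpr.eval, hc', e9, e10] using hlc
      · rintro s2 hF2 ⟨g1, g2, g3⟩
        have k8 : s2.arr aS = s.arr aS := by rw [hF2.arr aS rfl]; simpa using e8
        have kE : s2.arr aEnd = s'.arr aEnd := by rw [hF2.arr aEnd rfl]; simp
        have kL : s2.arr aLo = s'.arr aLo := by rw [hF2.arr aLo rfl]; simp
        have kH : s2.arr aHi = s'.arr aHi := by rw [hF2.arr aHi rfl]; simp
        have kU : s2.arr aU = s'.arr aU := by rw [hF2.arr aU rfl]; simp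
        refine (wp_recordCmd (p := p) (t := t) (d := d) (lo := lo) (hi := hi) (v := v) (c := c)
          (a := p + len c) (f := p + len c + (l c).length) hE ?_ ?_ ?_ ?_ ?_ ?_ ?_ ?_ g1
          hc hd hn (by omega) (l c)).mono le_rfl ?_
        · rw [hF2.reg rPos rfl]; simpa using e1
        · rw [hF2.reg rCells rfl]; simpa using e2
        · rw [hF2.reg rStep rfl]; simpa using e3
        · rw [hF2.reg rLo rfl]; simpa using e4
        · rw [hF2.reg rHi rfl]; simpa using e5
        · rw [hF2.reg rV rfl]; simpa using e6
        · rw [hF2.reg rC rfl]; simpa using hc'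
        · rw [hF2.reg rA rfl]; simpa [AExpr.eval] using h1
        · rintro s3 hF3 ⟨k1, k2, k3, k4⟩
          rw [k8] at k2 k3 k4
          rw [kE] at k1
          rw [kL] at k2
          rw [kH] at k3
          rw [kU] at k4
          have k5 : s3.arr aP = s2.arr aP := hF3.arr aP rfl
          have kP : s2.arr aP = s2.arr aP := rfl
          -- The header changes only at the first position of the new bucket; the bucket is
          -- nonempty, so this position lies inside it.
          have hsame : ∀ r x, x < p + len c ∨ p + len c + (l c).length ≤ x →
              s3.arr r x = s'.arr r x := by
            have hpos : 0 < (l c).length := List.length_pos_iff.2 hne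
            intro r x hx
            fin_cases r
            · change s3.arr aP x = _
              rw [k5, g3 x hx]; simp
            · change s3.arr aS x = s'.arr aS x
              rw [hF3.arr aS rfl, k8, e8]
            · change s3.arr aQ x = s'.arr aQ x
              rw [hF3.arr aQ rfl, hF2.arr aQ rfl]; simp
            · change s3.arr aEnd x = s'.arr aEnd x
              rw [k1, Function.update_of_ne (by omega)]
            · change s3.arr aLo x = s'.arr aLo x
              rw [k2, Function.update_of_ne (by omega)]
            · change s3.arr aHi x = s'.arr aHi x
              rw [k3, Function.update_of_ne (by omega)]
            · change s3.arr aU x = s'.arr aU x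
              rw [k4, Function.update_of_ne (by omega)]
            · change s3.arr aHead x = s'.arr aHead x
              rw [hF3.arr aHead rfl, hF2.arr aHead rfl]; simp
            · change s3.arr aNext x = s'.arr aNext x
              rw [hF3.arr aNext rfl, hF2.arr aNext rfl]; simp
          refine ⟨?_, ?_, ?_⟩
          · rw [hF3.reg rW rfl, g1, add_assoc]
          · rw [cellBuckets_succ, if_neg hne]
            refine (h2.congr fun r _ x _ hx => hsame r x (.inl hx)).append ?_
            refine ⟨hne, ?_, ?_, ?_, ?_, ?_⟩
            · rw [k1]; simp [cellBucket]
            · rw [k4, Function.update_self]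
            · intro _
              rw [k2, k3, Function.update_self, Function.update_self]
              exact ⟨rfl, rfl⟩
            · rw [k5]; exact g2
            · exact add_assoc _ _ _
          · intro r x hx
            rw [hsame r x (by omega), h3 r x (by omega)]
    · intro hx
      have hx' : E.n ≤ s.arr aHead c := by simpa [AExpr.eval, hc', e7, e9] using hx
      have hnil : l c = [] := by
        cases hlc' : l c with
        | nil => rfl
        | cons y l' =>
          rw [hlc'] at hlc
          have h1 := hlc.1
          have h2 := hlc.2.1
          omega
      refine (wp_skip ?_).mono (by omega) fun _ _ h => h
      simp only [AState.reg_setReg, AState.arr_setReg, cellBuckets_succ, hnil, if_true,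
        List.append_nil, List.length_nil, add_zero]
      exact ⟨h1, h2, h3⟩
  · rintro s' hF ⟨⟨h1, h2, h3⟩, h4⟩
    exact ⟨h2, h3⟩
  · rw [← Finset.range_eq_Ico]
    simp only [Finset.sum_add_distrib, ← Finset.mul_sum, Finset.sum_const, Finset.card_range,
      smul_eq_mul]
    change 2 + (2 + (40 * len (2 * t) + _ + _ + 4)) ≤ 400 * t + 40 * len (2 * t) + 20
    omega

/-! ### Splitting a bucket. -/

/-- The model trained on the first `m` entries of a bucket. -/
noncomputable def Env.bucketModel (E : Env) (lo hi : ℕ) (els : List ℕ) (m : ℕ) : Model where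
  m := m
  D := fun j => rescale (E.key lo) (E.key hi) (E.key (els.getD j 0))
  lo := E.key lo
  hi := E.key hi

theorem seg_getD (f : ℕ → ℕ) {a b i : ℕ} (h : a + i < b) : (seg f a b).getD i 0 = f (a + i) := by
  rw [List.getD_eq_getElem _ _ (by simp; omega), seg_getElem]

theorem take_seg (f : ℕ → ℕ) {a b m : ℕ} (h : a + m ≤ b) : (seg f a b).take m = seg f a (a + m) := by
  rw [seg_append f (Nat.le_add_right a m) h, List.take_left' (by simp)]

theorem sum_length_filter (l : List ℕ) (g : ℕ → ℕ) (n : ℕ) (h : ∀ x ∈ l, g x < n) :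
    ∑ c ∈ Finset.range n, (l.filter fun x => g x = c).length = l.length := by
  induction l with
  | nil => simp
  | cons x l ih =>
    have h1 : ∀ c, ((x :: l).filter fun x => g x = c).length =
        (if g x = c then 1 else 0) + (l.filter fun x => g x = c).length := by
      intro c
      by_cases hc : g x = c
      · rw [List.filter_cons_of_pos (by simpa using hc)]; simp [hc]; ring
      · rw [List.filter_cons_of_neg (by simpa using hc)]; simp [hc]
    simp only [h1, Finset.sum_add_distrib]
    rw [ih fun y hy => h y (List.mem_cons_of_mem _ hy), Finset.sum_ite_eq]
    simp [h x (by simp)]; ring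

/-- For a bucket of about `N = u ^ 10` entries, the sample has about `N ^ (1/2)` entries, there are
`N ^ (1/5)` intervals between pivots, and these are `N ^ (3/10)` sample ranks apart. The spacing
exceeds the typical error `√m = N ^ (1/4)` by the factor `√u`. -/
def splitCmd : ACmd 24 :=
  .assign rF (.add (.reg rPos) (.reg rM)) ;; sortCmd ;;
  .assign rStep (.mul (.mul (.reg rU) (.reg rU)) (.reg rU)) ;;
  .assign rCells (.mul (.reg rU) (.reg rU)) ;;
  .train (.reg rLo) (.reg rHi) aP (.reg rPos) (.reg rM) ;;
  headsCmd ;; scatterCmd ;; gatherCmd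

/-- Sorted versions of the first `m` entries of a list. -/
def Env.SortedSample (E : Env) (els : List ℕ) (m : ℕ) (S : ℕ → ℕ) : Prop :=
  (seg S 0 m).Pairwise (fun x y => E.key x ≤ E.key y) ∧ (seg S 0 m).Perm (els.take m)

theorem Env.SortedSample.pivotsMono {E : Env} {els : List ℕ} {S : ℕ → ℕ} {d t : ℕ}
    (h : E.SortedSample els (t * d) S) (hd : 1 ≤ d) : E.PivotsMono (fun c => S (c * d)) t := by
  intro c c' _ h1 h2
  rcases h1.eq_or_lt with rfl | h1
  · exact le_rfl
  · exact pairwise_seg.1 h.1 _ _ (Nat.zero_le _) (Nat.mul_lt_mul_of_pos_right h1 hd)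
      (Nat.mul_lt_mul_of_pos_right h2 hd)

/-- The sorted sample is only known to be some ordered rearrangement, since keys may coincide.
Therefore the bound `W` on the walks is required for all of them, and the result asserts the
existence of one. -/
theorem wp_splitCmd {E : Env} (hE : E.Wide) {s : AState 24} {p e u v lo hi : ℕ} {els : List ℕ}
    (hN : s.reg rN = E.n)
    (hP : s.reg rPos = p) (hEnd : s.reg rEnd = e) (hU : s.reg rU = u) (hV : s.reg rV = v)
    (hM : s.reg rM = u ^ 5) (hLo : s.reg rLo = lo) (hHi : s.reg rHi = hi) (hu : 2 ≤ u)
    (hm : p + u ^ 5 ≤ e) (he : e ≤ E.n) (hels : seg (s.arr aP) p e = els) (hnd : els.Nodup)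
    (hlt : ∀ x ∈ els, x < E.n) (W T : ℕ)
    (hW : ∀ S, E.SortedSample els (u ^ 5) S → (els.map (E.walk (E.bucketModel lo hi els (u ^ 5))
      (fun c => S (c * u ^ 3)) (u ^ 3) (u ^ 2))).sum ≤ W)
    (hT : ∀ x ∈ els, E.queryTime (E.bucketModel lo hi els (u ^ 5)) x ≤ T) :
    wp E splitCmd (E.L.trainTime (u ^ 5) (E.bucketModel lo hi els (u ^ 5)).D +
      (2000 * (u ^ 5 * (Nat.clog 2 (u ^ 5) + 1) + 1) + els.length * (T + 600) + 100 * W)) (fun s' =>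
      ∃ S, E.SortedSample els (u ^ 5) S ∧
        Stored s'.arr p (cellBuckets (fun c => S (c * u ^ 3)) (u ^ 2) lo hi v
          (fun c => els.filter fun x => E.cellNo (fun c => S (c * u ^ 3)) (u ^ 2) x = c)
          (2 * u ^ 2)) e ∧
        (∀ r, (r = aP ∨ r = aEnd ∨ r = aLo ∨ r = aHi ∨ r = aU) → ∀ x, x < p ∨ e ≤ x →
          s'.arr r x = s.arr r x) ∧
        s'.peak = max s.peak (E.L.modelSize (u ^ 5) (E.bucketModel lo hi els (u ^ 5)).D)) s := by
  have hw := hE.wide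
  have hE' := hE.toRoomy
  have hu5 : u ^ 2 * u ^ 3 = u ^ 5 := by ring
  have hu3 : 1 ≤ u ^ 3 := Nat.one_le_pow _ _ (by omega)
  have hu2 : 1 ≤ u ^ 2 := Nat.one_le_pow _ _ (by omega)
  -- The list heads of all cells fit into one row because there are fewer cells than sample entries.
  have hu23 : 2 * u ^ 2 ≤ u ^ 5 := by
    calc 2 * u ^ 2 ≤ u ^ 3 * u ^ 2 := by
          have : 2 ^ 3 ≤ u ^ 3 := Nat.pow_le_pow_left hu 3
          exact Nat.mul_le_mul_right _ (by omega)
      _ = u ^ 5 := by ring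
  have hu35 : u ^ 3 ≤ u ^ 5 := Nat.pow_le_pow_right (by omega) (by norm_num)
  have hlen : els.length = e - p := by rw [← hels, length_seg]
  set md := E.bucketModel lo hi els (u ^ 5) with hmd
  have hcl : u ^ 5 ≤ u ^ 5 * (Nat.clog 2 (u ^ 5) + 1) := Nat.le_mul_of_pos_right _ (by omega)
  set SC := u ^ 5 * (Nat.clog 2 (u ^ 5) + 1) with hSC
  have hD : (fun j : Fin (u ^ 5) => rescale (E.key lo) (E.key hi) (E.key (s.arr aP (p + j)))) =
      md.D := by
    funext j
    change _ = rescale (E.key lo) (E.key hi) (E.key (els.getD j 0))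
    rw [← hels, seg_getD _ (by have := j.isLt; omega)]
  rw [show E.L.trainTime (u ^ 5) (E.bucketModel lo hi els (u ^ 5)).D =
    E.L.trainTime (u ^ 5) md.D from rfl]
  refine (wp_seq (t := 4) (t' := 300 * (SC + 1) + (6 + (4 + ((4 + 7 + u ^ 5 +
    E.L.trainTime (u ^ 5) md.D) + ((60 * u ^ 2 + 20) +
    ((els.length * (T + 500) + 100 * W + 10) + (400 * u ^ 2 + 40 * els.length + 20)))))))
    ((wp_assign (x := rF) (e := .add (.reg rPos) (.reg rM)) hE' (by decide) ⟨trivial, trivial, ?_⟩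
      ?_).mono (by decide) fun _ _ h => h)).mono
    (by have := mul_add els.length T 500
        have := mul_add els.length T 600
        omega) fun _ _ h => h
  · simp only [AExpr.eval, hP, hM]; omega
  refine wp_seq ((wp_sortCmd (p := p) (f := p + u ^ 5) hE (by simpa using hP)
    (by simp [AExpr.eval, hP, hM]) (by omega) (by omega)).mono ?_ ?_)
  · rw [Nat.add_sub_cancel_left]
  rintro s1 hF1 ⟨h1, h2⟩
  have a1 : s1.reg rU = u := by rw [hF1.reg rU rfl]; simpa using hU
  have a2 : s1.reg rPos = p := by rw [hF1.reg rPos rfl]; simpa using hP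
  have a3 : s1.reg rM = u ^ 5 := by rw [hF1.reg rM rfl]; simpa using hM
  have a4 : s1.reg rLo = lo := by rw [hF1.reg rLo rfl]; simpa using hLo
  have a5 : s1.reg rHi = hi := by rw [hF1.reg rHi rfl]; simpa using hHi
  have a6 : s1.reg rEnd = e := by rw [hF1.reg rEnd rfl]; simpa using hEnd
  have a7 : s1.reg rV = v := by rw [hF1.reg rV rfl]; simpa using hV
  have a8 : s1.reg rN = E.n := by rw [hF1.reg rN rfl]; simpa using hN
  have aarr : ∀ r, r ≠ aS → r ≠ aQ → s1.arr r = s.arr r := by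
    intro r hr hr'
    rw [hF1.arr r (by fin_cases r <;> first | rfl | exact absurd rfl hr | exact absurd rfl hr')]
    simp
  have apk : s1.peak = s.peak := by rw [hF1.peak rfl]; simp
  refine wp_seq ((wp_assign (e := .mul (.mul (.reg rU) (.reg rU)) (.reg rU)) hE' (by decide)
    ⟨⟨trivial, trivial, ?_⟩, trivial, ?_⟩ ?_).mono
    (by decide) fun _ _ h => h)
  · simp only [AExpr.eval, a1]; rw [← sq]; omega
  · simp only [AExpr.eval, a1]
    have : u * u * u = u ^ 3 := by ring
    omega
  refine wp_seq ((wp_assign (e := .mul (.reg rU) (.reg rU)) hE' (by decide)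
    ⟨trivial, trivial, ?_⟩ ?_).mono
    (by decide) fun _ _ h => h)
  · simp only [AExpr.eval, AState.reg_setReg, a1, Fin.reduceEq, if_false]; rw [← sq]; omega
  have hD1 : (fun j : Fin (u ^ 5) => rescale (E.key lo) (E.key hi) (E.key (s1.arr aP (p + j)))) =
      md.D := by rw [aarr aP (by decide) (by decide), hD]
  refine wp_seq ((wp_train_of_eq (lo := .reg rLo) (hi := .reg rHi) (a := .reg rPos) (m := .reg rM)
    (vl := lo) (vh := hi) (va := p) (vm := u ^ 5) hE' trivial trivial trivial trivial
    (by simpa [AExpr.eval] using a4) (by simpa [AExpr.eval] using a5)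
    (by simpa [AExpr.eval] using a2) (by simpa [AExpr.eval] using a3) (by omega) ?_).mono ?_
      fun _ _ h => h)
  rotate_left
  · simp only [AState.arr_setReg, hD1]
    exact Nat.add_le_add_right (Nat.add_le_add_right (by decide) _) _
  set s2 := ((s1.setReg rStep _).setReg rCells _).train E lo hi aP p (u ^ 5) with hs2
  have b1 : s2.reg rStep = u ^ 3 := by
    simp [hs2, AState.train, AExpr.eval, a1]; ring
  have b2 : s2.reg rCells = u ^ 2 := by
    simp [hs2, AState.train, AExpr.eval, a1]; ring
  have b3 : s2.model = md := by
    change Model.mk (u ^ 5) (fun j : Fin (u ^ 5) => rescale (E.key lo) (E.key hi)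
      (E.key (s1.arr aP (p + j)))) _ _ = _
    rw [hD1]; rfl
  have b4 : s2.peak = max s.peak (E.L.modelSize (u ^ 5) md.D) := by
    change max s1.peak (E.L.modelSize (u ^ 5) (fun j : Fin (u ^ 5) => rescale (E.key lo) (E.key hi)
      (E.key (s1.arr aP (p + j))))) = _
    rw [hD1, apk]
  have b5 : s2.arr = s1.arr := rfl
  have breg : ∀ x, x ≠ rStep → x ≠ rCells → s2.reg x = s1.reg x := by
    intro x hx hx'
    simp [hs2, AState.train, hx, hx']
  clear_value s2
  refine wp_seq ((wp_headsCmd hE (t := u ^ 2) (by rw [breg _ (by decide) (by decide), a8]) b2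
    (by omega)).mono le_rfl ?_)
  rintro s3 hF3 ⟨c1, c2⟩
  have c3 : s3.reg rPos = p := by rw [hF3.reg rPos rfl, breg _ (by decide) (by decide), a2]
  have c4 : s3.arr aS = s1.arr aS := by rw [hF3.arr aS rfl, b5]
  have c5 : s3.arr aP = s.arr aP := by
    rw [hF3.arr aP rfl, b5, aarr aP (by decide) (by decide)]
  have c6 : s3.model = md := by rw [hF3.model rfl, b3]
  -- Shifted to start at 0, the sorted sample no longer refers to the position of the bucket.
  obtain ⟨S, hS⟩ : ∃ S : ℕ → ℕ, S = fun i => s1.arr aS (p + i) := ⟨_, rfl⟩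
  have hseg : seg S 0 (u ^ 5) = seg (s1.arr aS) p (p + u ^ 5) := by
    refine List.ext_getElem (by simp) fun i hi hi' => ?_
    rw [seg_getElem, seg_getElem, hS]; simp
  have hSS : E.SortedSample els (u ^ 5) S := by
    refine ⟨by rw [hseg]; exact h1, ?_⟩
    rw [hseg, ← hels, take_seg _ (by omega)]
    simpa using h2
  have hpm : E.PivotsMono (fun c => S (c * u ^ 3)) (u ^ 2) := by
    rw [← hu5] at hSS; exact hSS.pivotsMono hu3
  have hpv : (fun c => s3.arr aS (p + c * u ^ 3)) = fun c => S (c * u ^ 3) := by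
    rw [c4, hS]
  refine wp_seq ((wp_scatterCmd hE (p := p) (e := e) (t := u ^ 2) (d := u ^ 3) c3
    (by rw [hF3.reg rEnd rfl, breg _ (by decide) (by decide), a6])
    (by rw [hF3.reg rCells rfl, b2]) (by rw [hF3.reg rStep rfl, b1]) hu2 hu3 (by omega)
    (by omega) (by omega) he (by rw [c6]; change u ^ 5 ≤ _; omega) (by rw [hpv]; exact hpm)
    (by rw [c5, hels]; exact hnd) (by rw [c5, hels]; exact hlt) c2).mono ?_ ?_)
  · rw [c5, hels, hpv, c6]
    have h3 := hW S hSS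
    have h4 : ∀ l : List ℕ, (∀ x ∈ l, x ∈ els) → (l.map fun x => E.queryTime md x + (100 *
        E.walk md (fun c => S (c * u ^ 3)) (u ^ 3) (u ^ 2) x + 500)).sum ≤
        l.length * (T + 500) +
          100 * (l.map (E.walk md (fun c => S (c * u ^ 3)) (u ^ 3) (u ^ 2))).sum := by
      intro l hl
      induction l with
      | nil => simp
      | cons x l ih =>
        have := ih fun y hy => hl y (List.mem_cons_of_mem _ hy)
        have := hT x (hl x (by simp))
        simp only [List.map_cons, List.sum_cons, List.length_cons, add_mul, one_mul, mul_add] at *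
        omega
    have := h4 els fun _ h => h
    omega
  · intro s4 hF4 hl
    rw [c5, hels, hpv] at hl
    have hsum : ∑ c ∈ Finset.range (2 * u ^ 2), (els.filter fun x =>
        E.cellNo (fun c => S (c * u ^ 3)) (u ^ 2) x = c).length = els.length :=
      sum_length_filter _ _ _ fun x _ => E.cellNo_lt hu2
    have dpv : (fun c => s4.arr aS (p + c * u ^ 3)) = fun c => S (c * u ^ 3) := by
      rw [hF4.arr aS rfl, hpv]
    have dreg : ∀ x, scatterCmd.writesReg x = false → headsCmd.writesReg x = false →
        x ≠ rStep → x ≠ rCells → s4.reg x = s1.reg x := fun x h h' h3 h4 => by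
      rw [hF4.reg x h, hF3.reg x h', breg x h3 h4]
    refine (wp_gatherCmd hE (p := p) (t := u ^ 2) (d := u ^ 3) (lo := lo) (hi := hi) (v := v)
      (by rw [hF4.reg rPos rfl, c3]) (by rw [hF4.reg rCells rfl, hF3.reg rCells rfl, b2])
      (by rw [hF4.reg rStep rfl, hF3.reg rStep rfl, b1])
      (by rw [dreg rLo rfl rfl (by decide) (by decide), a4])
      (by rw [dreg rHi rfl rfl (by decide) (by decide), a5])
      (by rw [dreg rV rfl rfl (by decide) (by decide), a7])
      (by rw [dreg rN rfl rfl (by decide) (by decide), a8])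
      (by rw [hF4.reg rLim rfl, c1]) hu3 (by omega) (by omega) _ hl (by rw [hsum]; omega)).mono
      (by rw [hsum]) ?_
    rintro s5 hF5 ⟨g1, g2⟩
    rw [hsum, dpv, hlen, Nat.add_sub_cancel' (by omega)] at g1
    rw [hsum, hlen, Nat.add_sub_cancel' (by omega)] at g2
    refine ⟨S, hSS, g1, ?_, ?_⟩
    · intro r hr x hx
      rw [g2 r x hx]
      have hr' : s4.arr r = s.arr r := by
        rcases hr with rfl | rfl | rfl | rfl | rfl
        all_goals
          rw [hF4.arr _ rfl, hF3.arr _ rfl, b5, aarr _ (by decide) (by decide)]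
      rw [hr']
    · rw [hF5.peak rfl, hF4.peak rfl, hF3.peak rfl, b4]

/-! ### The cells of a bucket -/

/-- The key of `x` lies between the end points; the words `n` and `n + 1` stand for no bound. -/
def Env.Between (E : Env) (lo hi x : ℕ) : Prop :=
  (lo = E.n ∨ E.key lo < E.key x) ∧ (hi = E.n + 1 ∨ E.key x < E.key hi)

open Classical in
/-- The entries of the input array between two keys, in the order of the array. -/
noncomputable def Env.elems (E : Env) (lo hi : ℕ) : List ℕ :=
  (List.range E.n).filter fun x => E.Between lo hi x

/-- Valid end points of intervals. -/
def Env.Valid (E : Env) (lo hi : ℕ) : Prop := lo ≤ E.n ∧ (hi < E.n ∨ hi = E.n + 1)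

variable {E : Env} {lo hi v t d : ℕ} {S : ℕ → ℕ}

theorem Env.mem_elems {x : ℕ} : x ∈ E.elems lo hi ↔ x < E.n ∧ E.Between lo hi x := by
  simp [Env.elems]

theorem Env.elems_nodup : (E.elems lo hi).Nodup := List.nodup_range.filter _

theorem Env.elems_length_le : (E.elems lo hi).length ≤ E.n :=
  (List.length_filter_le _ _).trans (by simp)

theorem Env.elems_root : E.elems E.n (E.n + 1) = List.range E.n := by
  simp [Env.elems, Env.Between]

theorem Env.SortedSample.mem {els : List ℕ} {m i : ℕ} (h : E.SortedSample els m S) (hi : i < m) :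
    S i ∈ els.take m := h.2.subset (mem_seg.2 ⟨i, Nat.zero_le _, hi, rfl⟩)

theorem Env.SortedSample.mono {els : List ℕ} {m i j : ℕ} (h : E.SortedSample els m S)
    (hij : i ≤ j) (hj : j < m) : E.key (S i) ≤ E.key (S j) := by
  rcases hij.eq_or_lt with rfl | hij
  · exact le_rfl
  · exact pairwise_seg.1 h.1 _ _ (Nat.zero_le _) hij hj

theorem Env.SortedSample.pivot_mem {els : List ℕ} (h : E.SortedSample els (t * d) S) (hd : 1 ≤ d)
    {c : ℕ} (hc : c < t) : S (c * d) ∈ els :=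
  List.mem_of_mem_take (h.mem (Nat.mul_lt_mul_of_pos_right hc hd))

section buckets
variable (h : E.SortedSample (E.elems lo hi) (t * d) S) (hd : 1 ≤ d)
include h hd

/-- Pivots belong to the bucket, so that lying strictly between two of them implies lying in the
bucket. Hence a child again consists of all entries between two keys: it is determined by the words
for its end points, whatever the history of splits. -/
theorem Env.cellNo_eq_two_mul {c x : ℕ} (hc : c < t) :
    E.Between lo hi x ∧ E.cellNo (fun c => S (c * d)) t x = 2 * c ↔
      E.Between (cellBucket (fun c => S (c * d)) t lo hi v (2 * c) []).lo
        (cellBucket (fun c => S (c * d)) t lo hi v (2 * c) []).hi x := by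
  set pv : ℕ → ℕ := fun c => S (c * d) with hpv
  have hm : E.PivotsMono pv t := h.pivotsMono hd
  have hmem : ∀ c < t, pv c < E.n ∧ E.Between lo hi (pv c) := fun c hc =>
    E.mem_elems.1 (h.pivot_mem hd hc)
  have hdiv : 2 * c / 2 = c := by omega
  have hcell : E.cellNo pv t x = 2 * c ↔ E.slot pv t x = c ∧
      (c + 1 < t → E.key x < E.key (pv (c + 1))) := by
    unfold Env.cellNo
    constructor
    · intro h1
      split_ifs at h1 with h2
      · omega
      · obtain rfl : E.slot pv t x = c := by omega
        refine ⟨rfl, fun h3 => ?_⟩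
        by_contra h4
        exact h2 ⟨h3, h4⟩
    · rintro ⟨rfl, h1⟩
      rw [if_neg fun h2 => h2.2 (h1 h2.1)]
  simp only [cellBucket, hdiv]
  rw [hcell]
  constructor
  · rintro ⟨⟨h1, h2⟩, h3, h4⟩
    constructor
    · split_ifs with hc2
      · exact h1
      · right
        rcases E.slot_spec (pv := pv) (t := t) (x := x) with h5 | h5
        · omega
        · rwa [h3] at h5
    · split_ifs with hc2
      · exact .inr (h4 hc2)
      · exact h2
  · rintro ⟨h1, h2⟩
    have h3 : c = 0 ∨ E.key (pv c) < E.key x := by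
      rcases Nat.eq_zero_or_pos c with h0 | h0
      · exact .inl h0
      · rw [if_neg (by omega)] at h1
        exact .inr (h1.resolve_left (by have := (hmem c hc).1; omega))
    have h4 : c + 1 < t → E.key x < E.key (pv (c + 1)) := by
      intro h5
      rw [if_pos h5] at h2
      exact h2.resolve_left (by have := (hmem _ h5).1; omega)
    refine ⟨⟨?_, ?_⟩, E.slot_eq hm hc h3 fun h5 => (h4 h5).not_gt, h4⟩
    · rcases Nat.eq_zero_or_pos c with h0 | h0
      · rwa [if_pos (by omega)] at h1
      · rcases (hmem c hc).2.1 with h6 | h6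
        · exact .inl h6
        · exact .inr (h6.trans (h3.resolve_left (by omega)))
    · by_cases h5 : c + 1 < t
      · rcases (hmem _ h5).2.2 with h6 | h6
        · exact .inl h6
        · exact .inr ((h4 h5).trans h6)
      · rwa [if_neg h5] at h2

-- Both sides filter the positions in increasing order, so they agree as lists and not just as sets;
-- the sample of the child depends on this.
open Classical in
theorem Env.filter_cell_eq {c : ℕ} (hc : c < t) (l : List ℕ) :
    ((E.elems lo hi).filter fun x => E.cellNo (fun c => S (c * d)) t x = 2 * c) =
      E.elems (cellBucket (fun c => S (c * d)) t lo hi v (2 * c) l).lo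
        (cellBucket (fun c => S (c * d)) t lo hi v (2 * c) l).hi := by
  rw [Env.elems, List.filter_filter, Env.elems]
  refine List.filter_congr fun x _ => ?_
  have := Env.cellNo_eq_two_mul (v := v) (x := x) h hd hc
  rw [← Bool.decide_and]
  exact decide_eq_decide.2 (by rw [and_comm]; exact this)

theorem Env.valid_cell (hv : E.Valid lo hi) {c : ℕ} (hc : c < t) (l : List ℕ) :
    E.Valid (cellBucket (fun c => S (c * d)) t lo hi v (2 * c) l).lo
        (cellBucket (fun c => S (c * d)) t lo hi v (2 * c) l).hi := by
  have hmem : ∀ c < t, S (c * d) < E.n := fun c hc =>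
    (E.mem_elems.1 (h.pivot_mem hd hc)).1
  have hdiv : 2 * c / 2 = c := by omega
  simp only [cellBucket, hdiv]
  constructor
  · split_ifs
    · exact hv.1
    · exact (hmem c hc).le
  · split_ifs with h1
    · exact .inl (hmem _ h1)
    · exact hv.2

-- In the sorted sample, only the positions `c * d, …, (c + 1) * d - 1` can lie strictly between the
-- two pivots: earlier keys are at most the lower one, later keys are at least the upper one.
open Classical in
theorem Env.countP_cell_le {c : ℕ} (hc : c < t) (l : List ℕ) :
    ((E.elems lo hi).take (t * d)).countP (fun x =>
      E.Between (cellBucket (fun c => S (c * d)) t lo hi v (2 * c) l).lo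
        (cellBucket (fun c => S (c * d)) t lo hi v (2 * c) l).hi x) ≤ d := by
  have hmem : ∀ c < t, S (c * d) < E.n := fun c hc =>
    (E.mem_elems.1 (h.pivot_mem hd hc)).1
  have hdiv : 2 * c / 2 = c := by omega
  have h1 : c * d ≤ (c + 1) * d := Nat.mul_le_mul_right _ (Nat.le_succ c)
  have h2 : (c + 1) * d ≤ t * d := Nat.mul_le_mul_right _ hc
  rw [← h.2.countP_eq, seg_append S (Nat.zero_le (c * d)) (h1.trans h2), seg_append S h1 h2,
    List.countP_append, List.countP_append]
  have e1 : (seg S 0 (c * d)).countP (fun x =>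
      E.Between (cellBucket (fun c => S (c * d)) t lo hi v (2 * c) l).lo
        (cellBucket (fun c => S (c * d)) t lo hi v (2 * c) l).hi x) = 0 := by
    rw [List.countP_eq_zero]
    intro x hx hb
    obtain ⟨i, -, hi', rfl⟩ := mem_seg.1 hx
    have hb' := (of_decide_eq_true hb).1
    have hc0 : 0 < c := Nat.pos_of_ne_zero fun h0 => by simp [h0] at hi'
    simp only [cellBucket, hdiv] at hb'
    rw [if_neg (by omega)] at hb'
    exact absurd (hb'.resolve_left (by have := hmem c hc; omega))
      (not_lt.2 (h.mono hi'.le (lt_of_lt_of_le (by rw [add_mul]; omega) h2)))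
  have e3 : (seg S ((c + 1) * d) (t * d)).countP (fun x =>
      E.Between (cellBucket (fun c => S (c * d)) t lo hi v (2 * c) l).lo
        (cellBucket (fun c => S (c * d)) t lo hi v (2 * c) l).hi x) = 0 := by
    rw [List.countP_eq_zero]
    intro x hx hb
    obtain ⟨i, hi1, hi2, rfl⟩ := mem_seg.1 hx
    have hb' := (of_decide_eq_true hb).2
    have hct : c + 1 < t := by
      by_contra hcon
      obtain rfl : t = c + 1 := by omega
      omega
    simp only [cellBucket, hdiv] at hb'
    rw [if_pos hct] at hb'
    exact absurd (hb'.resolve_left (by have := hmem _ hct; omega)) (not_lt.2 (h.mono hi1 hi2))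
  have e2 := List.countP_le_length (p := (fun x =>
      decide (E.Between (cellBucket (fun c => S (c * d)) t lo hi v (2 * c) l).lo
        (cellBucket (fun c => S (c * d)) t lo hi v (2 * c) l).hi x)))
        (l := seg S (c * d) ((c + 1) * d))
  rw [length_seg, show (c + 1) * d - c * d = d by rw [add_mul]; omega] at e2
  omega

open Classical in
/-- The rank of a key in the sample determines its cell. -/
theorem Env.pivot_lt_iff {c x : ℕ} (hc : c < t) :
    E.key (S (c * d)) < E.key x ↔
      c * d < ((E.elems lo hi).take (t * d)).countP (fun y => E.key y < E.key x) := by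
  have h2 : c * d < t * d := Nat.mul_lt_mul_of_pos_right hc hd
  rw [← h.2.countP_eq]
  constructor
  · intro hlt
    rw [seg_append S (Nat.zero_le (c * d + 1)) h2, List.countP_append]
    have : (seg S 0 (c * d + 1)).countP (fun y => E.key y < E.key x) = c * d + 1 := by
      rw [List.countP_eq_length.2, length_seg]
      · omega
      · intro y hy
        obtain ⟨i, -, hi', rfl⟩ := mem_seg.1 hy
        exact decide_eq_true ((h.mono (Nat.lt_succ_iff.1 hi') h2).trans_lt hlt)
    omega
  · intro hlt
    by_contra hcon
    rw [seg_append S (Nat.zero_le (c * d)) h2.le, List.countP_append] at hlt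
    have h3 : (seg S (c * d) (t * d)).countP (fun y => E.key y < E.key x) = 0 := by
      rw [List.countP_eq_zero]
      intro y hy hy'
      obtain ⟨i, hi1, hi2, rfl⟩ := mem_seg.1 hy
      exact hcon ((h.mono hi1 hi2).trans_lt (of_decide_eq_true hy'))
    have h4 := List.countP_le_length (p := fun y => decide (E.key y < E.key x))
      (l := seg S 0 (c * d))
    rw [length_seg] at h4
    omega

-- The slot `o` and the rank `r` in the sample satisfy `o * d < r ≤ (o + 1) * d`, except at the two
-- ends. An estimate within `w * d` of `r`, divided by `d`, is therefore within `w + 1` of `o`.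
open Classical in
theorem Env.walk_le (ht : 1 ≤ t) {md : Model} {x w : ℕ}
    (h1 : E.est md x ≤ ((E.elems lo hi).take (t * d)).countP (fun y => E.key y < E.key x) + w * d)
    (h2 : ((E.elems lo hi).take (t * d)).countP (fun y => E.key y < E.key x) ≤ E.est md x + w * d) :
    E.walk md (fun c => S (c * d)) d t x ≤ w + 1 := by
  set pv : ℕ → ℕ := fun c => S (c * d) with hpv
  set r := ((E.elems lo hi).take (t * d)).countP (fun y => E.key y < E.key x) with hr
  have hsl := E.slot_le (pv := pv) (t := t) (x := x)
  have hspec := E.slot_spec (pv := pv) (t := t) (x := x)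
  have hnot := E.not_lt_of_slot_lt (pv := pv) (t := t) (x := x) (c := E.slot pv t x + 1) (by omega)
  set o := E.slot pv t x with ho
  -- Slot 0 has no lower pivot and the last slot no upper one. Neither bound is needed there: the
  -- guess is never below 0, and it is cut off at `t - 1`.
  have ho1 : 0 < o → o * d < r := fun h0 =>
    (Env.pivot_lt_iff h hd (by omega)).1 (hspec.resolve_left (by omega))
  have ho2 : o + 1 < t → r ≤ (o + 1) * d := fun h0 => by
    by_contra hcon
    exact hnot h0 ((Env.pivot_lt_iff h hd h0).2 (not_le.1 hcon))
  have hmod := Nat.div_add_mod' (E.est md x) d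
  have hmod' := Nat.mod_lt (E.est md x) (show 0 < d by omega)
  set q := E.est md x / d with hq
  unfold Env.walk
  rw [← ho, ← hq]
  clear_value o q r
  rcases le_total o (min q (t - 1)) with hle | hle
  · rw [Nat.sub_eq_zero_of_le hle, zero_add]
    by_contra hcon
    have hmin : min q (t - 1) ≤ q := min_le_left _ _
    have h3 := ho2 (by omega)
    have h4 : (o + 1 + w + 1) * d ≤ q * d := Nat.mul_le_mul_right _ (by omega)
    rw [add_mul, add_mul, one_mul] at h4
    omega
  · rw [Nat.sub_eq_zero_of_le hle, add_zero]
    by_contra hcon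
    have hmin : min q (t - 1) = q := min_eq_left (by
      by_contra hq'
      rw [min_eq_right (by omega)] at hcon hle
      omega)
    rw [hmin] at hcon
    have h0 : q + w + 1 < o := by
      exact Nat.lt_of_not_le fun h => hcon (by omega)
    have h3 := ho1 (by omega)
    have h4 : (q + 1 + w) * d ≤ o * d := Nat.mul_le_mul_right _ (by omega)
    rw [add_mul, add_mul] at h4
    omega

end buckets

/-- Serves for the sample entries themselves, about which the model promises nothing; there are few
of them. -/
theorem Env.walk_le_cells {md : Model} {pv : ℕ → ℕ} {x : ℕ} : E.walk md pv d t x ≤ t := by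
  have hsl := E.slot_le (pv := pv) (t := t) (x := x)
  unfold Env.walk
  generalize E.est md x / d = q
  omega

section order
variable {pv : ℕ → ℕ} (hm : E.PivotsMono pv t)

theorem Env.slot_mono {x x' : ℕ} (h : E.key x ≤ E.key x') : E.slot pv t x ≤ E.slot pv t x' := by
  have hsl := E.slot_le (pv := pv) (t := t) (x := x)
  by_contra hcon
  rcases E.slot_spec (pv := pv) (t := t) (x := x) with h5 | h5
  · omega
  · exact E.not_lt_of_slot_lt (not_le.1 hcon) (by omega) (h5.trans_le h)

/-- Slots are monotone in the key. Within one slot, the odd cell contains keys that reach the next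
pivot and the even cell keys that do not. -/
theorem Env.key_le_of_cellNo_lt {x x' : ℕ} (h : E.cellNo pv t x < E.cellNo pv t x') :
    E.key x ≤ E.key x' := by
  by_contra hcon
  push Not at hcon
  have h1 := E.slot_mono (pv := pv) (t := t) hcon.le
  have h2 := E.not_lt_of_slot_lt (pv := pv) (t := t) (x := x) (c := E.slot pv t x + 1) (by omega)
  unfold Env.cellNo at h
  split_ifs at h with h3 h4 h4
  · omega
  · omega
  · obtain h5 : E.slot pv t x = E.slot pv t x' := by omega
    rw [← h5] at h4
    exact h2 h4.1 ((not_lt.1 h4.2).trans_lt hcon)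
  · omega

/-- Keys of an odd cell are neither below nor above its pivot. So odd cells need no further sorting,
however many equal keys there are. -/
theorem Env.key_eq_of_cellNo_odd {x x' c : ℕ} (h : E.cellNo pv t x = 2 * c + 1)
    (h' : E.cellNo pv t x' = 2 * c + 1) : E.key x = E.key x' := by
  have key : ∀ y, E.cellNo pv t y = 2 * c + 1 → E.key y = E.key (pv (c + 1)) := by
    intro y hy
    have h2 := E.not_lt_of_slot_lt (pv := pv) (t := t) (x := y) (c := E.slot pv t y + 1) (by omega)
    unfold Env.cellNo at hy
    split_ifs at hy with h3
    · obtain h5 : E.slot pv t y = c := by omega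
      rw [h5] at h2 h3
      exact le_antisymm (not_lt.1 (h2 h3.1)) (not_lt.1 h3.2)
    · omega
  rw [key x h, key x' h']

end order

/-! ### Sorted lists of keys. -/

/-- The keys of a list of indices in order. -/
noncomputable def Env.sorted (E : Env) (l : List ℕ) : List ℝ :=
  (l.map E.key).mergeSort fun a b => decide (a ≤ b)

theorem Env.sorted_perm (E : Env) (l : List ℕ) : (E.sorted l).Perm (l.map E.key) :=
  List.mergeSort_perm _ _

theorem Env.sorted_pairwise (E : Env) (l : List ℕ) : (E.sorted l).Pairwise (· ≤ ·) := by
  refine (List.pairwise_mergeSort (le := fun a b : ℝ => decide (a ≤ b)) ?_ ?_ _).imp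
    fun h => of_decide_eq_true h
  · intro a b c h1 h2
    simp only [decide_eq_true_eq] at *
    exact h1.trans h2
  · intro a b
    simpa using le_total a b

/-- For keys, as opposed to indices, the ordered rearrangement is unique; this allows the output to
be specified by equations. -/
theorem Env.eq_sorted {l : List ℕ} {L : List ℝ} (h : L.Pairwise (· ≤ ·))
    (h' : L.Perm (l.map E.key)) : L = E.sorted l :=
  (h'.trans (E.sorted_perm l).symm).eq_of_pairwise (fun _ _ _ _ h1 h2 => le_antisymm h1 h2) h
    (E.sorted_pairwise l)

theorem sum_map_range (f : ℕ → ℕ) (n : ℕ) :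
    ((List.range n).map f).sum = ∑ c ∈ Finset.range n, f c := by
  induction n with
  | zero => simp
  | succ n ih => rw [List.sum_range_succ, ih, Finset.sum_range_succ]

theorem perm_flatMap_filter (l : List ℕ) (g : ℕ → ℕ) (n : ℕ) (h : ∀ x ∈ l, g x < n) :
    ((List.range n).flatMap fun c => l.filter fun x => g x = c).Perm l := by
  rw [List.perm_iff_count]
  intro a
  rw [List.count_flatMap]
  have h1 : (List.count a ∘ fun c => l.filter fun x => g x = c) =
      fun c => if c = g a then l.count a else 0 := by
    funext c
    by_cases hc : g a = c
    · simp only [Function.comp, hc, if_true]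
      rw [List.count_filter (by simpa using hc)]
    · simp only [Function.comp]
      rw [if_neg (Ne.symm hc), List.count_eq_zero]
      intro hmem
      have := List.of_mem_filter hmem
      simp at this
      exact hc this
  rw [h1, sum_map_range]
  by_cases ha : a ∈ l
  · rw [Finset.sum_ite_eq', if_pos (Finset.mem_range.2 (h a ha))]
  · rw [List.count_eq_zero_of_not_mem ha]
    simp

/-! ### The main loop -/

/-- The correctness of splitting: it suffices to sort the cells one by one and concatenate. -/
theorem Env.sorted_flatMap {E : Env} {els : List ℕ} {g : ℕ → ℕ} {n : ℕ} (h : ∀ x ∈ els, g x < n)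
    (hg : ∀ x ∈ els, ∀ y ∈ els, g x < g y → E.key x ≤ E.key y) :
    (List.range n).flatMap (fun c => E.sorted (els.filter fun x => g x = c)) = E.sorted els := by
  refine E.eq_sorted ?_ ?_
  · rw [List.pairwise_flatMap]
    refine ⟨fun c _ => E.sorted_pairwise _, ?_⟩
    refine (List.pairwise_lt_range (n := n)).imp ?_
    intro c c' hc a ha b hb
    obtain ⟨x, hx, rfl⟩ := List.mem_map.1 ((E.sorted_perm _).subset ha)
    obtain ⟨y, hy, rfl⟩ := List.mem_map.1 ((E.sorted_perm _).subset hb)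
    simp only [List.mem_filter, decide_eq_true_eq] at hx hy
    exact hg x hx.1 y hy.1 (by omega)
  · refine List.Perm.trans (List.Perm.flatMap_left _ fun c _ => E.sorted_perm _) ?_
    rw [← List.map_flatMap]
    exact (perm_flatMap_filter els g n h).map _

theorem Env.sorted_congr {E : Env} {l l' : List ℕ} (h : l.Perm l') : E.sorted l = E.sorted l' :=
  E.eq_sorted (E.sorted_pairwise l) ((E.sorted_perm l).trans (h.map _))

theorem Env.sorted_of_pairwise {E : Env} {l : List ℕ}
    (h : l.Pairwise fun x y => E.key x ≤ E.key y) : E.sorted l = l.map E.key :=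
  (E.eq_sorted (List.pairwise_map.2 h) (.refl _)).symm

theorem flatMap_cellBuckets {E : Env} (pv : ℕ → ℕ) (t lo hi v : ℕ) (l : ℕ → List ℕ) (c : ℕ) :
    (cellBuckets pv t lo hi v l c).flatMap (fun b => E.sorted b.els) =
      (List.range c).flatMap fun c => E.sorted (l c) := by
  induction c with
  | zero => simp [cellBuckets]
  | succ c ih =>
    rw [cellBuckets_succ, List.flatMap_append, ih, List.range_succ, List.flatMap_append]
    congr 1
    by_cases h : l c = []
    · simp [h, Env.sorted]
    · simp [h, cellBucket]

/-! ### Levels, budgets and the invariant. -/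

/-- The parameter of the level below that of `u`. -/
def next (u : ℕ) : ℕ := root (u ^ 8)

theorem next_lt {u : ℕ} (h : 2 ≤ u) : next u < u := by
  by_contra hcon
  have h1 : u ^ 10 ≤ u ^ 8 := (Nat.pow_le_pow_left (not_lt.1 hcon) 10).trans (root_pow_le _)
  exact absurd h1 (not_le.2 (Nat.pow_lt_pow_right h (by norm_num)))

theorem one_le_next {u : ℕ} (h : 1 ≤ u) : 1 ≤ next u :=
  le_root (by simpa using Nat.one_le_pow _ _ h)

/-- The number of levels from `u` on; the recursion ends below `thr`. -/
def levels (thr u : ℕ) : ℕ :=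
  if h : 2 ≤ u ∧ thr ≤ u then levels thr (next u) + 1 else 0
termination_by u
decreasing_by exact next_lt h.1

/-- The total cost of a recursion tree whose nodes have `u ^ 2` children. -/
def tree (c : ℕ → ℕ) (thr u : ℕ) : ℕ :=
  if h : 2 ≤ u ∧ thr ≤ u then c u + u ^ 2 * tree c thr (next u) else 0
termination_by u
decreasing_by exact next_lt h.1

/-- The parameters of the analysis: threshold `thr`, query time `T`, deviation `w` of the model in
cells, logarithm `ℓ` of the size of small buckets, model size `SS`, training times `TB` and sizes
`Sz` of buckets by level. -/
structure Params where
  thr : ℕ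
  T : ℕ
  w : ℕ
  ℓ : ℕ
  SS : ℕ
  TB : ℕ → ℕ
  Sz : ℕ → ℕ

/-- The cost of a recursion tree. -/
def Params.tree (P : Params) (u : ℕ) : ℕ :=
  LearnedSort.tree (fun u => P.TB u + 20000 * u ^ 10) P.thr u

/-- The time that may be spent on a bucket. -/
def Params.pot (P : Params) (b : Bucket) : ℕ :=
  if b.u = 0 then 200 * b.els.length else
    b.els.length * (1000 * levels P.thr b.u * (P.T + P.w + 1) + 2000 * (P.ℓ + 1)) + P.tree b.u

open Classical in
/-- The facts about models and buckets that the running time depends on. -/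
structure Regime (E : Env) (P : Params) : Prop where
  two_le : 2 ≤ P.thr
  query : ∀ u lo hi, P.thr ≤ u → u ≤ root E.n → E.Valid lo hi → u ^ 5 ≤ (E.elems lo hi).length →
    ∀ x ∈ E.elems lo hi, E.queryTime (E.bucketModel lo hi (E.elems lo hi) (u ^ 5)) x ≤ P.T
  train : ∀ u lo hi, P.thr ≤ u → u ≤ root E.n → E.Valid lo hi → u ^ 5 ≤ (E.elems lo hi).length →
    E.L.trainTime (u ^ 5) (E.bucketModel lo hi (E.elems lo hi) (u ^ 5)).D ≤ P.TB u
  size : ∀ u lo hi, P.thr ≤ u → u ≤ root E.n → E.Valid lo hi → u ^ 5 ≤ (E.elems lo hi).length →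
    E.L.modelSize (u ^ 5) (E.bucketModel lo hi (E.elems lo hi) (u ^ 5)).D ≤ P.SS
  accurate : ∀ u lo hi, P.thr ≤ u → u ≤ root E.n → E.Valid lo hi →
    u ^ 5 ≤ (E.elems lo hi).length → ∀ x ∈ (E.elems lo hi).drop (u ^ 5),
    E.est (E.bucketModel lo hi (E.elems lo hi) (u ^ 5)) x ≤
      ((E.elems lo hi).take (u ^ 5)).countP (fun y => E.key y < E.key x) + P.w * u ^ 3 ∧
    ((E.elems lo hi).take (u ^ 5)).countP (fun y => E.key y < E.key x) ≤
      E.est (E.bucketModel lo hi (E.elems lo hi) (u ^ 5)) x + P.w * u ^ 3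
  top : E.n ≤ P.Sz (root E.n)
  skip : ∀ u, P.thr ≤ u → u ≤ root E.n → u ^ 5 ≤ P.Sz (next u)
  child : ∀ u lo hi lo' hi', P.thr ≤ u → u ≤ root E.n → E.Valid lo hi → E.Valid lo' hi' →
    u ^ 5 ≤ (E.elems lo hi).length → (E.elems lo hi).length ≤ P.Sz u →
    (∀ x < E.n, E.Between lo' hi' x → E.Between lo hi x) →
    ((E.elems lo hi).take (u ^ 5)).countP (fun x => E.Between lo' hi' x) ≤ u ^ 3 →
    (E.elems lo' hi').length ≤ P.Sz (next u)
  leaf : ∀ u, 1 ≤ u → u < P.thr → u ≤ root E.n → Nat.clog 2 (P.Sz u) ≤ P.ℓ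

/-- The buckets that occur. -/
def Bucket.Ok (E : Env) (P : Params) (b : Bucket) : Prop :=
  (b.u = 0 ∧ b.els.Pairwise (fun x y => E.key x ≤ E.key y)) ∨
  (b.u ≠ 0 ∧ b.u ≤ root E.n ∧ b.els = E.elems b.lo b.hi ∧ E.Valid b.lo b.hi ∧
    b.els.length ≤ P.Sz b.u)

/-- The invariant of the main loop: the buckets `bs` are still to be sorted. -/
structure MainInv (E : Env) (P : Params) (bs : List Bucket) (s : AState 24) : Prop where
  n : s.reg rN = E.n
  thr : s.reg rThr = P.thr
  stored : Stored s.arr (s.reg rPos) bs E.n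
  ok : ∀ b ∈ bs, b.Ok E P
  out : s.out ++ bs.flatMap (fun b => E.sorted b.els) = E.sorted (List.range E.n)
  peak : s.peak ≤ P.SS

/-! ### One round of the main loop. -/

def finishCmd : ACmd 24 :=
  .assign rI (.reg rPos) ;; .forUp rI rEnd (.emit (.arr aP (.reg rI))) ;;
    .assign rPos (.reg rEnd)

theorem wp_finishCmd {E : Env} (hE : E.Wide) {P : Params} {b : Bucket} {bs : List Bucket}
    {s : AState 24} (h : MainInv E P (b :: bs) s)
    (hEnd : s.reg rEnd = s.reg rPos + b.els.length) (hu : b.u = 0) :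
    wp E finishCmd (100 * b.els.length) (MainInv E P bs) s := by
  have hw := hE.wide
  have hE' := hE.toRoomy
  obtain ⟨h1, h2, h3, h4, h5, h6⟩ := h.stored
  have hle := h6.le
  have hlen : 0 < b.els.length := List.length_pos_iff.2 h1
  have hsort : E.sorted b.els = b.els.map E.key := by
    refine Env.sorted_of_pairwise ?_
    rcases h.ok b (by simp) with h7 | h7
    · exact h7.2
    · exact absurd hu h7.1
  set p := s.reg rPos with hp
  refine (wp_seq (t := 2) (wp_assign hE' (by decide) (by exact trivial)
    (wp_seq ((wp_forUp_const (x := rI) (y := rEnd) hE' (by decide) (by decide) rfl rfl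
      (fun c s' => s'.out = s.out ++ (seg (s.arr aP) p c).map E.key) 9 (a := p)
      (b := p + b.els.length) ?_ ?_ (by omega) (by omega) ?_ ?_ ?_).mono le_rfl ?_)))).mono
    (t := 2 + ((p + b.els.length - p) * (9 + 8) + 4 + 2)) ?_ fun _ _ h => h
  · simp [AExpr.eval, hp]
  · simp [AExpr.eval, hEnd]
  · simp [seg_self]
  · intro i s' v h'; simpa using h'
  · intro i s' hi hi' hF' hr hJ
    refine (wp_emit hE' (e := .arr aP (.reg rI)) ⟨trivial, ?_⟩ ?_).mono (by decide) fun _ _ h => h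
    · simp only [AExpr.eval, hr]; omega
    · have : s'.arr aP = s.arr aP := by rw [hF'.arr aP rfl]; simp
      simp only [AExpr.eval, hr, AState.out_emit, hJ, this]
      rw [seg_succ _ hi]
      simp
  · rintro s' hF' ⟨hJ, -⟩
    refine (wp_assign hE' (e := .reg rEnd) (by decide) (by exact trivial) ?_).mono (by decide)
      fun _ _ h => h
    have hEnd' : s'.reg rEnd = p + b.els.length := by
      rw [hF'.reg rEnd rfl]; simpa using hEnd
    have harr : ∀ r, s'.arr r = s.arr r := fun r => by
      rw [hF'.arr r rfl]; simp
    refine ⟨?_, ?_, ?_, fun b' hb' => h.ok b' (List.mem_cons_of_mem _ hb'), ?_, ?_⟩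
    · have := hF'.reg rN rfl
      simp only [AState.reg_setReg, Fin.reduceEq, if_false] at this ⊢
      rw [this, h.n]
    · have := hF'.reg rThr rfl
      simp only [AState.reg_setReg, Fin.reduceEq, if_false] at this ⊢
      rw [this, h.thr]
    · simp only [AState.reg_setReg, if_true, AState.arr_setReg, AExpr.eval, hEnd']
      exact h6.congr fun r _ x _ _ => by rw [harr]
    · rw [← h.out, AState.out_setReg, hJ, h5, List.flatMap_cons, hsort, List.append_assoc]
    · rw [AState.peak_setReg, hF'.peak rfl]; exact h.peak
  · rw [Nat.add_sub_cancel_left]; omega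

def leafCmd : ACmd 24 :=
  .assign rF (.reg rEnd) ;; sortCmd ;; copyCmd aS aP ;; .store aU (.reg rPos) (.const 0)

/-- The sorted bucket is copied back in front with parameter 0; a later round of the main loop
outputs it. Its words `lo` and `hi` have no meaning any more. -/
theorem wp_leafCmd {E : Env} (hE : E.Wide) {P : Params} {b : Bucket} {bs : List Bucket}
    {s : AState 24} (h : MainInv E P (b :: bs) s)
    (hEnd : s.reg rEnd = s.reg rPos + b.els.length) :
    wp E leafCmd (300 * (b.els.length * (Nat.clog 2 b.els.length + 1) + 1) +
      30 * b.els.length + 30)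
      (fun s' => ∃ b', b'.u = 0 ∧ b'.els.length = b.els.length ∧ MainInv E P (b' :: bs) s') s := by
  have hw := hE.wide
  have hE' := hE.toRoomy
  obtain ⟨h1, h2, h3, h4, h5, h6⟩ := h.stored
  have hle := h6.le
  have hlen : 0 < b.els.length := List.length_pos_iff.2 h1
  set p := s.reg rPos with hp
  refine (wp_seq (t := 2) (t' := 300 * (b.els.length * (Nat.clog 2 b.els.length + 1) + 1) +
    ((30 * b.els.length + 10) + 9)) (wp_assign hE' (by decide) (by exact trivial) ?_)).mono
      (by omega) fun _ _ h => h
  refine wp_seq ((wp_sortCmd (p := p) (f := p + b.els.length) hE (by simp [hp])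
    (by simp [AExpr.eval, hEnd]) hle (by omega)).mono ?_ ?_)
  · rw [Nat.add_sub_cancel_left]
  rintro s1 hF1 ⟨g1, g2⟩
  have a1 : s1.reg rPos = p := by rw [hF1.reg rPos rfl]; simp [hp]
  have a2 : s1.reg rF = p + b.els.length := by
    rw [hF1.reg rF rfl]; simp [AExpr.eval, hEnd]
  refine wp_seq ((wp_copyCmd hE (r := aS) (r' := aP) (by decide) a1 a2 hle (by omega)).mono ?_ ?_)
  · rw [Nat.add_sub_cancel_left]
  rintro s2 hF2 ⟨g3, g4⟩
  have b1 : s2.reg rPos = p := by rw [hF2.reg rPos rfl, a1]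
  refine (wp_store hE' (i := .reg rPos) (e := .const 0) (by exact trivial) ?_ ?_ ?_).mono
    (by decide) fun _ _ h => h
  · simp only [AExpr.Ok]; omega
  · simp only [AExpr.eval, b1]; omega
  have c1 : seg (s2.arr aP) p (p + b.els.length) = seg (s1.arr aS) p (p + b.els.length) :=
    seg_congr fun x hx hx' => g3 x hx hx'
  have c2 : ∀ r, r ≠ aP → r ≠ aS → r ≠ aQ → s2.arr r = s.arr r := by
    intro r hr hr' hr''
    rw [hF2.arr r (by fin_cases r <;> first | rfl | exact absurd rfl hr),
      hF1.arr r (by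
        fin_cases r <;> first | rfl | exact absurd rfl hr' | exact absurd rfl hr'')]
    simp
  have c3 : (seg (s2.arr aP) p (p + b.els.length)).Perm b.els := by
    rw [c1]; refine g2.trans ?_
    simp only [AState.arr_setReg]; rw [h5]
  have c4 : (seg (s2.arr aP) p (p + b.els.length)).length = b.els.length := c3.length_eq
  have creg : ∀ x, x ≠ rF → sortCmd.writesReg x = false → (copyCmd aS aP).writesReg x = false →
      s2.reg x = s.reg x := by
    intro x hx h1 h2
    rw [hF2.reg x h2, hF1.reg x h1]
    simp [hx]
  refine ⟨⟨b.lo, b.hi, 0, seg (s2.arr aP) p (p + b.els.length)⟩, rfl, c4, ?_, ?_, ?_, ?_, ?_, ?_⟩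
  · simp only [AState.reg_setArr]; rw [creg rN (by decide) rfl rfl, h.n]
  · simp only [AState.reg_setArr]; rw [creg rThr (by decide) rfl rfl, h.thr]
  · simp only [AState.reg_setArr, AExpr.eval, b1]
    refine ⟨fun h0 => by
      have h0' := congrArg List.length h0
      simp only [List.length_nil] at h0'; omega, ?_, ?_, ?_, ?_, ?_⟩
    · simp only [AState.arr_setArr, Fin.reduceEq, if_false, c4]
      rw [c2 aEnd (by decide) (by decide) (by decide), h2]
    · simp
    · simp
    · simp only [AState.arr_setArr, Fin.reduceEq, if_false, c4]
    · simp only [c4]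
      refine h6.congr fun r hr x hx hx' => ?_
      rcases hr with rfl | rfl | rfl | rfl | rfl
      · simp only [AState.arr_setArr, Fin.reduceEq, if_false]
        rw [g4 x (.inr hx), hF1.arr aP rfl]; simp
      · simp only [AState.arr_setArr, Fin.reduceEq, if_false]
        rw [c2 _ (by decide) (by decide) (by decide)]
      · simp only [AState.arr_setArr, Fin.reduceEq, if_false]
        rw [c2 _ (by decide) (by decide) (by decide)]
      · simp only [AState.arr_setArr, Fin.reduceEq, if_false]
        rw [c2 _ (by decide) (by decide) (by decide)]
      · simp only [AState.arr_setArr, if_true]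
        rw [Function.update_of_ne (by omega), c2 _ (by decide) (by decide) (by decide)]
  · intro b' hb'
    rcases List.mem_cons.1 hb' with rfl | hb'
    · left; refine ⟨rfl, ?_⟩; simp only; rw [c1]; exact g1
    · exact h.ok b' (List.mem_cons_of_mem _ hb')
  · have : s2.out = s.out := by rw [hF2.out rfl, hF1.out rfl]; rfl
    rw [← h.out, AState.out_setArr, this]
    simp only [List.flatMap_cons]
    rw [Env.sorted_congr c3]
  · rw [AState.peak_setArr, hF2.peak rfl, hF1.peak rfl]
    exact h.peak

theorem levels_of_le {thr u : ℕ} (h : 2 ≤ u) (h' : thr ≤ u) :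
    levels thr u = levels thr (next u) + 1 := by
  rw [levels, dif_pos ⟨h, h'⟩]

theorem tree_of_le {c : ℕ → ℕ} {thr u : ℕ} (h : 2 ≤ u) (h' : thr ≤ u) :
    tree c thr u = c u + u ^ 2 * tree c thr (next u) := by
  rw [tree, dif_pos ⟨h, h'⟩]

theorem Params.tree_eq (P : Params) {u : ℕ} (h : 2 ≤ u) (h' : P.thr ≤ u) :
    P.tree u = P.TB u + 20000 * u ^ 10 + u ^ 2 * P.tree (next u) := tree_of_le h h'

/-- The time per entry of a bucket. -/
def Params.rate (P : Params) (u : ℕ) : ℕ :=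
  1000 * levels P.thr u * (P.T + P.w + 1) + 2000 * (P.ℓ + 1)

theorem Params.pot_of_ne (P : Params) {b : Bucket} (h : b.u ≠ 0) :
    P.pot b = b.els.length * P.rate b.u + P.tree b.u := if_neg h

theorem Params.pot_of_eq (P : Params) {b : Bucket} (h : b.u = 0) :
    P.pot b = 200 * b.els.length := if_pos h

theorem Params.rate_eq (P : Params) {u : ℕ} (h : 2 ≤ u) (h' : P.thr ≤ u) :
    P.rate u = P.rate (next u) + 1000 * (P.T + P.w + 1) := by
  rw [rate, rate, levels_of_le h h']; ring

/-- Even cells contribute a subtree each, and `(c + 1) / 2` of the first `c` cells are even. For the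
entries of odd cells, 200 operations each are less than the rate. -/
theorem Params.sum_pot_cellBuckets (P : Params) (pv : ℕ → ℕ) (t lo hi v : ℕ) (hv : v ≠ 0)
    (l : ℕ → List ℕ) (c : ℕ) : ((cellBuckets pv t lo hi v l c).map P.pot).sum ≤
      (∑ c ∈ Finset.range c, (l c).length) * P.rate v + ((c + 1) / 2) * P.tree v := by
  induction c with
  | zero => simp [cellBuckets]
  | succ c ih =>
    have h1 : ((if l c = [] then [] else [cellBucket pv t lo hi v c (l c)]).map P.pot).sum ≤
        (l c).length * P.rate v + (if 2 * (c / 2) < c then 0 else P.tree v) := by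
      by_cases hl : l c = []
      · simp [hl]
      · rw [if_neg hl, List.map_singleton, List.sum_singleton]
        by_cases hc : 2 * (c / 2) < c
        · rw [P.pot_of_eq (by simp [cellBucket, hc]), if_pos hc, add_zero, mul_comm]
          exact Nat.mul_le_mul_left _ (by unfold rate; omega)
        · have : (cellBucket pv t lo hi v c (l c)).u = v := by simp [cellBucket, hc]
          rw [P.pot_of_ne (by rw [this]; exact hv), this, if_neg hc]
          exact le_rfl
    rw [cellBuckets_succ, List.map_append, List.sum_append, Finset.sum_range_succ, add_mul]
    by_cases hc : 2 * (c / 2) < c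
    · rw [if_pos hc] at h1
      rw [show (c + 1 + 1) / 2 = (c + 1) / 2 by omega]
      omega
    · rw [if_neg hc] at h1
      rw [show (c + 1 + 1) / 2 = (c + 1) / 2 + 1 by omega, add_mul, one_mul]
      omega

theorem mem_cellBuckets {pv : ℕ → ℕ} {t lo hi v : ℕ} {l : ℕ → List ℕ} {c : ℕ} {b : Bucket} :
    b ∈ cellBuckets pv t lo hi v l c ↔
      ∃ i < c, cellBucket pv t lo hi v i (l i) = b ∧ b.els ≠ [] := by
  simp only [cellBuckets, List.mem_filter, List.mem_map, List.mem_range, decide_eq_true_eq]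
  constructor
  · rintro ⟨⟨i, h1, h2⟩, h3⟩; exact ⟨i, h1, h2, h3⟩
  · rintro ⟨i, h1, h2, h3⟩; exact ⟨⟨i, h1, h2⟩, h3⟩

/-- Even cells are intervals that contain at most `u ^ 3` sample entries, which is what the size
bound `Regime.child` asks for; odd cells have constant keys. -/
theorem Regime.cell_ok {E : Env} {P : Params} (R : Regime E P) {u lo hi : ℕ} {S : ℕ → ℕ}
    (hthr : P.thr ≤ u) (hu : u ≤ root E.n) (hV : E.Valid lo hi)
    (hm : u ^ 5 ≤ (E.elems lo hi).length) (hSz : (E.elems lo hi).length ≤ P.Sz u)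
    (h : E.SortedSample (E.elems lo hi) (u ^ 5) S) :
    ∀ b ∈ cellBuckets (fun c => S (c * u ^ 3)) (u ^ 2) lo hi (next u)
      (fun c => (E.elems lo hi).filter fun x =>
        E.cellNo (fun c => S (c * u ^ 3)) (u ^ 2) x = c) (2 * u ^ 2), b.Ok E P := by
  have h2 := R.two_le
  have hu5 : u ^ 5 = u ^ 2 * u ^ 3 := by ring
  have hu3 : 1 ≤ u ^ 3 := Nat.one_le_pow _ _ (by omega)
  have hv : 1 ≤ next u := one_le_next (by omega)
  have hvr : next u ≤ root E.n := (next_lt (by omega)).le.trans hu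
  have hS := h
  rw [hu5] at hS
  intro b hb
  obtain ⟨c, hc, rfl, -⟩ := mem_cellBuckets.1 hb
  rcases Nat.even_or_odd' c with ⟨i, rfl | rfl⟩
  · right
    have hic : i < u ^ 2 := by omega
    have hlen : (E.elems (cellBucket (fun c => S (c * u ^ 3)) (u ^ 2) lo hi (next u) (2 * i) []).lo
      (cellBucket (fun c => S (c * u ^ 3)) (u ^ 2) lo hi (next u) (2 * i) []).hi).length ≤
        P.Sz (next u) := by
      refine R.child u lo hi _ _ hthr hu hV (Env.valid_cell hS hu3 hV hic []) hm hSz ?_ ?_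
      · intro x _ hx
        exact ((Env.cellNo_eq_two_mul hS hu3 hic).2 hx).1
      · have := Env.countP_cell_le (v := next u) hS hu3 hic []
        rwa [← hu5] at this
    have hub : (cellBucket (fun c => S (c * u ^ 3)) (u ^ 2) lo hi (next u) (2 * i)
        ((E.elems lo hi).filter fun x =>
          E.cellNo (fun c => S (c * u ^ 3)) (u ^ 2) x = 2 * i)).u = next u := by
      simp [cellBucket]
    refine ⟨by rw [hub]; omega, by rw [hub]; exact hvr, Env.filter_cell_eq hS hu3 hic _,
      Env.valid_cell hS hu3 hV hic _, ?_⟩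
    rw [hub]
    refine le_trans (le_of_eq ?_) hlen
    exact congrArg List.length (Env.filter_cell_eq hS hu3 hic _)
  · left
    refine ⟨by simp [cellBucket]; omega, ?_⟩
    refine List.Pairwise.imp_of_mem (R := fun _ _ => True) ?_ (List.pairwise_of_forall (by simp))
    intro a b ha hb _
    simp only [cellBucket, List.mem_filter, decide_eq_true_eq] at ha hb
    exact (Env.key_eq_of_cellNo_odd ha.2 hb.2).le

-- The `u ^ 5` sample entries may walk across all `u ^ 2` cells, since `u ^ 7` is well below the `u
-- ^ 10` in the budget of the node; for all other entries the model is accurate.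
open Classical in
theorem Regime.walk_sum_le {E : Env} {P : Params} (R : Regime E P) {u lo hi : ℕ} {S : ℕ → ℕ}
    (hthr : P.thr ≤ u) (hu : u ≤ root E.n) (hV : E.Valid lo hi)
    (hm : u ^ 5 ≤ (E.elems lo hi).length)
    (h : E.SortedSample (E.elems lo hi) (u ^ 5) S) :
    ((E.elems lo hi).map (E.walk (E.bucketModel lo hi (E.elems lo hi) (u ^ 5))
      (fun c => S (c * u ^ 3)) (u ^ 3) (u ^ 2))).sum ≤
      u ^ 5 * u ^ 2 + (E.elems lo hi).length * (P.w + 1) := by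
  have h2 := R.two_le
  have hu5 : u ^ 5 = u ^ 2 * u ^ 3 := by ring
  have hu3 : 1 ≤ u ^ 3 := Nat.one_le_pow _ _ (by omega)
  have hu2 : 1 ≤ u ^ 2 := Nat.one_le_pow _ _ (by omega)
  set f := E.walk (E.bucketModel lo hi (E.elems lo hi) (u ^ 5)) (fun c => S (c * u ^ 3)) (u ^ 3)
    (u ^ 2) with hf
  conv_lhs => rw [← List.take_append_drop (u ^ 5) (E.elems lo hi)]
  rw [List.map_append, List.sum_append]
  refine add_le_add ?_ ?_
  · refine (List.sum_le_card_nsmul _ (u ^ 2) ?_).trans ?_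
    · intro y hy
      obtain ⟨x, -, rfl⟩ := List.mem_map.1 hy
      exact Env.walk_le_cells
    · rw [List.length_map, List.length_take, smul_eq_mul]
      exact Nat.mul_le_mul_right _ (min_le_left _ _)
  · refine (List.sum_le_card_nsmul _ (P.w + 1) ?_).trans ?_
    · intro y hy
      obtain ⟨x, hx, rfl⟩ := List.mem_map.1 hy
      obtain ⟨g1, g2⟩ := R.accurate u lo hi hthr hu hV hm x hx
      rw [hu5] at h g1 g2
      rw [hf, hu5]
      exact Env.walk_le h hu3 hu2 g1 g2
    · rw [List.length_map, List.length_drop, smul_eq_mul]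
      exact Nat.mul_le_mul_right _ (Nat.sub_le _ _)

def refineCmd : ACmd 24 :=
  .assign rB (.mul (AExpr.pow5 (.reg rU)) (.mul (.reg rU) (.mul (.reg rU) (.reg rU)))) ;;
  rootCmd ;; .assign rM (AExpr.pow5 (.reg rU)) ;;
  .ite (.lt (.sub (.reg rEnd) (.reg rPos)) (.reg rM)) (.store aU (.reg rPos) (.reg rV))
    (.assign rLo (.arr aLo (.reg rPos)) ;; .assign rHi (.arr aHi (.reg rPos)) ;; splitCmd)

/-- Crude, but with `m = u ^ 5` it shows that sorting the sample costs `O(u ^ 10)`. -/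
theorem clog_add_one_le {m : ℕ} (h : 4 ≤ m) : Nat.clog 2 m + 1 ≤ m := by
  have : Nat.clog 2 m ≤ m - 1 := by
    refine Nat.clog_le_of_le_pow ?_
    have := Nat.lt_two_pow_self (n := m - 1)
    omega
  omega

/-- The amortization step. The drop of the rate by one level pays the query and the walk of each
entry; the summand `TB u + 20000 * u ^ 10` of the tree pays for training, for sorting the sample,
for its walks and for the root; the remaining `u ^ 2` subtrees go to the even cells. A bucket with
fewer than `u ^ 5` entries cannot provide the sample, so only its parameter is lowered. -/
theorem wp_refineCmd {E : Env} (hE : E.Wide) {P : Params} (R : Regime E P) {b : Bucket}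
    {bs : List Bucket} {s : AState 24} (h : MainInv E P (b :: bs) s)
    (hEnd : s.reg rEnd = s.reg rPos + b.els.length) (hU : s.reg rU = b.u) (hthr : P.thr ≤ b.u) :
    ∃ t, wp E refineCmd t (fun s' => ∃ bs', MainInv E P bs' s' ∧
      (bs'.map P.pot).sum + t + 100 ≤ ((b :: bs).map P.pot).sum) s := by
  have hw := hE.wide
  have hE' := hE.toRoomy
  have hthr2 := R.two_le
  obtain ⟨h1, h2, h3, h4, h5, h6⟩ := h.stored
  have hle := h6.le
  have hlen : 0 < b.els.length := List.length_pos_iff.2 h1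
  obtain ⟨k1, k2, k3, k4, k5⟩ : b.u ≠ 0 ∧ b.u ≤ root E.n ∧ b.els = E.elems b.lo b.hi ∧
      E.Valid b.lo b.hi ∧ b.els.length ≤ P.Sz b.u := by
    rcases h.ok b (by simp) with ⟨h7, -⟩ | h7
    · omega
    · exact h7
  obtain ⟨h8, h9⟩ := h4 k1
  set p := s.reg rPos with hp
  set u := b.u with hu
  have hu2 : 2 ≤ u := by omega
  have hu10 : u ^ 10 ≤ E.n := (Nat.pow_le_pow_left k2 10).trans (root_pow_le _)
  have hpw : ∀ i ≤ 10, u ^ i ≤ u ^ 10 := fun i hi => Nat.pow_le_pow_right (by omega) hi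
  have hu5 := hpw 5 (by norm_num)
  have hu8 := hpw 8 (by norm_num)
  have hu7 := hpw 7 (by norm_num)
  have hu1 : u ≤ u ^ 10 := by simpa using hpw 1 (by norm_num)
  have hu0 : 1024 ≤ u ^ 10 := by simpa using Nat.pow_le_pow_left hu2 10
  have hv : next u < u := next_lt hu2
  have hv1 : 1 ≤ next u := one_le_next (by omega)
  have hPtree := P.tree_eq hu2 hthr
  have hPrate := P.rate_eq hu2 hthr
  have hpotb : P.pot b = b.els.length * P.rate u + P.tree u := P.pot_of_ne k1
  -- Needed if the bucket is not split: it then keeps just one of the `u ^ 2` subtrees.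
  have htv : P.tree (next u) ≤ u ^ 2 * P.tree (next u) :=
    Nat.le_mul_of_pos_left _ (Nat.pos_of_ne_zero (by positivity))
  -- the common prefix
  have pre : ∀ (t : ℕ) (Q : AState 24 → Prop),
      (∀ s', (∀ x, x ≠ rB → x ≠ rV → x ≠ rM → s'.reg x = s.reg x) → s'.reg rV = next u →
        s'.reg rM = u ^ 5 → s'.arr = s.arr → s'.out = s.out → s'.peak = s.peak →
        wp E (.ite (.lt (.sub (.reg rEnd) (.reg rPos)) (.reg rM)) (.store aU (.reg rPos) (.reg rV))
          (.assign rLo (.arr aLo (.reg rPos)) ;; .assign rHi (.arr aHi (.reg rPos)) ;;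
            splitCmd)) t Q s') → wp E refineCmd (t + 60 * (u + 2) + 40) Q s := by
    intro t Q hQ
    refine (wp_seq (t := 20) (t' := 60 * (next u + 2) + (20 + t)) ((wp_assign hE' (by decide)
      (e := .mul (AExpr.pow5 (.reg rU)) (.mul (.reg rU) (.mul (.reg rU) (.reg rU)))) ?_ ?_).mono
      (by decide) fun _ _ h => h)).mono (by omega) fun _ _ h => h
    · have q2 := hpw 2 (by norm_num)
      have q3 := hpw 3 (by norm_num)
      refine ⟨AExpr.ok_pow5 E s _ trivial ?_ ?_, ⟨trivial, ⟨trivial, trivial, ?_⟩, ?_⟩, ?_⟩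
      · simp only [AExpr.eval, hU]; omega
      · simp only [AExpr.eval, hU]; omega
      · simp only [AExpr.eval, hU]; rw [← sq]; omega
      · simp only [AExpr.eval, hU]; rw [show u * (u * u) = u ^ 3 by ring]; omega
      · simp only [AExpr.eval_pow5, AExpr.eval, hU]
        rw [show u ^ 5 * (u * (u * u)) = u ^ 8 by ring]; omega
    have hB : (s.setReg rB ((AExpr.mul (AExpr.pow5 (.reg rU)) (.mul (.reg rU)
        (.mul (.reg rU) (.reg rU)))).eval E s)).reg rB = u ^ 8 := by
      simp only [AState.reg_setReg, if_true, AExpr.eval_pow5, AExpr.eval, hU]; ring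
    set s0 := s.setReg rB ((AExpr.mul (AExpr.pow5 (.reg rU)) (.mul (.reg rU)
        (.mul (.reg rU) (.reg rU)))).eval E s) with hs0
    refine wp_seq ((wp_rootCmd hE (by rw [hB]; omega)).mono (by rw [hB]; exact le_rfl) ?_)
    intro s1 hF1 hV
    rw [hB] at hV
    have hr1 : ∀ x, x ≠ rB → rootCmd.writesReg x = false → s1.reg x = s.reg x := fun x hx hx' => by
      rw [hF1.reg x hx']; simp [hs0, hx]
    have hU1 : s1.reg rU = u := by rw [hr1 rU (by decide) rfl, hU]
    refine wp_seq ((wp_assign hE' (by decide) (e := AExpr.pow5 (.reg rU)) ?_ ?_).mono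
      (by decide) fun _ _ h => h)
    · exact AExpr.ok_pow5 E s1 _ trivial (by simp only [AExpr.eval, hU1]; omega)
        (by simp only [AExpr.eval, hU1]; omega)
    refine hQ _ ?_ ?_ ?_ ?_ ?_ ?_
    · intro x hx hx' hx''
      simp only [AState.reg_setReg, hx'', if_false]
      exact hr1 x hx (by
        fin_cases x <;> first | rfl | exact absurd rfl hx')
    · simpa [next] using hV
    · simp only [AState.reg_setReg, if_true, AExpr.eval_pow5, AExpr.eval, hU1]
    · funext r
      rw [AState.arr_setReg, hF1.arr r rfl]; rfl
    · rw [AState.out_setReg, hF1.out rfl]; rfl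
    · rw [AState.peak_setReg, hF1.peak rfl]; rfl
  by_cases hm : b.els.length < u ^ 5
  · refine ⟨_, pre 20 _ ?_⟩
    intro s1 r1 r2 r3 r4 r5 r6
    have hEnd1 : s1.reg rEnd = p + b.els.length := by
      rw [r1 _ (by decide) (by decide) (by decide), hEnd]
    have hPos1 : s1.reg rPos = p := by rw [r1 _ (by decide) (by decide) (by decide)]
    have hsub : p + b.els.length - p = b.els.length := by omega
    refine (wp_ite (t := 9) hE' (e := .lt (.sub (.reg rEnd) (.reg rPos)) (.reg rM))
      ⟨⟨trivial, trivial, ?_⟩, trivial⟩ ?_ ?_).mono (by decide) fun _ _ h => h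
    · simp only [AExpr.eval, hEnd1, hPos1]; omega
    rotate_left
    · intro hcon
      simp [AExpr.eval, hEnd1, hPos1, r3, hm] at hcon
    intro _
    refine (wp_store hE' (i := .reg rPos) (e := .reg rV) (by exact trivial) (by exact trivial) ?_
      ?_).mono (by decide) fun _ _ h => h
    · simp only [AExpr.eval, hPos1]; omega
    -- The same bucket one level down. Its size bound there is `Regime.skip`, as it has fewer than
    -- `u ^ 5` entries.
    refine ⟨⟨b.lo, b.hi, next u, b.els⟩ :: bs, ⟨?_, ?_, ?_, ?_, ?_, ?_⟩, ?_⟩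
    · rw [AState.reg_setArr, r1 _ (by decide) (by decide) (by decide), h.n]
    · rw [AState.reg_setArr, r1 _ (by decide) (by decide) (by decide), h.thr]
    · simp only [AState.reg_setArr, hPos1, AExpr.eval, r2]
      refine ⟨h1, ?_, ?_, fun _ => ⟨?_, ?_⟩, ?_, h6.congr fun r hr x hx hx' => ?_⟩
      · simp only [AState.arr_setArr, Fin.reduceEq, if_false, r4, h2]
      · simp
      · simp only [AState.arr_setArr, Fin.reduceEq, if_false, r4, h8]
      · simp only [AState.arr_setArr, Fin.reduceEq, if_false, r4, h9]
      · simp only [AState.arr_setArr, Fin.reduceEq, if_false, r4, h5]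
      · simp only [AState.arr_setArr, r4]
        split_ifs with hr'
        · rw [Function.update_of_ne (by omega), hr']
        · rfl
    · intro b' hb'
      rcases List.mem_cons.1 hb' with rfl | hb'
      · exact .inr ⟨by simp only; omega, hv.le.trans k2, k3, k4,
          hm.le.trans (R.skip u hthr k2)⟩
      · exact h.ok b' (List.mem_cons_of_mem _ hb')
    · rw [AState.out_setArr, r5, ← h.out, List.flatMap_cons, List.flatMap_cons]
    · rw [AState.peak_setArr, r6]; exact h.peak
    · rw [List.map_cons, List.sum_cons, List.map_cons, List.sum_cons, hpotb,
        P.pot_of_ne (by simp only; omega)]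
      simp only
      rw [hPtree, hPrate, mul_add b.els.length]
      omega
  · have hm' : u ^ 5 ≤ b.els.length := not_lt.1 hm
    set m := u ^ 5 with hmdef
    set TT := E.L.trainTime m (E.bucketModel b.lo b.hi b.els m).D with hTT
    set W := m * u ^ 2 + b.els.length * (P.w + 1) with hW
    set t0 := TT + (2000 * (m * (Nat.clog 2 m + 1) + 1) + b.els.length * (P.T + 600) + 100 * W)
      with ht0
    refine ⟨_, pre (t0 + 40) _ ?_⟩
    intro s1 r1 r2 r3 r4 r5 r6
    have hreg : ∀ x, x ≠ rB → x ≠ rV → x ≠ rM → s1.reg x = s.reg x := r1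
    have hEnd1 : s1.reg rEnd = p + b.els.length := by
      rw [r1 _ (by decide) (by decide) (by decide), hEnd]
    have hPos1 : s1.reg rPos = p := by rw [r1 _ (by decide) (by decide) (by decide)]
    have hsub : p + b.els.length - p = b.els.length := by omega
    refine (wp_ite (t := t0 + 30) hE' (e := .lt (.sub (.reg rEnd) (.reg rPos)) (.reg rM))
      ⟨⟨trivial, trivial, ?_⟩, trivial⟩ ?_ ?_).mono (show t0 + 30 + ((AExpr.lt
        (.sub (.reg rEnd) (.reg rPos)) (.reg rM) : AExpr 24).cost + 1) ≤ t0 + 40 by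
          have : (AExpr.lt (.sub (.reg rEnd) (.reg rPos)) (.reg rM) : AExpr 24).cost = 5 := rfl
          omega) fun _ _ h => h
    · simp only [AExpr.eval, hEnd1, hPos1]; omega
    · intro hcon
      simp [AExpr.eval, hEnd1, hPos1, r3, hm] at hcon
    intro _
    refine (wp_seq (t := 15) (t' := 15 + t0) ((wp_assign hE' (e := .arr aLo (.reg rPos))
      (by decide) ⟨trivial, ?_⟩ (wp_seq ((wp_assign hE' (e := .arr aHi (.reg rPos)) (by decide)
      ⟨trivial, ?_⟩ ?_).mono (by decide) fun _ _ h => h))).mono (by decide) fun _ _ h => h)).mono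
      (by omega) fun _ _ h => h
    · simp only [AExpr.eval, hPos1]; omega
    · simp [AExpr.eval, hPos1]; omega
    have hLo : s1.arr aLo p = b.lo := by rw [r4, h8]
    have hHi : s1.arr aHi p = b.hi := by rw [r4, h9]
    refine (wp_splitCmd hE (p := p) (e := p + b.els.length) (u := u) (v := next u) (lo := b.lo)
      (hi := b.hi) (els := b.els) ?_ ?_ ?_ ?_ ?_ ?_ ?_ ?_ hu2 (by omega) hle ?_ ?_ ?_ W P.T ?_
      ?_).mono le_rfl ?_
    · simp only [AState.reg_setReg, Fin.reduceEq, if_false]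
      rw [r1 _ (by decide) (by decide) (by decide), h.n]
    · simpa using hPos1
    · simpa using hEnd1
    · simp only [AState.reg_setReg, Fin.reduceEq, if_false]
      rw [r1 _ (by decide) (by decide) (by decide), hU]
    · simpa using r2
    · simpa using r3
    · simp [AExpr.eval, hPos1, hLo]
    · simp [AExpr.eval, hPos1, hHi]
    · simp only [AState.arr_setReg, r4, h5]
    · rw [k3]; exact Env.elems_nodup
    · intro x hx
      rw [k3] at hx
      exact (E.mem_elems.1 hx).1
    · intro S hS
      rw [k3] at hS hm' ⊢
      rw [hW, k3]
      exact R.walk_sum_le hthr k2 k4 hm' hS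
    · rw [k3] at hm' ⊢
      exact R.query u _ _ hthr k2 k4 hm'
    rintro s2 hF2 ⟨S, hS, g1, g2, g3⟩
    have hreg2 : ∀ x, splitCmd.writesReg x = false → x ≠ rLo → x ≠ rHi → x ≠ rB → x ≠ rV →
        x ≠ rM → s2.reg x = s.reg x := by
      intro x hx h1 h2 h3 h4 h5
      rw [hF2.reg x hx]
      simp only [AState.reg_setReg, h1, h2, if_false]
      exact r1 x h3 h4 h5
    have hPos2 : s2.reg rPos = p := hreg2 _ rfl (by decide) (by decide) (by decide) (by decide)
      (by decide)
    refine ⟨cellBuckets (fun c => S (c * u ^ 3)) (u ^ 2) b.lo b.hi (next u)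
      (fun c => b.els.filter fun x => E.cellNo (fun c => S (c * u ^ 3)) (u ^ 2) x = c)
      (2 * u ^ 2) ++ bs, ⟨?_, ?_, ?_, ?_, ?_, ?_⟩, ?_⟩
    rotate_left 2
    · rw [hPos2]
      refine g1.append (h6.congr fun r hr x hx hx' => ?_)
      rw [g2 r hr x (.inr hx), AState.arr_setReg, AState.arr_setReg, r4]
    · intro b' hb'
      rcases List.mem_append.1 hb' with hb' | hb'
      · rw [k3] at hS hb' hm' k5
        exact R.cell_ok hthr k2 k4 hm' k5 hS b' hb'
      · exact h.ok b' (List.mem_cons_of_mem _ hb')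
    · rw [hF2.out rfl, AState.out_setReg, AState.out_setReg, r5, ← h.out, List.flatMap_append,
        flatMap_cellBuckets, List.flatMap_cons, Env.sorted_flatMap]
      · intro x _
        exact E.cellNo_lt (Nat.one_le_pow _ _ (by omega))
      · intro x _ y _ hxy
        exact Env.key_le_of_cellNo_lt hxy
    · rw [g3]
      refine max_le ?_ ?_
      · rw [AState.peak_setReg, AState.peak_setReg, r6]; exact h.peak
      · rw [k3] at hm' ⊢
        exact R.size u _ _ hthr k2 k4 hm'
    · rw [List.map_append, List.sum_append, List.map_cons, List.sum_cons, hpotb]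
      have q1 := P.sum_pot_cellBuckets (fun c => S (c * u ^ 3)) (u ^ 2) b.lo b.hi (next u)
        (by omega) (fun c => b.els.filter fun x =>
          E.cellNo (fun c => S (c * u ^ 3)) (u ^ 2) x = c) (2 * u ^ 2)
      rw [sum_length_filter _ _ _ fun x _ => E.cellNo_lt (Nat.one_le_pow _ _ (by omega)),
        show (2 * u ^ 2 + 1) / 2 = u ^ 2 by omega] at q1
      have q2 : TT ≤ P.TB u := by
        rw [hTT]
        rw [k3] at hm' ⊢
        exact R.train u _ _ hthr k2 k4 hm'
      have q3 : m * (Nat.clog 2 m + 1) ≤ u ^ 10 := by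
        have : 4 ≤ m := by
          have : 2 ^ 5 ≤ u ^ 5 := Nat.pow_le_pow_left hu2 5
          omega
        calc m * (Nat.clog 2 m + 1) ≤ m * m := Nat.mul_le_mul_left _ (clog_add_one_le this)
          _ = u ^ 10 := by rw [hmdef]; ring
      have q4 : m * u ^ 2 = u ^ 7 := by rw [hmdef]; ring
      rw [hPtree, hPrate]
      rw [ht0, hW, q4]
      have q5 : b.els.length * (P.rate (next u) + 1000 * (P.T + P.w + 1)) =
        b.els.length * P.rate (next u) + 1000 * (b.els.length * P.T) +
          1000 * (b.els.length * P.w) + 1000 * b.els.length := by ring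
      have q6 : b.els.length * (P.T + 600) = b.els.length * P.T + 600 * b.els.length := by ring
      have q7 : b.els.length * (P.w + 1) = b.els.length * P.w + b.els.length := by ring
      rw [q5, q6, q7]
      omega
    · exact (hreg2 rN rfl (by decide) (by decide) (by decide) (by decide) (by decide)).trans h.n
    · exact (hreg2 rThr rfl (by decide) (by decide) (by decide) (by decide) (by decide)).trans h.thr

def mainBody : ACmd 24 :=
  .assign rEnd (.arr aEnd (.reg rPos)) ;; .assign rU (.arr aU (.reg rPos)) ;;
  .ite (.lt (.const 0) (.reg rU)) (.ite (.lt (.reg rU) (.reg rThr)) leafCmd refineCmd) finishCmd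

/-- The leftmost bucket is output, sorted or refined. The 4 in the bound is the price of the loop
test. -/
theorem wp_mainBody {E : Env} (hE : E.Wide) {P : Params} (R : Regime E P) {b : Bucket}
    {bs : List Bucket} {s : AState 24} (h : MainInv E P (b :: bs) s) :
    ∃ t, wp E mainBody t (fun s' => ∃ bs', MainInv E P bs' s' ∧
      (bs'.map P.pot).sum + t + 4 ≤ ((b :: bs).map P.pot).sum) s := by
  have hw := hE.wide
  have hE' := hE.toRoomy
  obtain ⟨h1, h2, h3, h4, h5, h6⟩ := h.stored
  have hle := h6.le
  have hlen : 0 < b.els.length := List.length_pos_iff.2 h1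
  set p := s.reg rPos with hp
  set s1 := (s.setReg rEnd ((AExpr.arr aEnd (.reg rPos)).eval E s)).setReg rU
    ((AExpr.arr aU (.reg rPos)).eval E
      (s.setReg rEnd ((AExpr.arr aEnd (.reg rPos)).eval E s))) with hs1
  have pre : ∀ (t : ℕ) (Q : AState 24 → Prop),
      wp E (.ite (.lt (.const 0) (.reg rU)) (.ite (.lt (.reg rU) (.reg rThr)) leafCmd refineCmd)
        finishCmd) t Q s1 → wp E mainBody (9 + (9 + t)) Q s := by
    intro t Q hQ
    refine wp_seq ((wp_assign hE' (e := .arr aEnd (.reg rPos)) (by decide) ⟨trivial, ?_⟩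
      (wp_seq ((wp_assign hE' (e := .arr aU (.reg rPos)) (by decide) ⟨trivial, ?_⟩ hQ).mono
        (by decide) fun _ _ h => h))).mono (by decide) fun _ _ h => h)
    · simp only [AExpr.eval, ← hp]; omega
    · simp only [AExpr.eval, AState.reg_setReg, Fin.reduceEq, if_false, ← hp]; omega
  have hPos : s1.reg rPos = p := by simp [hs1, hp]
  have hEnd : s1.reg rEnd = s1.reg rPos + b.els.length := by
    rw [hPos]; simp [hs1, AExpr.eval, ← hp, h2]
  have hU : s1.reg rU = b.u := by simp [hs1, AExpr.eval, ← hp, h3]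
  have hThr : s1.reg rThr = P.thr := by simp [hs1, h.thr]
  have hI : MainInv E P (b :: bs) s1 :=
    ⟨by simp [hs1, h.n], hThr, by rw [hPos]; exact h.stored, h.ok, h.out, h.peak⟩
  clear_value s1
  have c1 : ((AExpr.lt (.const 0) (.reg rU)) : AExpr 24).cost = 3 := rfl
  have c2 : ((AExpr.lt (.reg rU) (.reg rThr)) : AExpr 24).cost = 3 := rfl
  have hok1 : ((AExpr.lt (.const 0) (.reg rU)) : AExpr 24).Ok E s1 :=
    ⟨by simp [AExpr.Ok], trivial⟩
  rcases Nat.eq_zero_or_pos b.u with hu | hu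
  · refine ⟨_, pre _ _ (wp_ite (t := 100 * b.els.length) hE' hok1 ?_ ?_)⟩
    · intro hcon
      simp [AExpr.eval, hU, hu] at hcon
    · intro _
      refine (wp_finishCmd hE hI hEnd hu).mono le_rfl fun s2 _ h2 => ⟨bs, h2, ?_⟩
      rw [List.map_cons, List.sum_cons, P.pot_of_eq hu, c1]
      omega
  · have hpot := P.pot_of_ne (b := b) (by omega)
    by_cases hthr : b.u < P.thr
    · refine ⟨_, pre _ _ (wp_ite (t := 300 * (b.els.length * (Nat.clog 2 b.els.length + 1) + 1) +
        30 * b.els.length + 30 + 4) hE' hok1 ?_ ?_)⟩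
      swap
      · intro hcon
        simp [AExpr.eval, hU, hu] at hcon
      intro _
      refine (wp_ite hE' ⟨trivial, trivial⟩ ?_ ?_)
      swap
      · intro hcon
        simp [AExpr.eval, hU, hThr, hthr] at hcon
      intro _
      refine (wp_leafCmd hE hI hEnd).mono le_rfl ?_
      rintro s2 - ⟨b', g1, g2, g3⟩
      refine ⟨b' :: bs, g3, ?_⟩
      rw [List.map_cons, List.sum_cons, List.map_cons, List.sum_cons, P.pot_of_eq g1, hpot, c1, g2]
      obtain ⟨k1, k2⟩ : b.u ≤ root E.n ∧ b.els.length ≤ P.Sz b.u := by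
        rcases h.ok b (by simp) with h7 | h7
        · omega
        · exact ⟨h7.2.1, h7.2.2.2.2⟩
      have q1 : Nat.clog 2 b.els.length ≤ P.ℓ :=
        (Nat.clog_mono_right 2 k2).trans (R.leaf _ hu hthr k1)
      have q2 : b.els.length * (Nat.clog 2 b.els.length + 1) ≤ b.els.length * (P.ℓ + 1) :=
        Nat.mul_le_mul_left _ (by omega)
      have q3 : b.els.length * (2000 * (P.ℓ + 1)) ≤ b.els.length * P.rate b.u :=
        Nat.mul_le_mul_left _ (by unfold Params.rate; omega)
      have q4 : b.els.length * (2000 * (P.ℓ + 1)) = 2000 * (b.els.length * (P.ℓ + 1)) := by ring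
      have q5 : b.els.length ≤ b.els.length * (P.ℓ + 1) := Nat.le_mul_of_pos_right _ (by omega)
      omega
    · obtain ⟨t, ht⟩ := wp_refineCmd hE R hI hEnd hU (not_lt.1 hthr)
      refine ⟨_, pre _ _ (wp_ite (t := t + 4) hE' hok1 ?_ ?_)⟩
      swap
      · intro hcon
        simp [AExpr.eval, hU, hu] at hcon
      intro _
      refine (wp_ite hE' ⟨trivial, trivial⟩ ?_ ?_)
      · intro hcon
        simp [AExpr.eval, hU, hThr, hthr] at hcon
      intro _
      refine ht.mono le_rfl ?_
      rintro s2 - ⟨bs', g1, g2⟩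
      refine ⟨bs', g1, ?_⟩
      rw [c1]; omega

/-- The recursion needs no stack: the unfinished buckets lie side by side from `rPos` on, and
children replace their parent in order, so that taking the leftmost bucket is a depth-first
traversal. -/
def mainLoop : ACmd 24 := .while (.lt (.reg rPos) (.reg rN)) mainBody

theorem wp_mainLoop {E : Env} (hE : E.Wide) {P : Params} (R : Regime E P) {bs : List Bucket}
    {s : AState 24} (h : MainInv E P bs s) :
    wp E mainLoop ((bs.map P.pot).sum + 4)
      (fun s' => s'.out = E.sorted (List.range E.n) ∧ s'.peak ≤ P.SS) s := by
  have hE' := hE.toRoomy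
  have c1 : ((AExpr.lt (.reg rPos) (.reg rN)) : AExpr 24).cost = 3 := rfl
  refine wp_while hE' (fun t s => ∃ bs, MainInv E P bs s ∧ (bs.map P.pot).sum + 4 ≤ t)
    ⟨bs, h, le_rfl⟩ (fun _ _ _ _ => ⟨trivial, trivial⟩) ?_ ?_
  · rintro t s - ⟨bs, hI, ht⟩ hc
    cases bs with
    | nil =>
      have : s.reg rPos = E.n := hI.stored
      simp [AExpr.eval, hI.n, this] at hc
    | cons b bs =>
      obtain ⟨t', ht'⟩ := wp_mainBody hE R hI
      refine ⟨t', ht'.mono le_rfl ?_⟩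
      rintro s' - ⟨bs', g1, g2⟩
      exact ⟨(bs'.map P.pot).sum + 4, by rw [c1]; omega, bs', g1, le_rfl⟩
  · rintro t s - ⟨bs, hI, ht⟩ hc
    cases bs with
    | nil =>
      refine ⟨by rw [c1]; omega, ?_, hI.peak⟩
      simpa using hI.out
    | cons b bs =>
      obtain ⟨h1, -, -, -, -, h6⟩ := hI.stored
      have hlen : 0 < b.els.length := List.length_pos_iff.2 h1
      have := h6.le
      simp [AExpr.eval, hI.n] at hc
      omega

/-! ### Initialization and the whole program. -/

def clogCmd : ACmd 24 :=
  .assign rI (.const 0) ;; .assign rJ (.const 1) ;;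
  .while (.lt (.reg rJ) (.reg rN))
    (.assign rJ (.add (.reg rJ) (.reg rJ)) ;; .assign rI (.add (.reg rI) (.const 1)))

theorem wp_clogCmd {E : Env} (hE : E.Wide) {s : AState 24} (hN : s.reg rN = E.n) :
    wp E clogCmd (20 * E.n + 10) (fun s' => s'.reg rI = Nat.clog 2 E.n) s := by
  have hw := hE.wide
  have hE' := hE.toRoomy
  have hn : Nat.clog 2 E.n ≤ E.n := by
    rcases Nat.lt_or_ge E.n 4 with h | h
    · interval_cases E.n <;> decide
    · have := clog_add_one_le h; omega
  refine (wp_seq (t := 2) (wp_assign hE' (e := .const 0) (by decide) (by simp [AExpr.Ok])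
    (wp_seq (t := 2) (wp_assign hE' (e := .const 1) (by decide) (by simp only [AExpr.Ok]; omega)
    (wp_while (b₀ := 20 * Nat.clog 2 E.n + 4) hE' (fun t s' => ∃ i, s'.reg rI = i ∧
      s'.reg rJ = 2 ^ i ∧ i ≤ Nat.clog 2 E.n ∧ 20 * (Nat.clog 2 E.n - i) + 4 ≤ t)
      ?_ ?_ ?_ ?_))))).mono (by omega) fun _ _ h => h
  · exact ⟨0, by simp [AExpr.eval], by simp [AExpr.eval], Nat.zero_le _, by omega⟩
  · intros; exact ⟨trivial, trivial⟩
  · rintro t s' hF ⟨i, h1, h2, h3, h4⟩ hc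
    have hN' : s'.reg rN = E.n := by
      rw [hF.reg rN rfl]; simpa using hN
    simp only [AExpr.eval, hN', h2] at hc
    have hlt : 2 ^ i < E.n := by
      by_contra hcon
      simp [hcon] at hc
    have hlt' : i < Nat.clog 2 E.n := (Nat.lt_clog_iff_pow_lt (by norm_num)).2 hlt
    refine ⟨8, (wp_of_vc hE' _ ?_)⟩
    simp only [ACmd.vc, AExpr.Ok, AExpr.eval, AState.reg_setReg, h1, h2, Fin.reduceEq, if_false]
    refine ⟨by decide, ⟨trivial, trivial, by omega⟩, by decide, ⟨trivial, by omega, by omega⟩,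
      20 * (Nat.clog 2 E.n - (i + 1)) + 4, ?_, i + 1, by simp, ?_, hlt', le_rfl⟩
    · refine le_trans ?_ h4
      have : ((AExpr.lt (.reg rJ) (.reg rN)) : AExpr 24).cost = 3 := rfl
      omega
    · simp only [if_true, pow_succ]
      omega
  · rintro t s' hF ⟨i, h1, h2, h3, h4⟩ hc
    have hN' : s'.reg rN = E.n := by
      rw [hF.reg rN rfl]; simpa using hN
    simp only [AExpr.eval, hN', h2] at hc
    have hge : E.n ≤ 2 ^ i := by
      by_contra hcon
      simp [not_le.1 hcon] at hc
    have : ((AExpr.lt (.reg rJ) (.reg rN)) : AExpr 24).cost = 3 := rfl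
    refine ⟨by omega, h1.trans (le_antisymm h3 (Nat.clog_le_of_le_pow hge))⟩

def rootBucketCmd : ACmd 24 :=
  .store aEnd (.const 0) (.reg rN) ;; .store aLo (.const 0) (.reg rN) ;;
  .store aHi (.const 0) (.add (.reg rN) (.const 1)) ;; .store aU (.const 0) (.reg rV) ;;
  .assign rPos (.const 0) ;; .assign rI (.const 0)

def initCmd : ACmd 24 :=
  clogCmd ;;
  .assign rThr (.mul (.add (.reg rI) (.const 2)) (.add (.reg rI) (.const 2))) ;;
  .assign rB (.reg rN) ;; rootCmd ;;
  rootBucketCmd ;; .forUp rI rN (.store aP (.reg rI) (.reg rI))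

/-- The threshold below which buckets are sorted by merge sort. -/
def threshold (n : ℕ) : ℕ := (Nat.clog 2 n + 2) ^ 2

/-- The square of a logarithm is at most linear; so the threshold fits into a word. -/
theorem threshold_lt (n : ℕ) : threshold n < 2 ^ 20 * (n + 1) := by
  have h : ∀ L, (L + 2) ^ 2 ≤ 8 * 2 ^ L := by
    intro L
    induction L using Nat.twoStepInduction with
    | zero => norm_num
    | one => norm_num
    | more L h1 h2 =>
      have h3 : 2 ^ (L + 2) = 2 * 2 ^ (L + 1) := by ring
      have h4 : 2 ^ (L + 1) = 2 * 2 ^ L := by ring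
      have h5 : 1 ≤ 2 ^ L := Nat.one_le_two_pow
      nlinarith
  rcases Nat.lt_or_ge n 2 with h2 | h2
  · interval_cases n <;> simp [threshold]
  · have h1 : 2 ^ (Nat.clog 2 n - 1) < n := Nat.pow_pred_clog_lt_self (by norm_num) h2
    have h3 : 0 < Nat.clog 2 n := Nat.clog_pos (by norm_num) h2
    have h4 : 2 ^ Nat.clog 2 n = 2 * 2 ^ (Nat.clog 2 n - 1) := by
      rw [← pow_succ', Nat.sub_add_cancel h3]
    have := h (Nat.clog 2 n)
    unfold threshold
    omega

theorem root_le_self (n : ℕ) : root n ≤ n := Nat.findGreatest_le n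

/-- The array becomes a single bucket without bounds, encoded by the words `n` and `n + 1`. For `n =
0` there is none, since buckets are nonempty. -/
theorem wp_initCmd {E : Env} (hE : E.Wide) {P : Params} (R : Regime E P)
    (hthr : P.thr = threshold E.n) {s : AState 24} (hN : s.reg rN = E.n) (hout : s.out = [])
    (hpeak : s.peak = 0) :
    wp E initCmd (500 * (E.n + 1)) (MainInv E P
      (if E.n = 0 then [] else [⟨E.n, E.n + 1, root E.n, List.range E.n⟩])) s := by
  have hw := hE.wide
  have hE' := hE.toRoomy
  have ht := threshold_lt E.n
  have hrt := root_le_self E.n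
  refine (wp_seq (t := 20 * E.n + 10) (t' := 10 + (2 + (60 * (root E.n + 2) + (100 +
    (E.n * (9 + 8) + 4))))) ((wp_clogCmd hE hN).mono le_rfl ?_)).mono (by omega) fun _ _ h => h
  intro s1 hF1 h1
  have hN1 : s1.reg rN = E.n := by rw [hF1.reg rN rfl, hN]
  refine wp_seq ((wp_assign hE' (by decide)
    (e := .mul (.add (.reg rI) (.const 2)) (.add (.reg rI) (.const 2))) ?_ ?_).mono (by decide)
      fun _ _ h => h)
  · rw [threshold, sq] at ht
    simp only [AExpr.Ok, AExpr.eval, h1, true_and]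
    have : Nat.clog 2 E.n + 2 ≤ (Nat.clog 2 E.n + 2) * (Nat.clog 2 E.n + 2) :=
      Nat.le_mul_of_pos_left _ (by omega)
    refine ⟨⟨by omega, by omega⟩, ⟨by omega, by omega⟩, by omega⟩
  refine wp_seq (wp_assign hE' (e := .reg rN) (by decide) (by exact trivial) ?_)
  set s2 := (s1.setReg rThr _).setReg rB _ with hs2
  have hB2 : s2.reg rB = E.n := by simp [hs2, AExpr.eval, hN1]
  have hT2 : s2.reg rThr = P.thr := by
    simp only [hs2, AExpr.eval, h1, AState.reg_setReg, Fin.reduceEq, if_false, if_true, hthr,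
      threshold]
    ring
  have hN2 : s2.reg rN = E.n := by simp [hs2, hN1]
  have hout2 : s2.out = [] := by
    simp only [hs2, AState.out_setReg]; rw [hF1.out rfl, hout]
  have hpeak2 : s2.peak = 0 := by
    simp only [hs2, AState.peak_setReg]; rw [hF1.peak rfl, hpeak]
  clear_value s2
  refine wp_seq ((wp_rootCmd hE (by rw [hB2])).mono (by rw [hB2]) ?_)
  intro s3 hF3 hV3
  rw [hB2] at hV3
  have hN3 : s3.reg rN = E.n := by rw [hF3.reg rN rfl, hN2]
  have hT3 : s3.reg rThr = P.thr := by rw [hF3.reg rThr rfl, hT2]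
  have hout3 : s3.out = [] := by rw [hF3.out rfl, hout2]
  have hpeak3 : s3.peak = 0 := by rw [hF3.peak rfl, hpeak2]
  refine wp_seq ((wp_of_vc hE' rootBucketCmd ?_).mono (by decide) fun _ _ h => h)
  simp only [rootBucketCmd, ACmd.vc, AExpr.Ok, AExpr.eval, AState.reg_setArr, hN3]
  refine ⟨by omega, trivial, by omega, by omega, trivial, by omega, by omega,
    ⟨trivial, by omega, by omega⟩, by omega, by omega, trivial, by omega, by decide, by omega,
    by decide, by omega, ?_⟩
  refine ((wp_forUp_const (x := rI) (y := rN) hE' (by decide) (by decide) rfl rfl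
    (fun c s' => seg (s'.arr aP) 0 c = List.range c) 9 (a := 0) (b := E.n) ?_ ?_ (Nat.zero_le _)
    (by omega) ?_ ?_ ?_).mono ?_ ?_)
  · simp
  · simp [hN3]
  · simp [seg_self]
  · intro i s' v h'; simpa using h'
  · intro i s' _ hi hF' hr hJ
    refine (wp_store hE' (i := .reg rI) (e := .reg rI) (by exact trivial) (by exact trivial) ?_
      ?_).mono (by decide) fun _ _ h => h
    · simp only [AExpr.eval, hr]; omega
    · simp only [AExpr.eval, hr, AState.arr_setArr, if_true]
      rw [seg_update_succ _ _ (Nat.zero_le i), hJ, List.range_succ]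
  · rw [Nat.sub_zero]
  · rintro s4 hF4 ⟨hJ, -⟩
    have q1 : s4.reg rN = E.n := by rw [hF4.reg rN rfl]; simp [hN3]
    have q2 : s4.reg rThr = P.thr := by rw [hF4.reg rThr rfl]; simp [hT3]
    have q3 : s4.reg rPos = 0 := by rw [hF4.reg rPos rfl]; simp
    have q4 : s4.out = [] := by rw [hF4.out rfl]; simpa using hout3
    have q5 : s4.peak = 0 := by rw [hF4.peak rfl]; simpa using hpeak3
    have q6 : s4.arr aEnd 0 = E.n := by
      rw [hF4.arr aEnd rfl]; simp
    have q7 : s4.arr aLo 0 = E.n := by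
      rw [hF4.arr aLo rfl]; simp
    have q8 : s4.arr aHi 0 = E.n + 1 := by
      rw [hF4.arr aHi rfl]; simp
    have q9 : s4.arr aU 0 = root E.n := by
      rw [hF4.arr aU rfl]; simp [hV3]
    by_cases hn : E.n = 0
    · rw [if_pos hn]
      refine ⟨q1, q2, ?_, by simp, ?_, by omega⟩
      · rw [q3]; exact hn.symm
      · rw [q4, hn]; simp [Env.sorted]
    · rw [if_neg hn]
      refine ⟨q1, q2, ?_, ?_, ?_, by omega⟩
      · rw [q3]
        refine ⟨by simpa using hn, ?_, q9, fun _ => ⟨q7, q8⟩, ?_, ?_⟩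
        · rw [q6]; simp
        · simpa using hJ
        · simp [Stored]
      · intro b hb
        rw [List.mem_singleton] at hb
        subst hb
        refine .inr ⟨?_, le_rfl, Env.elems_root.symm, ⟨le_rfl, .inr rfl⟩, ?_⟩
        · have : 1 ≤ root E.n := le_root (by simp; omega)
          simp only; omega
        · simpa using R.top
      · simp [q4]

/-- Sorting with learned models. -/
def sortProgram : ACmd 24 := initCmd ;; mainLoop

theorem exec_sortProgram {E : Env} (hE : E.Wide) {P : Params} (R : Regime E P)
    (hthr : P.thr = threshold E.n) :
    ∃ σ, Exec E sortProgram.toCmd E.init σ ∧ σ.out = E.sorted (List.range E.n) ∧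
      σ.time ≤ E.n * P.rate (root E.n) + P.tree (root E.n) + 500 * (E.n + 1) + 4 ∧
      σ.peak ≤ P.SS := by
  have hw := hE.wide
  have hwp : wp E sortProgram (500 * (E.n + 1) +
      (E.n * P.rate (root E.n) + P.tree (root E.n) + 4))
      (fun s' => s'.out = E.sorted (List.range E.n) ∧ s'.peak ≤ P.SS)
      ⟨fun x => if x = 0 then E.n else 0, fun _ _ => 0, E.init (k := 23).model, [], 0⟩ := by
    refine wp_seq ((wp_initCmd hE R hthr (by simp) rfl rfl).mono le_rfl fun s' _ hI => ?_)
    refine (wp_mainLoop hE R hI).mono (Nat.add_le_add_right ?_ _) fun _ _ h => h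
    split_ifs with hn
    · simp
    · have : 1 ≤ root E.n := le_root (by simp; omega)
      rw [List.map_singleton, List.sum_singleton, P.pot_of_ne (by simp only; omega)]
      simp
  obtain ⟨σ, s, h1, h2, -, ⟨h3, h4⟩, h5⟩ := hwp E.init (by
    refine ⟨?_, by simp, fun _ _ _ => rfl, rfl, rfl, rfl⟩
    funext x
    simp only [Env.init]
    rw [Env.word_eq (by omega)])
  refine ⟨σ, h1, h2.out.trans h3, ?_, h2.peak.trans_le h4⟩
  have : (E.init (k := 23)).time = 0 := rfl
  omega

/-- Each choice of parameters yields a run with its own time bound; determinism makes these the same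
run. -/
theorem Exec.det {k : ℕ} {E : Env} {p : Cmd k} {σ τ τ' : State k} (h : Exec E p σ τ)
    (h' : Exec E p σ τ') : τ = τ' := by
  induction h generalizing τ' with
  | skip => cases h'; rfl
  | assign => cases h'; rfl
  | store => cases h'; rfl
  | train => cases h'; rfl
  | query => cases h'; rfl
  | emit => cases h'; rfl
  | seq _ _ ih1 ih2 =>
    cases h' with
    | seq g1 g2 => obtain rfl := ih1 g1; exact ih2 g2
  | ite_true h0 _ ih =>
    cases h' with
    | ite_true g0 g => exact ih g
    | ite_false g0 g => exact absurd g0 h0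
  | ite_false h0 _ ih =>
    cases h' with
    | ite_true g0 g => exact absurd h0 g0
    | ite_false g0 g => exact ih g
  | while_true h0 _ _ ih1 ih2 =>
    cases h' with
    | while_true g0 g1 g2 => obtain rfl := ih1 g1; exact ih2 g2
    | while_false g0 => exact absurd g0 h0
  | while_false h0 =>
    cases h' with
    | while_true g0 g1 g2 => exact absurd h0 g0
    | while_false g0 => rfl

/-! ### The first hits of a set in a random sequence -/

/-- The first `m` entries of a list as a vector. -/
def listVec (l : List ℝ) (m : ℕ) : Fin m → ℝ := fun j => l.getD j 0

section hits
variable {δ : Type*}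

open Classical in
/-- The values in `I`, in the order of the list `l` of indices. -/
noncomputable def hitVals (l : List δ) (I : Set ℝ) (A : δ → ℝ) : List ℝ :=
  (l.map A).filter fun x => x ∈ I

/-- There are at least `m` values in `I A`, and the first `m` of them form a vector in `B A`. -/
def hitEvent (l : List δ) (I : (δ → ℝ) → Set ℝ) (m : ℕ) (B : (δ → ℝ) → Set (Fin m → ℝ)) :
    Set (δ → ℝ) :=
  {A | m ≤ (hitVals l (I A) A).length ∧ listVec (hitVals l (I A) A) m ∈ B A}

theorem mem_hitEvent {l : List δ} {I : (δ → ℝ) → Set ℝ} {m : ℕ} {B : (δ → ℝ) → Set (Fin m → ℝ)}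
    {A : δ → ℝ} : A ∈ hitEvent l I m B ↔
      m ≤ (hitVals l (I A) A).length ∧ listVec (hitVals l (I A) A) m ∈ B A := Iff.rfl

theorem indicator_one_congr {α β : Type*} {s : Set α} {t : Set β} {a : α} {b : β}
    (h : a ∈ s ↔ b ∈ t) : s.indicator (1 : α → ℝ≥0∞) a = t.indicator 1 b := by
  classical
  simp only [indicator_apply, Pi.one_apply, h]

/-- Once it is known which positions are hits, the vector of hit values is a fixed projection; this
reduces the measurability of `hitEvent` to a countable union. -/
theorem measurableSet_filter_eq (l h : List δ) {I : (δ → ℝ) → Set ℝ}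
    (hI : MeasurableSet {p : (δ → ℝ) × ℝ | p.2 ∈ I p.1}) :
    MeasurableSet {A : δ → ℝ | (open Classical in l.filter fun i => A i ∈ I A) = h} := by
  classical
  have hI' : ∀ i, MeasurableSet {A : δ → ℝ | A i ∈ I A} := fun i =>
    (measurable_id.prodMk (measurable_pi_apply i)) hI
  induction l generalizing h with
  | nil => simp
  | cons i l ih =>
    have h1 : {A : δ → ℝ | ((i :: l).filter fun i => A i ∈ I A) = h} =
        ({A | A i ∈ I A} ∩ {A | h.head? = some i ∧ (l.filter fun i => A i ∈ I A) = h.tail}) ∪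
        ({A | A i ∈ I A}ᶜ ∩ {A | (l.filter fun i => A i ∈ I A) = h}) := by
      ext A
      by_cases hA : A i ∈ I A
      · cases h with
        | nil => simp [hA]
        | cons j h => simp [hA, eq_comm]
      · simp [hA]
    rw [h1]
    exact ((hI' i).inter ((MeasurableSet.const (h.head? = some i)).inter (ih h.tail))).union
      ((hI' i).compl.inter (ih h))

theorem measurable_listVec_map (h : List δ) (m : ℕ) :
    Measurable fun A : δ → ℝ => listVec (h.map A) m := by
  refine measurable_pi_lambda _ fun j => ?_
  by_cases hj : (j : ℕ) < h.length
  · have : (fun A : δ → ℝ => listVec (h.map A) m j) = fun A => A h[j] := by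
      funext A
      rw [listVec, List.getD_eq_getElem _ _ (by simpa using hj)]
      simp
    rw [this]
    exact measurable_pi_apply _
  · have : (fun A : δ → ℝ => listVec (h.map A) m j) = fun _ => 0 := by
      funext A
      rw [listVec, List.getD_eq_default _ _ (by simpa using hj)]
    rw [this]
    exact measurable_const

theorem measurableSet_hitEvent [Countable δ] (l : List δ) {I : (δ → ℝ) → Set ℝ} {m : ℕ}
    {B : (δ → ℝ) → Set (Fin m → ℝ)} (hI : MeasurableSet {p : (δ → ℝ) × ℝ | p.2 ∈ I p.1})
    (hB : MeasurableSet {p : (δ → ℝ) × (Fin m → ℝ) | p.2 ∈ B p.1}) :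
    MeasurableSet (hitEvent l I m B) := by
  classical
  have h1 : hitEvent l I m B = ⋃ h : List δ, {A | (l.filter fun i => A i ∈ I A) = h} ∩
      ({A | m ≤ h.length} ∩ {A | listVec (h.map A) m ∈ B A}) := by
    ext A
    have : hitVals l (I A) A = (l.filter fun i => A i ∈ I A).map A := by
      rw [hitVals, List.filter_map]; rfl
    simp [hitEvent, this]
  rw [h1]
  refine MeasurableSet.iUnion fun h => (measurableSet_filter_eq l h hI).inter
    ((MeasurableSet.const _).inter ?_)
  exact (measurable_id.prodMk (measurable_listVec_map h m)) hB

variable [DecidableEq δ]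

theorem pi_fin_succ_apply (ν : Measure ℝ) [SigmaFinite ν] (m : ℕ) {B : Set (Fin (m + 1) → ℝ)}
    (hB : MeasurableSet B) : (Measure.pi fun _ => ν) B =
      ∫⁻ x, (Measure.pi fun _ => ν) {d : Fin m → ℝ | (Fin.cons x d : Fin (m + 1) → ℝ) ∈ B} ∂ν := by
  have h := measurePreserving_piFinSuccAbove (fun _ : Fin (m + 1) => ν) 0
  have h2 := (h.symm (MeasurableEquiv.piFinSuccAbove (fun _ => ℝ) 0)).measure_preimage
    hB.nullMeasurableSet
  rw [← h2, Measure.prod_apply ((MeasurableEquiv.piFinSuccAbove (fun _ => ℝ) 0).symm.measurable hB)]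
  refine lintegral_congr fun x => congrArg _ ?_
  ext d
  change (MeasurableEquiv.piFinSuccAbove (fun _ => ℝ) 0).symm (x, d) ∈ B ↔ Fin.cons x d ∈ B
  rw [show (MeasurableEquiv.piFinSuccAbove (fun _ => ℝ) 0).symm (x, d) =
    (Fin.cons x d : Fin (m + 1) → ℝ) from by rw [← Fin.insertNth_zero' x d]; rfl]

/-- Rejection sampling, by induction on the positions. If the first value misses `I`, nothing has
changed; if it hits, which has probability `χ I`, it has the law `cond χ I` and becomes the first
coordinate of the vector. There is only an inequality, as the positions may run out before there are
`m` hits. -/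
theorem lmarginal_hit_le (χ : Measure ℝ) [IsProbabilityMeasure χ] {I : Set ℝ}
    (hI : MeasurableSet I) (l : List δ) (hl : l.Nodup) (m : ℕ) (B : Set (Fin m → ℝ))
    (hB : MeasurableSet B) [Countable δ] (x : δ → ℝ) :
    lmarginal (fun _ => χ) l.toFinset
      ((hitEvent l (fun _ => I) m fun _ => B).indicator 1) x ≤
      (Measure.pi fun _ => cond χ I) B := by
  induction l generalizing m x with
  | nil =>
    rw [List.toFinset_nil, lmarginal_empty]
    rcases Nat.eq_zero_or_pos m with rfl | hm
    · rw [Measure.pi_of_empty, Measure.dirac_apply' _ hB]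
      refine le_of_eq (indicator_one_congr ?_)
      rw [mem_hitEvent, Subsingleton.elim (listVec _ 0) fun a => isEmptyElim a]
      simp
    · have : x ∉ hitEvent ([] : List δ) (fun _ => I) m fun _ => B := by
        simp [hitEvent, hitVals]; omega
      rw [indicator_of_notMem this]
      exact zero_le
  | cons i l ih =>
    have hil : i ∉ l.toFinset := by simpa using (List.nodup_cons.1 hl).1
    have hmeas : ∀ (l : List δ) (m : ℕ) (B : Set (Fin m → ℝ)), MeasurableSet B →
        MeasurableSet (hitEvent l (fun _ => I) m fun _ => B) := fun l m B hB =>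
      measurableSet_hitEvent l (measurable_snd hI) (measurable_snd hB)
    rw [List.toFinset_cons, lmarginal_insert _ (measurable_one.indicator (hmeas _ _ _ hB)) hil]
    have hout : ∀ y ∉ I, lmarginal (fun _ => χ) l.toFinset
        ((hitEvent (i :: l) (fun _ => I) m fun _ => B).indicator 1) (Function.update x i y) ≤
        (Measure.pi fun _ => cond χ I) B := by
      intro y hy
      refine le_trans (le_of_eq ?_) (ih (List.nodup_cons.1 hl).2 m B hB (Function.update x i y))
      refine lintegral_congr fun z => ?_
      have h1 : Function.updateFinset (Function.update x i y) l.toFinset z i = y := by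
        rw [Function.updateFinset, dif_neg hil, Function.update_self]
      have h2 : hitVals (i :: l) I (Function.updateFinset (Function.update x i y) l.toFinset z) =
          hitVals l I (Function.updateFinset (Function.update x i y) l.toFinset z) := by
        rw [hitVals, List.map_cons, h1, List.filter_cons_of_neg (by simpa using hy), hitVals]
      exact indicator_one_congr (by rw [mem_hitEvent, mem_hitEvent, h2])
    -- A hit `y` leaves the event that the remaining `k` hits complete `y` to a vector in `B`. For
    -- `m = 0` there is nothing to complete, so the claim is conditional on `m = k + 1`.
    have hin : ∀ k (hk : m = k + 1), ∀ y ∈ I, lmarginal (fun _ => χ) l.toFinset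
        ((hitEvent (i :: l) (fun _ => I) m fun _ => B).indicator 1) (Function.update x i y) ≤
        (Measure.pi fun _ => cond χ I)
          {d : Fin k → ℝ | (Fin.cons y d : Fin (k + 1) → ℝ) ∈ hk ▸ B} := by
      rintro k rfl y hy
      have hBy : MeasurableSet {d : Fin k → ℝ | (Fin.cons y d : Fin (k + 1) → ℝ) ∈ B} := by
        refine (measurable_pi_lambda _ fun j => ?_) hB
        refine Fin.cases ?_ (fun j => ?_) j
        · simp
        · simpa using measurable_pi_apply j
      refine le_trans (le_of_eq ?_) (ih (List.nodup_cons.1 hl).2 k _ hBy (Function.update x i y))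
      refine lintegral_congr fun z => ?_
      have h1 : Function.updateFinset (Function.update x i y) l.toFinset z i = y := by
        rw [Function.updateFinset, dif_neg hil, Function.update_self]
      have h2 : hitVals (i :: l) I (Function.updateFinset (Function.update x i y) l.toFinset z) =
          y :: hitVals l I (Function.updateFinset (Function.update x i y) l.toFinset z) := by
        rw [hitVals, List.map_cons, h1, List.filter_cons_of_pos (by simpa using hy), hitVals]
      have h3 : ∀ L : List ℝ, listVec (y :: L) (k + 1) = Fin.cons y (listVec L k) := by
        intro L
        funext j
        refine Fin.cases ?_ (fun j => ?_) j <;> simp [listVec]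
      refine indicator_one_congr ?_
      rw [mem_hitEvent, mem_hitEvent, h2, h3, List.length_cons, add_le_add_iff_right]
      rfl
    rw [← lintegral_add_compl _ hI]
    have hc : ∫⁻ y in Iᶜ, lmarginal (fun _ => χ) l.toFinset
        ((hitEvent (i :: l) (fun _ => I) m fun _ => B).indicator 1) (Function.update x i y) ∂χ ≤
        χ Iᶜ * (Measure.pi fun _ => cond χ I) B := by
      refine (setLIntegral_mono' hI.compl hout).trans ?_
      rw [setLIntegral_const, mul_comm]
    cases m with
    | zero =>
      have hone : lmarginal (fun _ => χ) l.toFinset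
        ((hitEvent (i :: l) (fun _ => I) 0 fun _ => B).indicator 1) ≤ fun _ =>
          (Measure.pi fun _ => cond χ I) B := by
        intro z
        by_cases h : B = ∅
        · have : (hitEvent (i :: l) (fun _ => I) 0 fun _ => B) = ∅ := by
            ext A; simp [hitEvent, h]
          simp [this, lmarginal]
        · have : B = univ := Subsingleton.eq_univ_of_nonempty (nonempty_iff_ne_empty.2 h)
          rw [Measure.pi_of_empty, this, measure_univ]
          refine (lintegral_mono (g := fun _ => 1) fun y => ?_).trans (by simp)
          exact indicator_apply_le' (fun _ => le_rfl) fun _ => zero_le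
      calc _ ≤ ∫⁻ y in I, (Measure.pi fun _ => cond χ I) B ∂χ +
            ∫⁻ y in Iᶜ, (Measure.pi fun _ => cond χ I) B ∂χ :=
            add_le_add (lintegral_mono fun _ => hone _) (lintegral_mono fun _ => hone _)
        _ = (Measure.pi fun _ => cond χ I) B := by
            rw [lintegral_add_compl _ hI]; simp
    | succ k =>
      have h1 : ∫⁻ y in I, lmarginal (fun _ => χ) l.toFinset
        ((hitEvent (i :: l) (fun _ => I) (k + 1) fun _ => B).indicator 1)
          (Function.update x i y) ∂χ ≤ χ I * (Measure.pi fun _ => cond χ I) B := by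
        refine (setLIntegral_mono' hI (hin k rfl)).trans ?_
        rw [pi_fin_succ_apply _ _ hB]
        by_cases h0 : χ I = 0
        · rw [Measure.restrict_eq_zero.2 h0]; simp
        · rw [ProbabilityTheory.cond, lintegral_smul_measure, smul_eq_mul, ← mul_assoc,
            ENNReal.mul_inv_cancel h0 (measure_ne_top _ _), one_mul]
      refine (add_le_add h1 hc).trans ?_
      rw [← add_mul, prob_add_prob_compl hI, one_mul]

/-- The probability of an event about the first hits of an interval that depends on some of the
coordinates, where the other coordinates are tested. -/
theorem measure_hitEvent_le [Fintype δ] (χ : Measure ℝ) [IsProbabilityMeasure χ] (s : Finset δ)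
    (l : List δ) (hl : l.Nodup) (hs : ∀ i ∈ l, i ∉ s) {I : (δ → ℝ) → Set ℝ} {m : ℕ}
    {B : (δ → ℝ) → Set (Fin m → ℝ)} (hI : MeasurableSet {p : (δ → ℝ) × ℝ | p.2 ∈ I p.1})
    (hB : MeasurableSet {p : (δ → ℝ) × (Fin m → ℝ) | p.2 ∈ B p.1})
    (hIs : ∀ A A', (∀ i ∈ s, A i = A' i) → I A = I A')
    (hBs : ∀ A A', (∀ i ∈ s, A i = A' i) → B A = B A') {ε : ℝ≥0∞}
    (h : ∀ A, (Measure.pi fun _ => cond χ (I A)) (B A) ≤ ε) :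
    (Measure.pi fun _ => χ) (hitEvent l I m B) ≤ ε := by
  have hm := measurableSet_hitEvent l hI hB
  rw [← lintegral_indicator_one hm]
  -- Only the coordinates in `l` are integrated out; those in `s` keep their values, which freezes
  -- the interval and the event, so that `lmarginal_hit_le` applies.
  refine (lintegral_le_of_lmarginal_le (μ := fun _ => χ) l.toFinset (g := fun _ => ε)
    (measurable_one.indicator hm) measurable_const fun A => ?_).trans (by simp)
  have hIA : MeasurableSet (I A) := measurable_prodMk_left hI
  have hBA : MeasurableSet (B A) := measurable_prodMk_left hB
  have h1 := (lmarginal_hit_le χ hIA l hl m (B A) hBA A).trans (h A)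
  refine le_trans (le_of_eq ?_) (h1.trans (by simp [lmarginal]))
  refine lintegral_congr fun z => ?_
  have h2 : ∀ i ∈ s, Function.updateFinset A l.toFinset z i = A i := fun i hi => by
    rw [Function.updateFinset, dif_neg]
    intro hi'
    exact hs i (List.mem_toFinset.1 hi') hi
  exact indicator_one_congr (by rw [mem_hitEvent, mem_hitEvent, hIs _ _ h2, hBs _ _ h2])

end hits

/-! ### Concentration -/

theorem integral_eval_pi (ν : Measure ℝ) [IsProbabilityMeasure ν] {f : ℝ → ℝ} (hf : Measurable f)
    {m : ℕ} (j : Fin m) : ∫ d, f (d j) ∂(Measure.pi fun _ : Fin m => ν) = ∫ x, f x ∂ν := by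
  have h := (measurePreserving_eval (fun _ : Fin m => ν) j).map_eq
  conv_rhs => rw [← h]
  exact (integral_map (measurable_pi_apply j).aemeasurable hf.aestronglyMeasurable).symm

/-- The interval for the values has length 1 but starts anywhere, so that indicators and their
negatives are covered: one gives the upper tail of counts, the other the lower tail. -/
theorem hoeffding_pi (ν : Measure ℝ) [IsProbabilityMeasure ν] {f : ℝ → ℝ} (hf : Measurable f)
    {a : ℝ} (hfa : ∀ x, f x ∈ Icc a (a + 1)) {m : ℕ} (s : Finset (Fin m)) {t : ℝ} (ht : 0 ≤ t) :
    (Measure.pi fun _ : Fin m => ν) {d | t ≤ ∑ j ∈ s, (f (d j) - ∫ x, f x ∂ν)} ≤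
      ENNReal.ofReal (Real.exp (-(2 * t ^ 2 / s.card))) := by
  have hint : ∀ j, ∫ d, f (d j) ∂(Measure.pi fun _ : Fin m => ν) = ∫ x, f x ∂ν := fun j =>
    integral_eval_pi ν hf j
  have hind : iIndepFun (fun (j : Fin m) (d : Fin m → ℝ) => f (d j) - ∫ x, f x ∂ν)
      (Measure.pi fun _ => ν) :=
    iIndepFun_pi (X := fun _ x => f x - ∫ x, f x ∂ν) fun _ => (hf.sub_const _).aemeasurable
  have hsub : ∀ j ∈ s, HasSubgaussianMGF (fun d : Fin m → ℝ => f (d j) - ∫ x, f x ∂ν)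
      ((‖(a + 1) - a‖₊ / 2) ^ 2) (Measure.pi fun _ => ν) := by
    intro j _
    have := hasSubgaussianMGF_of_mem_Icc (μ := Measure.pi fun _ : Fin m => ν)
      (X := fun d => f (d j)) (a := a) (b := a + 1)
      (hf.comp (measurable_pi_apply j)).aemeasurable (Filter.Eventually.of_forall fun d => hfa _)
    rwa [hint] at this
  have h := HasSubgaussianMGF.measure_sum_ge_le_of_iIndepFun hind hsub ht
  rw [← ENNReal.ofReal_toReal (measure_ne_top (Measure.pi fun _ : Fin m => ν) _)]
  refine ENNReal.ofReal_le_ofReal (h.trans (le_of_eq ?_))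
  congr 1
  simp only [add_sub_cancel_left, Finset.sum_const, nnnorm_one, nsmul_eq_mul]
  push_cast
  rcases Nat.eq_zero_or_pos s.card with h0 | h0
  · simp [h0]
  · have : (0 : ℝ) < s.card := by exact_mod_cast h0
    field_simp

open Classical in
/-- The number of entries with a property among the first `k` of a vector. -/
noncomputable def countVec (p : ℝ → Prop) (k : ℕ) {m : ℕ} (d : Fin m → ℝ) : ℕ :=
  (Finset.univ.filter fun j : Fin m => (j : ℕ) < k ∧ p (d j)).card

open Classical in
theorem countVec_listVec (p : ℝ → Prop) {k m : ℕ} {L : List ℝ} (hk : k ≤ m) (hm : m ≤ L.length) :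
    countVec p k (listVec L m) = (L.take k).countP p := by
  induction k with
  | zero => simp [countVec]
  | succ k ih =>
    have hkL : k < L.length := by omega
    rw [List.take_succ_eq_append_getElem hkL, List.countP_append, ← ih (by omega), countVec,
      countVec]
    have h1 : (Finset.univ.filter fun j : Fin m => (j : ℕ) < k + 1 ∧ p (listVec L m j)) =
        (Finset.univ.filter fun j : Fin m => (j : ℕ) < k ∧ p (listVec L m j)) ∪
        (if p L[k] then {(⟨k, hk⟩ : Fin m)} else ∅) := by
      ext j
      have h2 : listVec L m ⟨k, hk⟩ = L[k] := List.getD_eq_getElem _ _ hkL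
      by_cases hj : j = ⟨k, hk⟩
      · subst hj
        by_cases hp : p L[k] <;> simp [h2, hp]
      · have hj' : (j : ℕ) ≠ k := fun h => hj (Fin.ext h)
        have h3 : (j : ℕ) < k + 1 ↔ (j : ℕ) < k := by omega
        simp only [Finset.mem_union, Finset.mem_filter, Finset.mem_univ, true_and, h3]
        by_cases hp : p L[k] <;> simp [hp, hj]
    rw [h1, Finset.card_union_of_disjoint]
    · by_cases hp : p L[k] <;> simp [hp]
    · by_cases hp : p L[k] <;> simp [hp]

theorem rank_eq_countVec {m : ℕ} (d : Fin m → ℝ) (x : ℝ) : rank d x = countVec (· < x) m d := by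
  classical
  rw [rank, countVec]
  congr 1
  ext j
  simp

theorem countVec_eq_sum (J : Set ℝ) (k : ℕ) {m : ℕ} (d : Fin m → ℝ) :
    (countVec (· ∈ J) k d : ℝ) =
      ∑ j ∈ Finset.univ.filter (fun j : Fin m => (j : ℕ) < k), J.indicator (1 : ℝ → ℝ) (d j) := by
  classical
  rw [countVec, ← Finset.filter_filter, Finset.card_filter]
  push_cast
  exact Finset.sum_congr rfl fun j _ => by simp [indicator_apply]

theorem measurable_countVec {α : Type*} [MeasurableSpace α] {m : ℕ} {p : α → ℝ → Prop} (k : ℕ)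
    {d : α → Fin m → ℝ} (hp : ∀ j, MeasurableSet {a | p a (d a j)}) :
    Measurable fun a => countVec (p a) k (d a) := by
  classical
  have : (fun a => countVec (p a) k (d a)) =
      fun a => ∑ j ∈ Finset.univ.filter (fun j : Fin m => (j : ℕ) < k),
        {a | p a (d a j)}.indicator 1 a := by
    funext a
    rw [countVec, ← Finset.filter_filter, Finset.card_filter]
    exact Finset.sum_congr rfl fun j _ => by simp [indicator_apply]
  rw [this]
  exact Finset.measurable_sum _ fun j _ => measurable_one.indicator (hp j)

theorem card_filter_lt {m k : ℕ} (h : k ≤ m) :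
    (Finset.univ.filter fun j : Fin m => (j : ℕ) < k).card = k := by
  rw [Fin.card_filter_val_lt, min_eq_right h]

section counts
variable (ν : Measure ℝ) [IsProbabilityMeasure ν] {J : Set ℝ} (hJ : MeasurableSet J) {m k : ℕ}
  (hk : k ≤ m) {t : ℝ} (ht : 0 ≤ t)
include hJ hk ht

theorem countVec_upper : (Measure.pi fun _ : Fin m => ν)
    {d | k * ν.real J + t ≤ countVec (· ∈ J) k d} ≤
      ENNReal.ofReal (Real.exp (-(2 * t ^ 2 / k))) := by
  have h := hoeffding_pi ν (f := J.indicator 1) (measurable_one.indicator hJ) (a := 0)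
    (fun x => by by_cases hx : x ∈ J <;> simp [hx])
    (Finset.univ.filter fun j : Fin m => (j : ℕ) < k) ht
  rw [card_filter_lt hk] at h
  refine (measure_mono fun d hd => ?_).trans h
  have hd' : k * ν.real J + t ≤ (countVec (· ∈ J) k d : ℝ) := hd
  rw [countVec_eq_sum] at hd'
  change t ≤ ∑ j ∈ Finset.univ.filter (fun j : Fin m => (j : ℕ) < k),
    (J.indicator (1 : ℝ → ℝ) (d j) - ∫ x, J.indicator (1 : ℝ → ℝ) x ∂ν)
  rw [Finset.sum_sub_distrib, Finset.sum_const, card_filter_lt hk, integral_indicator_one hJ,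
    nsmul_eq_mul]
  linarith

theorem countVec_lower : (Measure.pi fun _ : Fin m => ν)
    {d | (countVec (· ∈ J) k d : ℝ) ≤ k * ν.real J - t} ≤
      ENNReal.ofReal (Real.exp (-(2 * t ^ 2 / k))) := by
  have h := hoeffding_pi ν (f := fun x => - J.indicator 1 x) (measurable_one.indicator hJ).neg
    (a := -1) (fun x => by by_cases hx : x ∈ J <;> simp [hx])
    (Finset.univ.filter fun j : Fin m => (j : ℕ) < k) ht
  rw [card_filter_lt hk] at h
  refine (measure_mono fun d hd => ?_).trans h
  have hd' : (countVec (· ∈ J) k d : ℝ) ≤ k * ν.real J - t := hd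
  rw [countVec_eq_sum] at hd'
  change t ≤ ∑ j ∈ Finset.univ.filter (fun j : Fin m => (j : ℕ) < k),
    (- J.indicator (1 : ℝ → ℝ) (d j) - ∫ x, - J.indicator (1 : ℝ → ℝ) x ∂ν)
  rw [Finset.sum_sub_distrib, Finset.sum_const, card_filter_lt hk, integral_neg,
    integral_indicator_one hJ, nsmul_eq_mul, Finset.sum_neg_distrib]
  linarith

end counts

/-- Links the quantity in the learnability assumption to the mean of the counts in Hoeffding's
inequality. -/
theorem expectedRank_const (ν : ProbabilityMeasure ℝ) (m : ℕ) (x : ℝ) :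
    expectedRank (fun _ : Fin m => ν) x = m * (ν : Measure ℝ).real (Iio x) := by
  have h1 : ∀ D : Fin m → ℝ, (rank D x : ℝ) = ∑ j, (Iio x).indicator (1 : ℝ → ℝ) (D j) := by
    intro D
    rw [rank_eq_countVec]
    have := countVec_eq_sum (Iio x) m D
    simpa using this
  have hm : Measurable ((Iio x).indicator (1 : ℝ → ℝ)) := measurable_one.indicator measurableSet_Iio
  rw [expectedRank]
  simp only [h1]
  rw [integral_finsetSum]
  · have : ∀ j : Fin m, ∫ D, (Iio x).indicator (1 : ℝ → ℝ) (D j)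
        ∂(Measure.pi fun _ : Fin m => (ν : Measure ℝ)) = (ν : Measure ℝ).real (Iio x) := by
      intro j
      rw [← integral_indicator_one measurableSet_Iio]
      exact integral_eval_pi (ν : Measure ℝ) hm j
    simp [this]
  · intro j _
    refine Integrable.of_mem_Icc 0 1 (hm.comp (measurable_pi_apply j)).aemeasurable
      (Filter.Eventually.of_forall fun D => ?_)
    by_cases hx : D j ∈ Iio x <;> simp [hx]

/-- The probability that the model of the data or the rank in the data deviates from its
expectation. -/
noncomputable def failAcc (κ₁ κ₂ : ℝ) (u : ℕ) : ℝ :=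
  κ₁ * Real.exp (-(κ₂ * (Real.sqrt u - 1) ^ 2)) + 2 * Real.exp (-(2 * u))

/-- The estimated rank, as it is used by the machine. -/
noncomputable def Learner.est (L : Learner) {m : ℕ} (d : Fin m → ℝ) (y : ℝ) : ℕ :=
  min m ⌊L.fit m d y⌋₊

/-- The model is within `u ^ 3` of the expected rank by learnability, and so is the rank in the
sample by Hoeffding's inequality; a third `u ^ 3 ≥ 1` absorbs the rounding. The key `y` is fixed
before the sample is drawn, so no uniform bound for the empirical distribution is needed. -/
theorem Learner.Learns.accurate {L : Learner} {κ₁ κ₂ : ℝ} (hκ₁ : 0 < κ₁)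
    {Y : Set (ProbabilityMeasure ℝ)} {T S B : ℕ → ℝ} (hL : L.Learns κ₁ κ₂ Y T S B)
    {ν : ProbabilityMeasure ℝ} (hν : ν ∈ Y) {u : ℕ} (hu : 2 ≤ u) {y : ℝ} (hy : y ∈ Icc (0 : ℝ) 1) :
    (Measure.pi fun _ : Fin (u ^ 5) => (ν : Measure ℝ))
      {d | ¬ (L.est d y ≤ rank d y + 3 * u ^ 3 ∧ rank d y ≤ L.est d y + 3 * u ^ 3)} ≤
      ENNReal.ofReal (failAcc κ₁ κ₂ u) := by
  have hu0 : (0 : ℝ) < u := by positivity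
  have hu2 : (2 : ℝ) ≤ u := by exact_mod_cast hu
  have hm : (((u ^ 5 : ℕ) : ℝ)) = (u : ℝ) ^ 5 := by push_cast; ring
  set μ := Measure.pi fun _ : Fin (u ^ 5) => (ν : Measure ℝ) with hμ
  have hsq : Real.sqrt ((u ^ 5 : ℕ) : ℝ) = u ^ 2 * Real.sqrt u := by
    rw [hm, show (u : ℝ) ^ 5 = (u ^ 2) ^ 2 * u by ring, Real.sqrt_mul (by positivity),
      Real.sqrt_sq (by positivity)]
  have hsu : Real.sqrt u * Real.sqrt u = u := Real.mul_self_sqrt hu0.le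
  have hsu1 : 1 ≤ Real.sqrt u := Real.one_le_sqrt.2 (by linarith)
  -- The exponents 5 and 3 leave a margin of `√u` standard deviations.
  have hdiv : (u : ℝ) ^ 3 / Real.sqrt ((u ^ 5 : ℕ) : ℝ) = Real.sqrt u := by
    rw [hsq, div_eq_iff (by positivity)]
    linear_combination (-(u : ℝ) ^ 2) * hsu
  have h1 := hL.accuracy (u ^ 5) (Nat.one_le_pow _ _ (by omega)) (fun _ => ν) (fun _ => hν) (u ^ 3)
    (by rw [hsq, show (u : ℝ) ^ 3 = u ^ 2 * (Real.sqrt u * Real.sqrt u) by rw [hsu]; ring]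
        exact mul_le_mul_of_nonneg_left (by nlinarith) (by positivity))
  rw [hdiv] at h1
  have h2 := countVec_upper (ν : Measure ℝ) (J := Iio y) measurableSet_Iio (m := u ^ 5)
    (k := u ^ 5) le_rfl (t := (u : ℝ) ^ 3) (by positivity)
  have h3 := countVec_lower (ν : Measure ℝ) (J := Iio y) measurableSet_Iio (m := u ^ 5)
    (k := u ^ 5) le_rfl (t := (u : ℝ) ^ 3) (by positivity)
  have hexp : 2 * ((u : ℝ) ^ 3) ^ 2 / ((u ^ 5 : ℕ) : ℝ) = 2 * u := by
    rw [hm]; field_simp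
  rw [hexp] at h2 h3
  refine le_trans (measure_mono (t := ({D | ENNReal.ofReal ((u : ℝ) ^ 3) ≤ ⨆ x ∈ Icc (0 : ℝ) 1,
    ‖expectedRank (fun _ : Fin (u ^ 5) => ν) x - L.fit (u ^ 5) D x‖ₑ} ∪
    ({d | ((u ^ 5 : ℕ) : ℝ) * (ν : Measure ℝ).real (Iio y) + (u : ℝ) ^ 3 ≤
      countVec (· ∈ Iio y) (u ^ 5) d} ∪ {d | (countVec (· ∈ Iio y) (u ^ 5) d : ℝ) ≤
        ((u ^ 5 : ℕ) : ℝ) * (ν : Measure ℝ).real (Iio y) - (u : ℝ) ^ 3}))) fun d hd => ?_) ?_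
  · by_contra hcon
    simp only [mem_union, not_or] at hcon
    obtain ⟨g1, g2, g3⟩ := hcon
    replace g1 : ¬ (ENNReal.ofReal ((u : ℝ) ^ 3) ≤ ⨆ x ∈ Icc (0 : ℝ) 1,
      ‖expectedRank (fun _ : Fin (u ^ 5) => ν) x - L.fit (u ^ 5) d x‖ₑ) := g1
    replace g2 : ¬ (((u ^ 5 : ℕ) : ℝ) * (ν : Measure ℝ).real (Iio y) + (u : ℝ) ^ 3 ≤
      countVec (· ∈ Iio y) (u ^ 5) d) := g2
    replace g3 : ¬ ((countVec (· ∈ Iio y) (u ^ 5) d : ℝ) ≤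
        ((u ^ 5 : ℕ) : ℝ) * (ν : Measure ℝ).real (Iio y) - (u : ℝ) ^ 3) := g3
    have g4 : ‖expectedRank (fun _ : Fin (u ^ 5) => ν) y - L.fit (u ^ 5) d y‖ₑ <
        ENNReal.ofReal ((u : ℝ) ^ 3) :=
      lt_of_le_of_lt (le_iSup₂ (f := fun x (_ : x ∈ Icc (0 : ℝ) 1) =>
        ‖expectedRank (fun _ : Fin (u ^ 5) => ν) x - L.fit (u ^ 5) d x‖ₑ) y hy) (not_le.1 g1)
    rw [← ofReal_norm, ENNReal.ofReal_lt_ofReal_iff (by positivity), Real.norm_eq_abs,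
      abs_lt, expectedRank_const] at g4
    have hrank : countVec (· ∈ Iio y) (u ^ 5) d = rank d y := (rank_eq_countVec d y).symm
    rw [hrank] at g2 g3
    push Not at g2 g3
    have hrm : rank d y ≤ u ^ 5 := by
      rw [rank]; exact (Finset.card_filter_le _ _).trans (by simp)
    have hu3 : (1 : ℝ) ≤ (u : ℝ) ^ 3 := one_le_pow₀ (by linarith)
    refine hd ⟨?_, ?_⟩
    · refine (min_le_right _ _).trans ?_
      rcases le_or_gt (L.fit (u ^ 5) d y) 0 with h0 | h0
      · rw [Nat.floor_of_nonpos h0]; exact Nat.zero_le _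
      · have h5 : ((⌊L.fit (u ^ 5) d y⌋₊ : ℕ) : ℝ) ≤ ((rank d y + 3 * u ^ 3 : ℕ) : ℝ) := by
          refine (Nat.floor_le h0.le).trans ?_
          push_cast
          linarith [g4.1]
        exact_mod_cast h5
    · rw [Learner.est]
      rcases le_total (u ^ 5) ⌊L.fit (u ^ 5) d y⌋₊ with h0 | h0
      · rw [min_eq_left h0]; omega
      · rw [min_eq_right h0]
        have h5 : (rank d y : ℝ) ≤ ((⌊L.fit (u ^ 5) d y⌋₊ + 3 * u ^ 3 : ℕ) : ℝ) := by
          have := (Nat.lt_floor_add_one (L.fit (u ^ 5) d y)).le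
          push_cast
          linarith [g4.2]
        exact_mod_cast h5
  · refine (measure_union_le _ _).trans ?_
    rw [failAcc, ENNReal.ofReal_add (by positivity) (by positivity)]
    refine add_le_add (h1.trans (le_of_eq (by rw [neg_mul]))) ((measure_union_le _ _).trans ?_)
    rw [two_mul (Real.exp _), ENNReal.ofReal_add (by positivity) (by positivity)]
    exact add_le_add h2 h3

/-- Either `J` has mass at least `4 / u ^ 2`, and then few sample points in it are unlikely, or it
has less, and then many points in it are unlikely. No union over the two cases is necessary, since
the mass of `J` is not random here. -/
theorem measure_large_child_le (ν : Measure ℝ) [IsProbabilityMeasure ν] {J : Set ℝ}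
    (hJ : MeasurableSet J) {u K c : ℕ} (hu : 2 ≤ u) (hK : 1 ≤ K) (hc : u ^ 5 - 2 ≤ c)
    (hc' : c ≤ K * u ^ 10) :
    (Measure.pi fun _ : Fin c => ν) {d | countVec (· ∈ J) (u ^ 5 - 2) d ≤ u ^ 3 ∧
      8 * K * u ^ 8 < countVec (· ∈ J) c d} ≤ ENNReal.ofReal (Real.exp (-u)) := by
  have hu2 : (2 : ℝ) ≤ u := by exact_mod_cast hu
  have hK1 : (1 : ℝ) ≤ K := by exact_mod_cast hK
  have h32 : 32 ≤ u ^ 5 := by simpa using Nat.pow_le_pow_left hu 5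
  have hu3 : (8 : ℝ) ≤ (u : ℝ) ^ 3 := by
    have := pow_le_pow_left₀ (by norm_num) hu2 3
    norm_num at this ⊢; exact this
  have hm : ((u ^ 5 - 2 : ℕ) : ℝ) = (u : ℝ) ^ 5 - 2 := by
    rw [Nat.cast_sub (by omega)]; push_cast; ring
  have hm0 : (0 : ℝ) < ((u ^ 5 - 2 : ℕ) : ℝ) := by
    have : 0 < u ^ 5 - 2 := by omega
    exact_mod_cast this
  have hu5 : (32 : ℝ) ≤ (u : ℝ) ^ 5 := by exact_mod_cast h32
  -- In the first case about `4 * u ^ 3` sample points are expected in `J`, but there are at most `u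
  -- ^ 3`: a deviation of `2 * u ^ 3`.
  rcases le_or_gt (4 / (u : ℝ) ^ 2) (ν.real J) with hγ | hγ
  · have h := countVec_lower ν hJ hc (t := 2 * (u : ℝ) ^ 3) (by positivity)
    refine (measure_mono fun d hd => ?_).trans (h.trans (ENNReal.ofReal_le_ofReal
      (Real.exp_le_exp.2 (neg_le_neg ?_))))
    · have h1 : (countVec (· ∈ J) (u ^ 5 - 2) d : ℝ) ≤ (u : ℝ) ^ 3 := by exact_mod_cast hd.1
      change (countVec (· ∈ J) (u ^ 5 - 2) d : ℝ) ≤ _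
      refine h1.trans ?_
      have h2 : ((u ^ 5 - 2 : ℕ) : ℝ) * (4 / (u : ℝ) ^ 2) ≤
        ((u ^ 5 - 2 : ℕ) : ℝ) * ν.real J := mul_le_mul_of_nonneg_left hγ hm0.le
      have h3 : ((u ^ 5 - 2 : ℕ) : ℝ) * (4 / (u : ℝ) ^ 2) = 4 * (u : ℝ) ^ 3 - 8 / (u : ℝ) ^ 2 := by
        rw [hm]; field_simp; ring
      have h4 : 8 / (u : ℝ) ^ 2 ≤ 2 := by
        rw [div_le_iff₀ (by positivity)]; nlinarith
      linarith
    · rw [le_div_iff₀ hm0, hm]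
      have : (u : ℝ) * (u : ℝ) ^ 5 = ((u : ℝ) ^ 3) ^ 2 := by ring
      nlinarith
  -- Among at most `K * u ^ 10` points at most `4 * K * u ^ 8` are expected in `J`; twice that
  -- number is exceeded.
  · have h := countVec_upper ν hJ (le_refl c) (t := 4 * K * (u : ℝ) ^ 8) (by positivity)
    have hc0 : (0 : ℝ) < c := by
      have : 0 < c := by omega
      exact_mod_cast this
    have hcK : (c : ℝ) ≤ K * (u : ℝ) ^ 10 := by exact_mod_cast hc'
    refine (measure_mono fun d hd => ?_).trans (h.trans (ENNReal.ofReal_le_ofReal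
      (Real.exp_le_exp.2 (neg_le_neg ?_))))
    · have h1 : (8 * K * u ^ 8 : ℝ) < countVec (· ∈ J) c d := by exact_mod_cast hd.2
      change _ ≤ (countVec (· ∈ J) c d : ℝ)
      have h2 : (c : ℝ) * ν.real J ≤ (K * (u : ℝ) ^ 10) * (4 / (u : ℝ) ^ 2) :=
        mul_le_mul hcK hγ.le measureReal_nonneg (by positivity)
      have h3 : (K * (u : ℝ) ^ 10) * (4 / (u : ℝ) ^ 2) = 4 * K * (u : ℝ) ^ 8 := by
        field_simp
      linarith
    · rw [le_div_iff₀ hc0]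
      calc (u : ℝ) * c ≤ u * (K * (u : ℝ) ^ 10) := mul_le_mul_of_nonneg_left hcK (by positivity)
        _ = (K * (u : ℝ) ^ 11) * 1 := by ring
        _ ≤ (K * (u : ℝ) ^ 11) * (32 * K * (u : ℝ) ^ 5) := by
            refine mul_le_mul_of_nonneg_left ?_ (by positivity)
            nlinarith
        _ = 2 * (4 * K * (u : ℝ) ^ 8) ^ 2 := by ring

/-! ### Unlikely events -/

section events
variable {n : ℕ}

/-- The key that a word refers to. -/
def keyAt (A : Fin n → ℝ) (i : ℕ) : ℝ :=
  if h : i < n then A ⟨i, h⟩ else if i = n then 0 else 1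

/-- The keys in `[0, 1]` between the keys that two words refer to. -/
def ivl (A : Fin n → ℝ) (lo hi : ℕ) : Set ℝ :=
  {y | y ∈ Icc (0 : ℝ) 1 ∧ (lo = n ∨ keyAt A lo < y) ∧ (hi = n + 1 ∨ y < keyAt A hi)}

/-- The positions of an array except for some. -/
def others (n : ℕ) (s : Finset ℕ) : List (Fin n) := (List.finRange n).filter fun i => (i : ℕ) ∉ s

theorem keyAt_congr {A A' : Fin n → ℝ} {s : Finset ℕ}
    (h : ∀ i ∈ Finset.univ.filter (fun i : Fin n => (i : ℕ) ∈ s), A i = A' i) {i : ℕ} (hi : i ∈ s) :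
    keyAt A i = keyAt A' i := by
  unfold keyAt
  split_ifs with h1 h2
  · exact h _ (by simpa using hi)
  · rfl
  · rfl

theorem ivl_congr {A A' : Fin n → ℝ} {lo hi : ℕ} (h : keyAt A lo = keyAt A' lo)
    (h' : keyAt A hi = keyAt A' hi) : ivl A lo hi = ivl A' lo hi := by
  unfold ivl; rw [h, h']

@[fun_prop]
theorem measurable_keyAt (i : ℕ) : Measurable fun A : Fin n → ℝ => keyAt A i := by
  unfold keyAt
  split_ifs with h1 h2
  · exact measurable_pi_apply _
  · exact measurable_const
  · exact measurable_const

theorem measurableSet_ivl {α : Type*} [MeasurableSpace α] {A : α → Fin n → ℝ} {y : α → ℝ}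
    (hA : Measurable A) (hy : Measurable y) (lo hi : ℕ) :
    MeasurableSet {a | y a ∈ ivl (A a) lo hi} :=
  (hy measurableSet_Icc).inter
    (((MeasurableSet.const _).union
      (measurableSet_lt ((measurable_keyAt lo).comp hA) hy)).inter
    ((MeasurableSet.const _).union (measurableSet_lt hy ((measurable_keyAt hi).comp hA))))

/-- One hit shows that the interval is not degenerate, so that rescaling it to the unit interval
makes sense. -/
theorem lt_of_mem_ivl {A : Fin n → ℝ} {lo hi : ℕ} {y : ℝ}
    (h : y ∈ ivl A lo hi) :
    keyAt A lo < keyAt A hi ∧ y ∈ Icc (keyAt A lo) (keyAt A hi) := by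
  obtain ⟨⟨g1, g2⟩, g3, g4⟩ := h
  have e0 : lo = n → keyAt A lo = 0 := fun h => by simp [keyAt, h]
  have e1 : hi = n + 1 → keyAt A hi = 1 := fun h => by simp [keyAt, h]
  rcases g3 with g3 | g3 <;> rcases g4 with g4 | g4
  · rw [e0 g3, e1 g4]; exact ⟨one_pos, g1, g2⟩
  · rw [e0 g3]; exact ⟨g1.trans_lt g4, g1, g4.le⟩
  · rw [e1 g4]; exact ⟨g3.trans_le g2, g3.le, g2⟩
  · exact ⟨g3.trans g4, g3.le, g4.le⟩

theorem rescale_mem {a b y : ℝ} (h : y ∈ Icc a b) : rescale a b y ∈ Icc (0 : ℝ) 1 := by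
  have h1 := h.1
  have h2 := h.2
  unfold rescale
  exact ⟨div_nonneg (by linarith) (by linarith), div_le_one_of_le₀ (by linarith) (by linarith)⟩

/-- The estimates of a model are close to the ranks in the sample. -/
def Learner.Acc (L : Learner) (u : ℕ) {m : ℕ} (d : Fin m → ℝ) (y : ℝ) : Prop :=
  L.est d y ≤ rank d y + 3 * u ^ 3 ∧ rank d y ≤ L.est d y + 3 * u ^ 3

theorem Learner.measurableSet_acc (L : Learner) (u : ℕ) {m : ℕ} {α : Type*} [MeasurableSpace α]
    {d : α → Fin m → ℝ} {y : α → ℝ} (hd : Measurable d) (hy : Measurable y) :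
    MeasurableSet {a | L.Acc u (d a) (y a)} := by
  have h1 : Measurable fun a => L.est (d a) (y a) := by
    unfold Learner.est
    exact measurable_const.min ((Nat.measurable_floor).comp ((L.measurable_fit m).comp
      (hd.prodMk hy)))
  have h2 : Measurable fun a => rank (d a) (y a) := by
    simp only [rank_eq_countVec]
    exact measurable_countVec m fun j =>
      measurableSet_lt ((measurable_pi_apply j).comp hd) hy
  exact (measurableSet_le h1 (h2.add_const _)).inter (measurableSet_le h2 (h1.add_const _))

theorem rank_rescale {m : ℕ} {a b : ℝ} (hab : a < b) (d : Fin m → ℝ) (y : ℝ) :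
    rank (fun j => rescale a b (d j)) (rescale a b y) = rank d y := by
  unfold rank rescale
  congr 1
  ext j
  simp only [Finset.mem_filter, Finset.mem_univ, true_and]
  rw [div_lt_div_iff_of_pos_right (sub_pos.2 hab), sub_lt_sub_iff_right]

/-- The model of a bucket errs at the key `q`. -/
def errEvent (n : ℕ) (L : Learner) (u lo hi q : ℕ) : Set (Fin n → ℝ) :=
  hitEvent (others n {lo, hi, q}) (fun A => ivl A lo hi) (u ^ 5) fun A =>
    {d | (keyAt A lo ∈ Icc (0 : ℝ) 1 ∧ keyAt A hi ∈ Icc (0 : ℝ) 1 ∧ keyAt A q ∈ ivl A lo hi) ∧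
      ¬ L.Acc u (fun j => rescale (keyAt A lo) (keyAt A hi) (d j))
        (rescale (keyAt A lo) (keyAt A hi) (keyAt A q))}

/-- Too many of the first `c` keys of a bucket lie in an interval that contains few of the keys of
the sample. -/
def largeEvent (n : ℕ) (K u lo hi lo' hi' c : ℕ) : Set (Fin n → ℝ) :=
  hitEvent (others n {lo, hi, lo', hi'}) (fun A => ivl A lo hi) c fun A =>
    {d | countVec (· ∈ ivl A lo' hi') (u ^ 5 - 2) d ≤ u ^ 3 ∧
      8 * K * u ^ 8 < countVec (· ∈ ivl A lo' hi') c d}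

theorem others_nodup (s : Finset ℕ) : (others n s).Nodup := (List.nodup_finRange n).filter _

theorem notMem_of_mem_others {s : Finset ℕ} {i : Fin n} (h : i ∈ others n s) :
    i ∉ Finset.univ.filter (fun i : Fin n => (i : ℕ) ∈ s) := by
  simpa [others] using h

/-- On a null set `cond` is the zero measure, and so are its powers of positive dimension; null
intervals then give no contribution. -/
theorem cond_eq_zero_or_isProbabilityMeasure (χ : Measure ℝ) [IsProbabilityMeasure χ] (I : Set ℝ) :
    (χ I = 0 ∧ ProbabilityTheory.cond χ I = 0) ∨
      (χ I ≠ 0 ∧ IsProbabilityMeasure (ProbabilityTheory.cond χ I)) := by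
  by_cases h : χ I = 0
  · exact .inl ⟨h, by rw [ProbabilityTheory.cond, Measure.restrict_eq_zero.2 h, smul_zero]⟩
  · exact .inr ⟨h, cond_isProbabilityMeasure h⟩

theorem pi_zero_apply {m : ℕ} (hm : 0 < m) (B : Set (Fin m → ℝ)) :
    (Measure.pi fun _ : Fin m => (0 : Measure ℝ)) B = 0 := by
  refine measure_mono_null (subset_univ B) ?_
  rw [Measure.pi_univ]
  exact Finset.prod_eq_zero (Finset.mem_univ ⟨0, hm⟩) (by simp)

/-- Given the entries at `lo`, `hi` and `q`, the sample consists of independent draws from the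
conditional law on the interval; rescaling moves this law into `condClosure X` and the statement to
that of `Learner.Learns.accurate`. -/
theorem measure_errEvent_le {L : Learner} {κ₁ κ₂ : ℝ} (hκ₁ : 0 < κ₁)
    {X : Set (ProbabilityMeasure ℝ)} {T S B : ℕ → ℝ} (hL : L.Learns κ₁ κ₂ (condClosure X) T S B)
    {χ : ProbabilityMeasure ℝ} (hχ : χ ∈ X) {u lo hi q : ℕ} (hu : 2 ≤ u) :
    (Measure.pi fun _ : Fin n => (χ : Measure ℝ)) (errEvent n L u lo hi q) ≤
      ENNReal.ofReal (failAcc κ₁ κ₂ u) := by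
  refine measure_hitEvent_le (χ : Measure ℝ)
    (Finset.univ.filter fun i : Fin n => (i : ℕ) ∈ ({lo, hi, q} : Finset ℕ)) _ (others_nodup _)
    (fun i => notMem_of_mem_others) (measurableSet_ivl measurable_fst measurable_snd lo hi) ?_ ?_ ?_
    fun A => ?_
  · have k1 : ∀ i, Measurable fun p : (Fin n → ℝ) × (Fin (u ^ 5) → ℝ) => keyAt p.1 i :=
      fun i => (measurable_keyAt i).comp measurable_fst
    refine ((k1 lo measurableSet_Icc).inter ((k1 hi measurableSet_Icc).inter
      (measurableSet_ivl measurable_fst (k1 q) lo hi))).inter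
      (L.measurableSet_acc u ?_ ?_).compl
    · refine measurable_pi_lambda _ fun j => ?_
      exact (((measurable_pi_apply j).comp measurable_snd).sub (k1 lo)).div ((k1 hi).sub (k1 lo))
    · exact ((k1 q).sub (k1 lo)).div ((k1 hi).sub (k1 lo))
  · intro A A' h
    exact ivl_congr (keyAt_congr h (by simp)) (keyAt_congr h (by simp))
  · intro A A' h
    rw [keyAt_congr h (i := lo) (by simp), keyAt_congr h (i := hi) (by simp),
      keyAt_congr h (i := q) (by simp), ivl_congr (keyAt_congr h (i := lo) (by simp))
      (keyAt_congr h (i := hi) (by simp))]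
  by_cases hA : keyAt A lo ∈ Icc (0 : ℝ) 1 ∧ keyAt A hi ∈ Icc (0 : ℝ) 1 ∧ keyAt A q ∈ ivl A lo hi
  swap
  · exact (measure_mono_null (fun d hd => (hA hd.1).elim) measure_empty).trans_le zero_le
  obtain ⟨h0, h1, hq⟩ := hA
  obtain ⟨hab, hqab⟩ := lt_of_mem_ivl hq
  set a := keyAt A lo with ha
  set b := keyAt A hi with hb
  rcases cond_eq_zero_or_isProbabilityMeasure (χ : Measure ℝ) (ivl A lo hi) with ⟨-, h2⟩ | ⟨h2, h3⟩
  · rw [h2, pi_zero_apply (pow_pos (by omega) 5)]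
    exact zero_le
  have hres : Measurable (rescale a b) := (measurable_id.sub_const a).div_const (b - a)
  have hν : IsProbabilityMeasure ((ProbabilityTheory.cond (χ : Measure ℝ) (ivl A lo hi)).map
      (rescale a b)) := Measure.isProbabilityMeasure_map hres.aemeasurable
  have hmem : (⟨_, hν⟩ : ProbabilityMeasure ℝ) ∈ condClosure X := by
    refine ⟨χ, hχ, a, b, ivl A lo hi, h0.1, hab, h1.2, ?_, ?_, h2, rfl⟩
    · intro y hy
      exact ⟨⟨h0.1.trans hy.1.le, hy.2.le.trans h1.2⟩, .inr hy.1, .inr hy.2⟩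
    · intro y hy
      exact (lt_of_mem_ivl hy).2
  have key := hL.accurate hκ₁ hmem hu (rescale_mem hqab)
  refine le_trans ?_ key
  have hpi := Measure.pi_map_pi (ι := Fin (u ^ 5))
    (μ := fun _ => ProbabilityTheory.cond (χ : Measure ℝ) (ivl A lo hi))
    (f := fun _ => rescale a b) fun _ => hres.aemeasurable
  change _ ≤ (Measure.pi fun _ : Fin (u ^ 5) =>
    (ProbabilityTheory.cond (χ : Measure ℝ) (ivl A lo hi)).map (rescale a b)) _
  rw [← hpi]
  -- For this inequality, the image measure may be evaluated without measurability of the event.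
  exact (measure_mono fun d hd => hd.2).trans (Measure.le_map_apply (measurable_pi_lambda _ fun j =>
    hres.comp (measurable_pi_apply j)).aemeasurable _)

theorem measure_largeEvent_le (χ : Measure ℝ) [IsProbabilityMeasure χ]
    {K u lo hi lo' hi' c : ℕ} (hu : 2 ≤ u) (hK : 1 ≤ K) (hc : u ^ 5 - 2 ≤ c)
    (hc' : c ≤ K * u ^ 10) :
    (Measure.pi fun _ : Fin n => χ) (largeEvent n K u lo hi lo' hi' c) ≤
      ENNReal.ofReal (Real.exp (-u)) := by
  refine measure_hitEvent_le χ (Finset.univ.filter fun i : Fin n =>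
      (i : ℕ) ∈ ({lo, hi, lo', hi'} : Finset ℕ)) _ (others_nodup _) (fun i => notMem_of_mem_others)
    (measurableSet_ivl measurable_fst measurable_snd lo hi) ?_ ?_ ?_ fun A => ?_
  · have h : ∀ k, Measurable fun p : (Fin n → ℝ) × (Fin c → ℝ) =>
        countVec (· ∈ ivl p.1 lo' hi') k p.2 := fun k =>
      measurable_countVec k fun j => measurableSet_ivl measurable_fst
        ((measurable_pi_apply j).comp measurable_snd) lo' hi'
    exact (measurableSet_le (h _) measurable_const).inter (measurableSet_lt measurable_const (h _))
  · intro A A' h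
    exact ivl_congr (keyAt_congr h (by simp)) (keyAt_congr h (by simp))
  · intro A A' h
    rw [ivl_congr (keyAt_congr h (i := lo') (by simp)) (keyAt_congr h (i := hi') (by simp))]
  have hc0 : 0 < c := by
    have : 2 ^ 5 ≤ u ^ 5 := Nat.pow_le_pow_left hu 5
    omega
  rcases cond_eq_zero_or_isProbabilityMeasure χ (ivl A lo hi) with ⟨-, h2⟩ | ⟨-, h3⟩
  · rw [h2, pi_zero_apply hc0]
    exact zero_le
  · exact measure_large_child_le _ (measurableSet_ivl measurable_const measurable_id lo' hi') hu hK
      hc hc'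

end events

/-! ### Typical arrays -/

theorem take_filter_of_forall {α : Type*} {p : α → Bool} {l : List α} {m : ℕ} (hm : m ≤ l.length)
    (h : ∀ x ∈ l.take m, p x) : m ≤ (l.filter p).length ∧ (l.filter p).take m = l.take m := by
  have h1 : l.filter p = l.take m ++ (l.drop m).filter p := by
    conv_lhs => rw [← List.take_append_drop m l, List.filter_append, List.filter_eq_self.2 h]
  have h2 : (l.take m).length = m := List.length_take_of_le hm
  rw [h1]
  refine ⟨by rw [List.length_append, h2]; omega, ?_⟩
  rw [List.take_append_of_le_length h2.ge, List.take_of_length_le h2.le]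

theorem length_filter_notMem_ge {l : List ℕ} (hl : l.Nodup) (s : Finset ℕ) :
    l.length ≤ (l.filter (· ∉ s)).length + s.card := by
  classical
  have h := List.length_eq_length_filter_add (l := l) (fun x => decide (x ∉ s))
  rw [h]
  refine Nat.add_le_add_left ?_ _
  have hnd : (l.filter fun x => !decide (x ∉ s)).Nodup := hl.filter _
  rw [← List.toFinset_card_of_nodup hnd]
  refine Finset.card_le_card fun x hx => ?_
  simpa using (List.mem_filter.1 (List.mem_toFinset.1 hx)).2

section typical
variable {n c : ℕ} {L : Learner} {A : Fin n → ℝ}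

theorem key_mem_Icc (hA : ∀ i, A i ∈ Icc (0 : ℝ) 1) (i : ℕ) : keyAt A i ∈ Icc (0 : ℝ) 1 := by
  unfold keyAt
  split_ifs
  · exact hA _
  · simp
  · simp

theorem mem_ivl_iff (hA : ∀ i, A i ∈ Icc (0 : ℝ) 1) {lo hi x : ℕ} :
    keyAt A x ∈ ivl A lo hi ↔ (envOf c L A).Between lo hi x :=
  and_iff_right (key_mem_Icc hA x)

/-- The bridge between the random experiment and the algorithm: hits at untested positions are the
entries of a bucket, in the same order, except for those at tested positions. -/
theorem hitVals_others (hA : ∀ i, A i ∈ Icc (0 : ℝ) 1) (s : Finset ℕ) (lo hi : ℕ) :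
    hitVals (others n s) (ivl A lo hi) A =
      (((envOf c L A).elems lo hi).filter (· ∉ s)).map (keyAt A) := by
  classical
  have h0 : ∀ i : Fin n, keyAt A i = A i := fun i => by simp [keyAt]
  have h2 : (envOf c L A).elems lo hi =
      ((List.finRange n).map fun i : Fin n => (i : ℕ)).filter fun x =>
        decide ((envOf c L A).Between lo hi x) := by
    rw [List.map_coe_finRange_eq_range]
    unfold Env.elems
    congr!
  rw [h2, List.filter_map, List.filter_map, List.map_map, hitVals, List.filter_map, others,
    List.filter_filter, List.filter_filter]
  have h3 : (keyAt A ∘ fun i : Fin n => (i : ℕ)) = A := funext h0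
  rw [h3]
  congr 1
  refine List.filter_congr fun i _ => ?_
  have h4 := mem_ivl_iff (c := c) (L := L) hA (lo := lo) (hi := hi) (x := i)
  rw [h0] at h4
  simp only [Function.comp, Bool.and_comm, h4]

theorem listVec_map {l : List ℕ} {m : ℕ} (hm : m ≤ l.length) :
    listVec (l.map (keyAt A)) m = fun j : Fin m => keyAt A (l.getD j 0) := by
  funext j
  have h : (j : ℕ) < l.length := j.2.trans_le hm
  rw [listVec, List.getD_eq_getElem _ _ (by simpa using h), List.getD_eq_getElem _ _ h,
    List.getElem_map]

/-- The bounds of a bucket are strict, so the conditioning on them does not touch its entries. -/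
theorem notMem_elems {E : Env} {lo hi x : ℕ} (hv : E.Valid lo hi) (h : x ∈ E.elems lo hi) :
    x ≠ lo ∧ x ≠ hi := by
  obtain ⟨h1, h2, h3⟩ := Env.mem_elems.1 h
  refine ⟨?_, ?_⟩
  · rintro rfl
    exact h2.elim (fun h => by omega) (lt_irrefl _)
  · rintro rfl
    exact h3.elim (fun h => by omega) (lt_irrefl _)

-- The sample contains neither the end points, by strictness, nor `q`, which comes after it in the
-- bucket. So the sample is precisely the vector of the first `u ^ 5` hits at the other positions.
open Classical in
theorem accurate_of_notMem (hA : ∀ i, A i ∈ Icc (0 : ℝ) 1) {u lo hi q : ℕ}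
    (hv : (envOf c L A).Valid lo hi) (hu : u ^ 5 ≤ ((envOf c L A).elems lo hi).length)
    (hq : q ∈ ((envOf c L A).elems lo hi).drop (u ^ 5)) (h : A ∉ errEvent n L u lo hi q) :
    (envOf c L A).est ((envOf c L A).bucketModel lo hi ((envOf c L A).elems lo hi) (u ^ 5)) q ≤
      (((envOf c L A).elems lo hi).take (u ^ 5)).countP
        (fun y => (envOf c L A).key y < (envOf c L A).key q) + 3 * u ^ 3 ∧
    (((envOf c L A).elems lo hi).take (u ^ 5)).countP
        (fun y => (envOf c L A).key y < (envOf c L A).key q) ≤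
      (envOf c L A).est ((envOf c L A).bucketModel lo hi ((envOf c L A).elems lo hi) (u ^ 5)) q +
        3 * u ^ 3 := by
  set E := envOf c L A with hE
  have hqm : q ∈ E.elems lo hi := List.mem_of_mem_drop hq
  have hqI : keyAt A q ∈ ivl A lo hi := (mem_ivl_iff (c := c) (L := L) hA).2 (Env.mem_elems.1 hqm).2
  have hnd : (E.elems lo hi).Nodup := Env.elems_nodup
  have htake : ∀ x ∈ (E.elems lo hi).take (u ^ 5), decide (x ∉ ({lo, hi, q} : Finset ℕ)) = true := by
    intro x hx
    have h1 := notMem_elems hv (List.mem_of_mem_take hx)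
    have h2 : x ≠ q := by
      rintro rfl
      rw [← List.take_append_drop (u ^ 5) (E.elems lo hi)] at hnd
      exact (List.nodup_append.1 hnd).2.2 _ hx _ hq rfl
    simp [h1, h2]
  obtain ⟨h1, h2⟩ := take_filter_of_forall hu htake
  have h3 : listVec (hitVals (others n {lo, hi, q}) (ivl A lo hi) A) (u ^ 5) =
      fun j : Fin (u ^ 5) => keyAt A ((E.elems lo hi).getD j 0) := by
    rw [hitVals_others (c := c) (L := L) hA, listVec_map h1]
    funext j
    congr 1
    have := congrArg (fun l => l.getD (j : ℕ) 0) h2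
    simpa [List.getD_eq_getElem?_getD, List.getElem?_take, j.2] using this
  have h4 : u ^ 5 ≤ (hitVals (others n {lo, hi, q}) (ivl A lo hi) A).length := by
    rw [hitVals_others (c := c) (L := L) hA, List.length_map]; exact h1
  rw [errEvent, mem_hitEvent] at h
  have h5 := not_not.1 fun h6 => h ⟨h4, ⟨⟨key_mem_Icc hA _, key_mem_Icc hA _, hqI⟩, h6⟩⟩
  have hlt := (lt_of_mem_ivl hqI).1
  rw [Learner.Acc, rank_rescale hlt, rank_eq_countVec, countVec_listVec _ le_rfl h4] at h5
  rw [h3, hitVals_others (c := c) (L := L) hA, ← List.map_take, h2, List.countP_map] at h5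
  exact h5

-- Unlike `lo` and `hi`, the end points `lo'` and `hi'` may be entries of the sample; removing them
-- shifts at most two further entries into its range, whence the `u ^ 5 - 2`. The child itself loses
-- nothing, as it contains none of the four.
open Classical in
theorem length_child_of_notMem (hA : ∀ i, A i ∈ Icc (0 : ℝ) 1) {K u lo hi lo' hi' : ℕ}
    (hv : (envOf c L A).Valid lo hi) (hv' : (envOf c L A).Valid lo' hi')
    (hu : u ^ 5 ≤ ((envOf c L A).elems lo hi).length)
    (hK : ((envOf c L A).elems lo hi).length ≤ K * u ^ 10)
    (hsub : ∀ x < n, (envOf c L A).Between lo' hi' x → (envOf c L A).Between lo hi x)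
    (hcount : (((envOf c L A).elems lo hi).take (u ^ 5)).countP
      (fun x => (envOf c L A).Between lo' hi' x) ≤ u ^ 3)
    (h : ∀ c', u ^ 5 - 2 ≤ c' → c' ≤ n → c' ≤ K * u ^ 10 → A ∉ largeEvent n K u lo hi lo' hi' c') :
    ((envOf c L A).elems lo' hi').length ≤ 8 * K * u ^ 8 := by
  set E := envOf c L A with hE
  set els := E.elems lo hi with hels
  set s : Finset ℕ := {lo, hi, lo', hi'} with hs
  have hnd : els.Nodup := Env.elems_nodup
  have hsame : els.filter (· ∉ s) = els.filter (· ∉ ({lo', hi'} : Finset ℕ)) :=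
    List.filter_congr fun x hx => by
      have := notMem_elems hv hx
      simp [hs, this]
  have hlen : els.length ≤ (els.filter (· ∉ s)).length + 2 := by
    rw [hsame]
    exact (length_filter_notMem_ge hnd _).trans (Nat.add_le_add_left Finset.card_le_two _)
  have htake : (els.take (u ^ 5)).length ≤ ((els.take (u ^ 5)).filter (· ∉ s)).length + 2 := by
    have h1 : (els.take (u ^ 5)).filter (· ∉ s) =
        (els.take (u ^ 5)).filter (· ∉ ({lo', hi'} : Finset ℕ)) :=
      List.filter_congr fun x hx => by
        have := notMem_elems hv (List.mem_of_mem_take hx)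
        simp [hs, this]
    rw [h1]
    exact (length_filter_notMem_ge (hnd.sublist (List.take_sublist _ _)) _).trans
      (Nat.add_le_add_left Finset.card_le_two _)
  rw [List.length_take_of_le hu] at htake
  set hits := hitVals (others n s) (ivl A lo hi) A with hhits
  have hits_eq : hits = (els.filter (· ∉ s)).map (keyAt A) := hitVals_others (c := c) (L := L) hA _ _ _
  have hlen' : hits.length = (els.filter (· ∉ s)).length := by rw [hits_eq, List.length_map]
  have hle : hits.length ≤ els.length := by rw [hlen']; exact List.length_filter_le _ _
  -- The number of hits depends on the data; this is why `c` is among the indices of the union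
  -- bound.
  have key := h hits.length (by omega) (hle.trans Env.elems_length_le) (hle.trans hK)
  rw [largeEvent, mem_hitEvent] at key
  have key' : ¬ (countVec (· ∈ ivl A lo' hi') (u ^ 5 - 2) (listVec hits hits.length) ≤ u ^ 3 ∧
      8 * K * u ^ 8 < countVec (· ∈ ivl A lo' hi') hits.length (listVec hits hits.length)) :=
    fun h' => key ⟨le_rfl, h'⟩
  rw [countVec_listVec _ (by omega) le_rfl, countVec_listVec _ le_rfl le_rfl, List.take_length,
    hits_eq, ← List.map_take, List.countP_map, List.countP_map] at key'
  have hpred : ((fun y => decide (y ∈ ivl A lo' hi')) ∘ keyAt A) = fun x => decide (E.Between lo' hi' x) := by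
    funext x
    exact decide_eq_decide.2 (mem_ivl_iff (c := c) (L := L) hA)
  rw [hpred] at key'
  have h1 : ((els.filter (· ∉ s)).take (u ^ 5 - 2)).countP (fun x => decide (E.Between lo' hi' x)) ≤
      u ^ 3 := by
    refine le_trans ?_ hcount
    refine List.Sublist.countP_le (List.Sublist.trans ?_ (List.filter_sublist (p := (· ∉ s))))
    have h2 : els.filter (· ∉ s) =
        (els.take (u ^ 5)).filter (· ∉ s) ++ (els.drop (u ^ 5)).filter (· ∉ s) := by
      rw [← List.filter_append, List.take_append_drop]
    rw [h2, List.take_append_of_le_length (by omega)]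
    exact List.take_sublist _ _
  have h2 := not_lt.1 fun h3 => key' ⟨h1, h3⟩
  refine le_trans (le_of_eq ?_) h2
  rw [hels, Env.elems, Env.elems, ← List.countP_eq_length_filter, List.countP_filter,
    List.countP_filter]
  refine List.countP_congr fun x hx => ?_
  have hx' : x < n := List.mem_range.1 hx
  simp only [decide_eq_true_eq, Bool.and_eq_true]
  refine ⟨fun h3 => ⟨⟨h3, ?_⟩, hsub x hx' h3⟩, fun h3 => h3.1.1⟩
  have h4 := notMem_elems hv (Env.mem_elems.2 ⟨hx', hsub x hx' h3⟩)
  have h5 := notMem_elems hv' (Env.mem_elems.2 ⟨hx', h3⟩)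
  simp [hs, h4, h5]

end typical

/-! ### Parameters for typical and for arbitrary runs. -/

theorem root_mono {a b : ℕ} (h : a ≤ b) : root a ≤ root b := le_root ((root_pow_le a).trans h)

theorem next_mono {a b : ℕ} (h : a ≤ b) : next a ≤ next b :=
  root_mono (Nat.pow_le_pow_left h 8)

theorem levels_mono (thr : ℕ) {a b : ℕ} (h : a ≤ b) : levels thr a ≤ levels thr b := by
  induction a using Nat.strong_induction_on generalizing b with
  | _ a ih =>
    by_cases ha : 2 ≤ a ∧ thr ≤ a
    · rw [levels_of_le ha.1 ha.2, levels_of_le (ha.1.trans h) (ha.2.trans h)]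
      exact Nat.add_le_add_right (ih _ (next_lt ha.1) (next_mono h)) 1
    · rw [levels, dif_neg ha]
      exact Nat.zero_le _

theorem pow_eight_le_next {u : ℕ} (hu : 1 ≤ u) : u ^ 8 ≤ 2 ^ 10 * next u ^ 10 := by
  have h1 := lt_root_succ_pow (u ^ 8)
  have h2 := one_le_next hu
  calc u ^ 8 ≤ (next u + 1) ^ 10 := h1.le
    _ ≤ (2 * next u) ^ 10 := Nat.pow_le_pow_left (by omega) 10
    _ = _ := mul_pow _ _ _

/-- The number of levels of the recursion. -/
def depth (n : ℕ) : ℕ := levels (threshold n) (root n)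

/-- Buckets of level `u` have at most `slack n u * u ^ 10` entries. -/
def slack (n u : ℕ) : ℕ := 2 ^ (13 * (depth n - levels (threshold n) u) + 10)

/-- The parameters in typical runs; those in all other runs have `b = false`. -/
noncomputable def params (T S B : ℕ → ℝ) (n : ℕ) (b : Bool) : Params where
  thr := threshold n
  T := ⌊T (Nat.sqrt n)⌋₊
  w := if b then 3 else n
  ℓ := if b then 13 * depth n + 10 + 10 * Nat.clog 2 (threshold n) else n
  SS := ⌊S (Nat.sqrt n)⌋₊
  TB := fun u => ⌊((u ^ 5 : ℕ) : ℝ) * B (u ^ 5)⌋₊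
  Sz := fun u => if b then slack n u * u ^ 10 else n

/-- The event that a model errs or that a bucket is too large. -/
def badEvent (n : ℕ) (L : Learner) : Set (Fin n → ℝ) :=
  ⋃ u ∈ Finset.Icc (threshold n) (root n), ⋃ lo ∈ Finset.range (n + 2), ⋃ hi ∈ Finset.range (n + 2),
    (⋃ q ∈ Finset.range (n + 2), errEvent n L u lo hi q) ∪
    ⋃ lo' ∈ Finset.range (n + 2), ⋃ hi' ∈ Finset.range (n + 2),
      ⋃ c ∈ (Finset.range (n + 2)).filter fun c => u ^ 5 - 2 ≤ c ∧ c ≤ slack n u * u ^ 10,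
        largeEvent n (slack n u) u lo hi lo' hi' c

theorem pow_five_le_sqrt {u n : ℕ} (h : u ≤ root n) : u ^ 5 ≤ Nat.sqrt n := by
  rw [Nat.le_sqrt]
  calc u ^ 5 * u ^ 5 = u ^ 10 := by ring
    _ ≤ root n ^ 10 := Nat.pow_le_pow_left h 10
    _ ≤ n := root_pow_le n

theorem two_le_threshold (n : ℕ) : 2 ≤ threshold n := by
  unfold threshold
  nlinarith [Nat.zero_le (Nat.clog 2 n)]

section regimes
variable {n c : ℕ} {L : Learner} {A : Fin n → ℝ} {κ₁ κ₂ : ℝ} {X : Set (ProbabilityMeasure ℝ)}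
  {T S B : ℕ → ℝ}

theorem bucketModel_mem (hA : ∀ i, A i ∈ Icc (0 : ℝ) 1) {lo hi m : ℕ}
    (hm : m ≤ ((envOf c L A).elems lo hi).length) (j : Fin m) :
    ((envOf c L A).bucketModel lo hi ((envOf c L A).elems lo hi) m).D j ∈ Icc (0 : ℝ) 1 := by
  refine rescale_mem (lt_of_mem_ivl ((mem_ivl_iff (c := c) (L := L) hA).2 (Env.mem_elems.1 ?_).2)).2
  rw [List.getD_eq_getElem _ _ (j.2.trans_le hm)]
  exact List.getElem_mem _

/-- A level loses a factor 8 by `largeEvent` and `2 ^ 10` by rounding the root, together `2 ^ 13`.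
The loss over all levels matters only through its logarithm, which is proportional to `depth n`. -/
theorem slack_mul_le {u : ℕ} (hu : threshold n ≤ u) (h : u ≤ root n) :
    8 * slack n u * u ^ 8 ≤ slack n (next u) * next u ^ 10 := by
  have h2 := (two_le_threshold n).trans hu
  have h3 := levels_of_le h2 hu
  have h4 : levels (threshold n) u ≤ depth n := levels_mono _ h
  have h5 : slack n (next u) = 2 ^ 13 * slack n u := by
    rw [slack, slack, ← pow_add]
    congr 1
    omega
  calc 8 * slack n u * u ^ 8 ≤ 8 * slack n u * (2 ^ 10 * next u ^ 10) :=
        Nat.mul_le_mul_left _ (pow_eight_le_next (by omega))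
    _ = _ := by rw [h5]; ring

/-- Costs of the learner are bounded on every array, because samples have at most `√n` keys,
rescaled to `[0, 1]`. Only accuracy and sizes depend on luck; without it, the trivial bound `n`
serves for the deviation, the sizes and the logarithms. -/
theorem regime_params (hA : ∀ i, A i ∈ Icc (0 : ℝ) 1) (hT : Monotone T) (hS : Monotone S)
    (hL : L.Learns κ₁ κ₂ X T S B) (b : Bool) (hb : b = true → A ∉ badEvent n L) :
    Regime (envOf c L A) (params T S B n b) := by
  have hpos : ∀ {u}, threshold n ≤ u → 1 ≤ u ^ 5 := fun h =>
    Nat.one_le_pow _ _ (by have := two_le_threshold n; omega)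
  refine ⟨two_le_threshold n, ?_, ?_, ?_, ?_, ?_, ?_, ?_, ?_⟩
  · intro u lo hi hu hun hv hlen x hx
    refine Nat.le_floor ((hL.inference _ (hpos hu) _ (bucketModel_mem hA hlen) _ ?_).trans
      (hT (pow_five_le_sqrt hun)))
    exact rescale_mem (lt_of_mem_ivl ((mem_ivl_iff (c := c) (L := L) hA).2 (Env.mem_elems.1 hx).2)).2
  · intro u lo hi hu hun hv hlen
    exact Nat.le_floor (hL.training _ (hpos hu) _ (bucketModel_mem hA hlen))
  · intro u lo hi hu hun hv hlen
    exact Nat.le_floor ((hL.space _ (hpos hu) _ (bucketModel_mem hA hlen)).trans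
      (hS (pow_five_le_sqrt hun)))
  · intro u lo hi hu hun hv hlen x hx
    have hxn : x < n := (Env.mem_elems.1 (List.mem_of_mem_drop hx)).1
    cases b with
    | true =>
      refine accurate_of_notMem hA hv hlen hx fun h => hb rfl ?_
      have h1 : lo < n + 2 := by have := hv.1; change lo ≤ n at this; omega
      have h2 : hi < n + 2 := by have := hv.2; change hi < n ∨ hi = n + 1 at this; omega
      simp only [badEvent, mem_iUnion]
      exact ⟨u, Finset.mem_Icc.2 ⟨hu, hun⟩, lo, Finset.mem_range.2 h1, hi, Finset.mem_range.2 h2,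
        .inl (mem_iUnion₂.2 ⟨x, Finset.mem_range.2 (by omega), h⟩)⟩
    | false =>
      -- Estimates and ranks are at most the sample size, so a deviation of `n` cells is never
      -- exceeded.
      have h5 : u ^ 5 ≤ n := hlen.trans Env.elems_length_le
      have h6 : n ≤ n * u ^ 3 := Nat.le_mul_of_pos_right _ (Nat.pos_of_ne_zero (by
        have := two_le_threshold n
        have : 2 ≤ u := this.trans hu
        positivity))
      refine ⟨?_, ?_⟩
      · exact ((min_le_left _ _).trans h5).trans (h6.trans (Nat.le_add_left _ _))
      · refine (List.countP_le_length.trans ?_).trans (h6.trans (Nat.le_add_left _ _))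
        rw [List.length_take]
        exact (min_le_left _ _).trans h5
  · cases b with
    | true =>
      change n ≤ slack n (root n) * root n ^ 10
      rcases Nat.eq_zero_or_pos n with rfl | hn
      · exact Nat.zero_le _
      have h1 := lt_root_succ_pow n
      have h2 : 1 ≤ root n := le_root (by rw [one_pow]; exact hn)
      rw [slack, depth, Nat.sub_self]
      calc n ≤ (root n + 1) ^ 10 := h1.le
        _ ≤ (2 * root n) ^ 10 := Nat.pow_le_pow_left (by omega) 10
        _ = _ := by rw [mul_pow]
    | false => exact le_rfl
  · intro u hu hun
    have hu' : threshold n ≤ u := hu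
    have h2 := (two_le_threshold n).trans hu'
    have hun' : u ≤ root n := hun
    cases b with
    | true =>
      change u ^ 5 ≤ slack n (next u) * next u ^ 10
      refine le_trans ?_ (slack_mul_le hu' hun')
      refine (Nat.pow_le_pow_right (by omega) (show 5 ≤ 8 by norm_num)).trans
        (Nat.le_mul_of_pos_left _ ?_)
      have : 0 < slack n u := Nat.two_pow_pos _
      omega
    | false =>
      exact (pow_five_le_sqrt hun').trans (Nat.sqrt_le_self n)
  · intro u lo hi lo' hi' hu hun hv hv' hlen hsz hsub hcount
    have hu' : threshold n ≤ u := hu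
    have hun' : u ≤ root n := hun
    cases b with
    | true =>
      refine (length_child_of_notMem hA hv hv' hlen hsz hsub hcount fun c' h1 h2 h3 h4 =>
        hb rfl ?_).trans (slack_mul_le hu' hun')
      have k1 : lo < n + 2 := by have := hv.1; change lo ≤ n at this; omega
      have k2 : hi < n + 2 := by have := hv.2; change hi < n ∨ hi = n + 1 at this; omega
      have k3 : lo' < n + 2 := by have := hv'.1; change lo' ≤ n at this; omega
      have k4 : hi' < n + 2 := by have := hv'.2; change hi' < n ∨ hi' = n + 1 at this; omega
      simp only [badEvent, mem_iUnion]
      refine ⟨u, Finset.mem_Icc.2 ⟨hu, hun⟩, lo, Finset.mem_range.2 k1, hi, Finset.mem_range.2 k2,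
        .inr ?_⟩
      simp only [mem_iUnion]
      exact ⟨lo', Finset.mem_range.2 k3, hi', Finset.mem_range.2 k4, c',
        Finset.mem_filter.2 ⟨Finset.mem_range.2 (by omega), h1, h3⟩, h4⟩
    | false => exact Env.elems_length_le
  · intro u h1 hu hun
    have hu' : u < threshold n := hu
    cases b with
    | true =>
      refine Nat.clog_le_of_le_pow ?_
      change slack n u * u ^ 10 ≤ 2 ^ (13 * depth n + 10 + 10 * Nat.clog 2 (threshold n))
      rw [pow_add, mul_comm 10 (Nat.clog 2 _), pow_mul]
      refine Nat.mul_le_mul (Nat.pow_le_pow_right (by norm_num) (by omega)) (Nat.pow_le_pow_left ?_ 10)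
      exact hu'.le.trans (Nat.le_pow_clog (by norm_num) _)
    | false =>
      exact Nat.clog_le_of_le_pow Nat.lt_two_pow_self.le

end regimes

theorem measure_biUnion_le_card_mul {α ι : Type*} [MeasurableSpace α] (μ : Measure α)
    {s : Finset ι} {f : ι → Set α} {N : ℕ} {ε : ℝ≥0∞} (hs : s.card ≤ N)
    (h : ∀ i ∈ s, μ (f i) ≤ ε) : μ (⋃ i ∈ s, f i) ≤ N * ε := by
  refine (measure_biUnion_finset_le s f).trans ((Finset.sum_le_card_nsmul s _ ε h).trans ?_)
  rw [nsmul_eq_mul]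
  gcongr

/-- Completing the square: `7 * x - κ * x ^ 2` is at most `49 / (4 * κ)`. Of the seven powers of
`n`, six pay for the union bound and one for the excess time of bad runs. -/
theorem exp_neg_sq_le {κ x : ℝ} {n : ℕ} (hκ : 0 < κ) (hn : 1 ≤ n) (hx : Real.log n ≤ x) :
    Real.exp (-(κ * x ^ 2)) ≤ Real.exp (49 / (4 * κ)) / (n : ℝ) ^ 7 := by
  have hn' : (0 : ℝ) < n := by exact_mod_cast hn
  rw [le_div_iff₀ (by positivity), ← Real.exp_log hn', ← Real.exp_nat_mul, ← Real.exp_add,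
    Real.exp_le_exp]
  have h1 : 0 ≤ κ * (x - 7 / (2 * κ)) ^ 2 := by positivity
  have h2 : κ * (x - 7 / (2 * κ)) ^ 2 = κ * x ^ 2 - 7 * x + 49 / (4 * κ) := by
    field_simp
    ring
  push_cast
  linarith

theorem log_le_clog (n : ℕ) : Real.log n ≤ Nat.clog 2 n := by
  rcases Nat.eq_zero_or_pos n with rfl | hn
  · simp
  have h1 : (n : ℝ) ≤ 2 ^ Nat.clog 2 n := by exact_mod_cast Nat.le_pow_clog (by norm_num) n
  calc Real.log n ≤ Real.log (2 ^ Nat.clog 2 n) := Real.log_le_log (by exact_mod_cast hn) h1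
    _ = Nat.clog 2 n * Real.log 2 := Real.log_pow _ _
    _ ≤ Nat.clog 2 n * 1 := by
        gcongr
        linarith [Real.log_two_lt_d9]
    _ = _ := mul_one _

/-- A bound for `n` times the probability of atypical arrays. -/
noncomputable def failConst (κ₁ κ₂ : ℝ) : ℝ :=
  1458 * (κ₁ * Real.exp (49 / (4 * κ₂)) + 2 * Real.exp (49 / 4))

/-- The reason for the threshold: from `(Nat.clog 2 n + 2) ^ 2 ≤ u` it follows that `√u - 1` exceeds
`log n`, so the exponents are quadratic in `log n`. -/
theorem failAcc_le {κ₁ κ₂ : ℝ} (hκ₁ : 0 < κ₁) (hκ₂ : 0 < κ₂) {n u : ℕ} (hn : 1 ≤ n)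
    (hu : threshold n ≤ u) : failAcc κ₁ κ₂ u ≤
      (κ₁ * Real.exp (49 / (4 * κ₂)) + 2 * Real.exp (49 / 4)) / (n : ℝ) ^ 7 ∧
    Real.exp (-u) ≤ (κ₁ * Real.exp (49 / (4 * κ₂)) + 2 * Real.exp (49 / 4)) / (n : ℝ) ^ 7 := by
  have hn' : (0 : ℝ) < n := by exact_mod_cast hn
  set ℓ : ℝ := ((Nat.clog 2 n : ℕ) : ℝ) with hℓ
  have hℓ0 : 0 ≤ ℓ := Nat.cast_nonneg _
  have hu' : (ℓ + 2) ^ 2 ≤ (u : ℝ) := by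
    have : ((threshold n : ℕ) : ℝ) ≤ u := by exact_mod_cast hu
    simpa [threshold] using this
  have hsq : ℓ + 2 ≤ Real.sqrt u := Real.le_sqrt_of_sq_le hu'
  have h1 := exp_neg_sq_le hκ₂ hn (x := ℓ) (log_le_clog n)
  have h2 := exp_neg_sq_le one_pos hn (x := ℓ) (log_le_clog n)
  rw [one_mul, mul_one] at h2
  have h3 : Real.exp (-(κ₂ * (Real.sqrt u - 1) ^ 2)) ≤ Real.exp (-(κ₂ * ℓ ^ 2)) := by
    rw [Real.exp_le_exp, neg_le_neg_iff]
    have : ℓ ≤ Real.sqrt u - 1 := by linarith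
    gcongr
  have h4 : Real.exp (-(u : ℝ)) ≤ Real.exp (-(ℓ ^ 2)) := by
    rw [Real.exp_le_exp, neg_le_neg_iff]
    nlinarith
  have h5 : Real.exp (-(2 * u : ℝ)) ≤ Real.exp (-(u : ℝ)) := by
    rw [Real.exp_le_exp]
    linarith [(Nat.cast_nonneg u : (0 : ℝ) ≤ u)]
  rw [failAcc, add_div, mul_div_assoc, mul_div_assoc]
  have h6 : 0 ≤ κ₁ * (Real.exp (49 / (4 * κ₂)) / (n : ℝ) ^ 7) := by positivity
  have h7 : 0 ≤ Real.exp (49 / 4) / (n : ℝ) ^ 7 := by positivity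
  refine ⟨add_le_add (mul_le_mul_of_nonneg_left (h3.trans h1) hκ₁.le) ?_, ?_⟩
  · linarith
  · linarith

theorem measure_badEvent_le {L : Learner} {κ₁ κ₂ : ℝ} (hκ₁ : 0 < κ₁) (hκ₂ : 0 < κ₂)
    {X : Set (ProbabilityMeasure ℝ)} {T S B : ℕ → ℝ} (hL : L.Learns κ₁ κ₂ (condClosure X) T S B)
    {χ : ProbabilityMeasure ℝ} (hχ : χ ∈ X) {n : ℕ} (hn : 1 ≤ n) :
    (Measure.pi fun _ : Fin n => (χ : Measure ℝ)) (badEvent n L) ≤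
      ENNReal.ofReal (failConst κ₁ κ₂ / n) := by
  set e := (κ₁ * Real.exp (49 / (4 * κ₂)) + 2 * Real.exp (49 / 4)) / (n : ℝ) ^ 7 with he
  have he0 : 0 ≤ e := by positivity
  set ε := ENNReal.ofReal e with hε
  set N := n + 2 with hN
  have hr : (Finset.range N).card ≤ N := by simp
  have hroot := root_le_self n
  -- Four indices for errors (`u`, `lo`, `hi`, `q`), six for large children (`u`, `lo`, `hi`, `lo'`,
  -- `hi'`, `c`).
  have key : (Measure.pi fun _ : Fin n => (χ : Measure ℝ)) (badEvent n L) ≤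
      N * (N * (N * (N * ε + N * (N * (N * ε))))) := by
    refine measure_biUnion_le_card_mul _ ?_ fun u hu => ?_
    · rw [Nat.card_Icc]; omega
    obtain ⟨hu1, hu2⟩ := Finset.mem_Icc.1 hu
    have h2 := (two_le_threshold n).trans hu1
    obtain ⟨g1, g2⟩ := failAcc_le hκ₁ hκ₂ hn hu1
    refine measure_biUnion_le_card_mul _ hr fun lo hlo => ?_
    refine measure_biUnion_le_card_mul _ hr fun hi hhi => ?_
    refine (measure_union_le _ _).trans (add_le_add ?_ ?_)
    · exact measure_biUnion_le_card_mul _ hr fun q hq =>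
        (measure_errEvent_le hκ₁ hL hχ h2).trans (ENNReal.ofReal_le_ofReal g1)
    · refine measure_biUnion_le_card_mul _ hr fun lo' hlo' => ?_
      refine measure_biUnion_le_card_mul _ hr fun hi' hhi' => ?_
      refine measure_biUnion_le_card_mul _ ((Finset.card_filter_le _ _).trans hr) fun c hc => ?_
      obtain ⟨-, h3, h4⟩ := Finset.mem_filter.1 hc
      exact (measure_largeEvent_le _ h2 (Nat.one_le_two_pow) h3 h4).trans
        (ENNReal.ofReal_le_ofReal g2)
  refine key.trans ?_
  rw [hε, ← ENNReal.ofReal_natCast, ← ENNReal.ofReal_mul (by positivity),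
    ← ENNReal.ofReal_mul (by positivity), ← ENNReal.ofReal_mul (by positivity),
    ← ENNReal.ofReal_add (by positivity) (by positivity), ← ENNReal.ofReal_mul (by positivity),
    ← ENNReal.ofReal_mul (by positivity), ← ENNReal.ofReal_mul (by positivity)]
  refine ENNReal.ofReal_le_ofReal ?_
  have hn' : (1 : ℝ) ≤ n := by exact_mod_cast hn
  have h1 : (N : ℝ) ≤ 3 * n := by push_cast [hN]; linarith
  have h1' : (1 : ℝ) ≤ N := by push_cast [hN]; linarith
  have h2 : (N : ℝ) ^ 6 ≤ (3 * n) ^ 6 := by gcongr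
  have h3 : (N : ℝ) ^ 4 ≤ N ^ 6 := pow_le_pow_right₀ h1' (by norm_num)
  calc (N : ℝ) * (N * (N * (N * e + N * (N * (N * e))))) = (N ^ 4 + N ^ 6) * e := by ring
    _ ≤ (2 * (3 * n) ^ 6) * e := by gcongr; linarith
    _ = failConst κ₁ κ₂ / n := by
        rw [he, failConst]
        field_simp
        ring

/-! ### The order of the running time -/

section numerics
variable {n : ℕ}

/-- A bound for the sizes of the buckets at depth `i`. -/
noncomputable def scale (n i : ℕ) : ℝ := (n : ℝ) ^ ((4 / 5 : ℝ) ^ i)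

/-- The number of terms in `timeBound`. -/
noncomputable def terms (n : ℕ) : ℕ := ⌊Real.logb (5 / 4) (Real.logb 2 n)⌋₊ + 1

theorem scale_pos (hn : 1 ≤ n) (i : ℕ) : 0 < scale n i :=
  Real.rpow_pos_of_pos (by exact_mod_cast hn) _

theorem scale_succ (n i : ℕ) : scale n (i + 1) = scale n i ^ (4 / 5 : ℝ) := by
  rw [scale, scale, ← Real.rpow_mul (by positivity), pow_succ]

/-- Taking logarithms twice: the scale is at least 2 exactly as long as `(5 / 4) ^ i ≤ log_2 n`. -/
theorem lt_terms (hn : 2 ≤ n) {i : ℕ} (h : 2 ≤ scale n i) : i < terms n := by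
  have hn' : (1 : ℝ) < n := by exact_mod_cast hn
  have h1 : 1 ≤ (4 / 5 : ℝ) ^ i * Real.logb 2 n := by
    have := Real.logb_le_logb_of_le (b := 2) (by norm_num) (by norm_num) h
    rwa [Real.logb_self_eq_one (by norm_num), scale, Real.logb_rpow_eq_mul_logb_of_pos (by linarith)]
      at this
  have h2 : (5 / 4 : ℝ) ^ i ≤ Real.logb 2 n := by
    have h3 : (5 / 4 : ℝ) ^ i * (4 / 5 : ℝ) ^ i = 1 := by rw [← mul_pow]; norm_num
    calc (5 / 4 : ℝ) ^ i = (5 / 4 : ℝ) ^ i * 1 := (mul_one _).symm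
      _ ≤ (5 / 4 : ℝ) ^ i * ((4 / 5 : ℝ) ^ i * Real.logb 2 n) := by gcongr
      _ = _ := by rw [← mul_assoc, h3, one_mul]
  have h4 : (i : ℝ) ≤ Real.logb (5 / 4) (Real.logb 2 n) := by
    rw [Real.le_logb_iff_rpow_le (by norm_num) (lt_of_lt_of_le (by positivity) h2)]
    simpa using h2
  exact Nat.lt_succ_of_le (Nat.le_floor h4)

theorem next_pow_le {u i : ℕ} (h : (u : ℝ) ^ 10 ≤ scale n i) : (next u : ℝ) ^ 10 ≤ scale n (i + 1) := by
  have h1 : (next u : ℝ) ^ 10 ≤ (u : ℝ) ^ 8 := by exact_mod_cast root_pow_le (u ^ 8)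
  refine h1.trans ?_
  rw [scale_succ]
  calc (u : ℝ) ^ 8 = ((u : ℝ) ^ 10) ^ (4 / 5 : ℝ) := by
        rw [← Real.rpow_natCast, ← Real.rpow_natCast, ← Real.rpow_mul (by positivity)]
        norm_num
    _ ≤ _ := Real.rpow_le_rpow (by positivity) h (by norm_num)

/-- The fan-out `u ^ 2` is at most the fifth root of the scale, and the scale drops by exactly this
root; hence the number of nodes times the scale does not grow with the depth. -/
theorem sq_mul_scale_le (hn : 1 ≤ n) {u i : ℕ} (h : (u : ℝ) ^ 10 ≤ scale n i) :
    (u : ℝ) ^ 2 * scale n (i + 1) ≤ scale n i := by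
  rw [scale_succ]
  calc (u : ℝ) ^ 2 * scale n i ^ (4 / 5 : ℝ)
      = ((u : ℝ) ^ 10) ^ (1 / 5 : ℝ) * scale n i ^ (4 / 5 : ℝ) := by
        congr 1
        rw [← Real.rpow_natCast, ← Real.rpow_natCast, ← Real.rpow_mul (by positivity)]
        norm_num
    _ ≤ scale n i ^ (1 / 5 : ℝ) * scale n i ^ (4 / 5 : ℝ) := by
        have := scale_pos hn i
        gcongr
    _ = scale n i := by
        rw [← Real.rpow_add (scale_pos hn i)]
        norm_num

theorem two_le_scale {u i : ℕ} (hu : 2 ≤ u) (h : (u : ℝ) ^ 10 ≤ scale n i) : 2 ≤ scale n i := by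
  have h1 : (2 : ℝ) ≤ u := by exact_mod_cast hu
  calc (2 : ℝ) ≤ 2 ^ 10 := by norm_num
    _ ≤ (u : ℝ) ^ 10 := by gcongr
    _ ≤ _ := h

/-- `u ^ 10 ≤ scale n i` is passed on from level to level, and while the recursion goes on, the
scale is at least 2. -/
theorem levels_add_le (hn : 2 ≤ n) (thr : ℕ) {u i : ℕ} (hi : i ≤ terms n)
    (h : (u : ℝ) ^ 10 ≤ scale n i) : levels thr u + i ≤ terms n := by
  induction u using Nat.strong_induction_on generalizing i with
  | _ u ih =>
    by_cases hu : 2 ≤ u ∧ thr ≤ u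
    · rw [levels_of_le hu.1 hu.2]
      have := ih _ (next_lt hu.1) (lt_terms hn (two_le_scale hu.1 h)) (next_pow_le h)
      omega
    · rw [levels, dif_neg hu]
      omega

theorem root_pow_le_scale (n : ℕ) : (root n : ℝ) ^ 10 ≤ scale n 0 := by
  rw [scale, pow_zero, Real.rpow_one]
  exact_mod_cast root_pow_le n

theorem depth_le (hn : 2 ≤ n) : depth n ≤ terms n :=
  levels_add_le hn _ (Nat.zero_le _) (root_pow_le_scale n)

/-- Here `f i` bounds the cost of the whole depth `i`: a node there is charged at most its share
`scale n i / n`, and by `sq_mul_scale_le` the shares of the children sum to at most that of the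
parent. -/
theorem tree_le (hn : 2 ≤ n) {c : ℕ → ℕ} {f : ℕ → ℝ} (thr : ℕ) (hf : ∀ i, 0 ≤ f i)
    (hc : ∀ u i, 2 ≤ u → thr ≤ u → (u : ℝ) ^ 10 ≤ scale n i → (c u : ℝ) * n ≤ f i * scale n i)
    {u i : ℕ} (h : (u : ℝ) ^ 10 ≤ scale n i) :
    (tree c thr u : ℝ) * n ≤ (∑ j ∈ Finset.Ico i (terms n), f j) * scale n i := by
  induction u using Nat.strong_induction_on generalizing i with
  | _ u ih =>
    have hs := scale_pos (n := n) (by omega)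
    by_cases hu : 2 ≤ u ∧ thr ≤ u
    · rw [tree_of_le hu.1 hu.2]
      have h1 := ih _ (next_lt hu.1) (next_pow_le h)
      have h2 := hc u i hu.1 hu.2 h
      have h3 := sq_mul_scale_le (by omega) h
      rw [Finset.sum_eq_sum_Ico_succ_bot (lt_terms hn (two_le_scale hu.1 h))]
      set s := ∑ j ∈ Finset.Ico (i + 1) (terms n), f j with hs'
      have h4 : 0 ≤ s := Finset.sum_nonneg fun j _ => hf j
      push_cast
      calc ((c u : ℝ) + u ^ 2 * tree c thr (next u)) * n
          = c u * n + u ^ 2 * (tree c thr (next u) * n) := by ring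
        _ ≤ f i * scale n i + u ^ 2 * (s * scale n (i + 1)) := by gcongr
        _ = f i * scale n i + s * (u ^ 2 * scale n (i + 1)) := by ring
        _ ≤ f i * scale n i + s * scale n i := by gcongr
        _ = _ := by ring
    · rw [tree, dif_neg hu, Nat.cast_zero, zero_mul]
      exact mul_nonneg (Finset.sum_nonneg fun j _ => hf j) (hs i).le

theorem clog_le (m : ℕ) (hm : 1 ≤ m) : (Nat.clog 2 m : ℝ) ≤ Real.logb 2 m + 1 := by
  have h1 := Real.natCeil_logb_natCast 2 m
  rw [← h1]
  exact (Nat.ceil_lt_add_one (Real.logb_nonneg (by norm_num) (by exact_mod_cast hm))).le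

theorem two_le_logb (hn : 4 ≤ n) : 2 ≤ Real.logb 2 n := by
  have hn' : (4 : ℝ) ≤ n := by exact_mod_cast hn
  rw [Real.le_logb_iff_rpow_le (by norm_num) (by linarith)]
  norm_num
  linarith

theorem one_le_logb_logb (hn : 4 ≤ n) : 1 ≤ Real.logb 2 (Real.logb 2 n) := by
  have := two_le_logb hn
  rw [Real.le_logb_iff_rpow_le (by norm_num) (by linarith)]
  norm_num
  linarith

/-- Because of `(5 / 4) ^ 4 ≥ 2` the change of base costs a factor 4; the extra term is at most one
more iterated logarithm, which is at least 1 for `n ≥ 4`. -/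
theorem terms_le (hn : 4 ≤ n) : (terms n : ℝ) ≤ 5 * Real.logb 2 (Real.logb 2 n) := by
  have h1 := one_le_logb_logb hn
  set y := Real.logb 2 (Real.logb 2 n) with hy
  have h2 : (1 : ℝ) / 4 ≤ Real.logb 2 (5 / 4) := by
    have h3 : Real.logb 2 2 ≤ Real.logb 2 ((5 / 4 : ℝ) ^ 4) :=
      Real.logb_le_logb_of_le (by norm_num) (by norm_num) (by norm_num)
    rw [Real.logb_self_eq_one (by norm_num), Real.logb_pow] at h3
    push_cast at h3
    linarith
  have h3 : Real.logb (5 / 4) (Real.logb 2 n) = y / Real.logb 2 (5 / 4) := by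
    rw [eq_div_iff (by linarith), mul_comm]
    exact Real.mul_logb (by norm_num) (by norm_num) (by norm_num)
  have h4 : Real.logb (5 / 4) (Real.logb 2 n) ≤ 4 * y := by
    rw [h3, div_le_iff₀ (by linarith)]
    nlinarith
  have h5 : 0 ≤ Real.logb (5 / 4) (Real.logb 2 n) := by
    rw [h3]
    exact div_nonneg (by linarith) (by linarith)
  have h6 := Nat.floor_le h5
  rw [terms]
  push_cast
  linarith

/-- With `x = log_2 n`, the threshold is at most `(4 * x) ^ 2`; its logarithm is `4 + 2 * log_2 x`,
and rounding adds 1. -/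
theorem clog_threshold_le (hn : 4 ≤ n) :
    (Nat.clog 2 (threshold n) : ℝ) ≤ 7 * Real.logb 2 (Real.logb 2 n) := by
  have h1 := one_le_logb_logb hn
  have h2 := two_le_logb hn
  have h3 := clog_le n (by omega)
  set x := Real.logb 2 n with hx
  have h4 := clog_le (threshold n) (by have := two_le_threshold n; omega)
  have h5 : ((threshold n : ℕ) : ℝ) ≤ (4 * x) ^ 2 := by
    rw [threshold]
    push_cast
    gcongr
    linarith
  have h6 : Real.logb 2 (threshold n) ≤ Real.logb 2 ((4 * x) ^ 2) :=
    Real.logb_le_logb_of_le (by norm_num)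
      (by have := two_le_threshold n; exact_mod_cast (by omega : 0 < threshold n)) h5
  have h7 : Real.logb 2 4 = 2 := by
    rw [show (4 : ℝ) = 2 ^ 2 by norm_num, Real.logb_pow, Real.logb_self_eq_one (by norm_num)]
    norm_num
  rw [Real.logb_pow, Real.logb_mul (by norm_num) (by linarith), h7] at h6
  push_cast at h6
  linarith

end numerics

/-! ### Assembly. -/

theorem wide_envOf (L : Learner) {n : ℕ} (A : Fin n → ℝ) : (envOf 20 L A).Wide := by
  have h1 : n + 1 ≤ 2 ^ (Nat.log 2 n + 1) := Nat.lt_pow_succ_log_self (by norm_num) n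
  have h2 : 2 ^ 20 * (n + 1) ≤ 2 ^ (20 * (Nat.log 2 n + 1) + 20) := by
    rw [pow_add, mul_comm]
    exact Nat.mul_le_mul_right _ (h1.trans (Nat.pow_le_pow_right (by norm_num) (by omega)))
  refine ⟨⟨?_, ?_⟩, h2⟩
  · change 9 * (n + 1) ≤ 20 * n + 20
    omega
  · change 20 * n + 20 < 2 ^ (20 * (Nat.log 2 n + 1) + 20)
    omega

/-- A bound for the time of a run. -/
noncomputable def Params.runTime (P : Params) (n : ℕ) : ℕ :=
  n * P.rate (root n) + P.tree (root n) + 500 * (n + 1) + 4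

theorem sorted_range_perm (L : Learner) {n c : ℕ} (A : Fin n → ℝ) :
    ((envOf c L A).sorted (List.range n)).Perm (List.ofFn A) := by
  refine ((envOf c L A).sorted_perm _).trans (List.Perm.of_eq ?_)
  rw [← List.map_coe_finRange_eq_range, List.map_map, List.ofFn_eq_map]
  refine List.map_congr_left fun i _ => ?_
  change keyAt A i = A i
  simp [keyAt]

/-- The run and its output come from the trivial parameters, which fit every array; on typical
arrays the same run also obeys the sharp bound. -/
theorem exec_envOf {L : Learner} {κ₁ κ₂ : ℝ} {X : Set (ProbabilityMeasure ℝ)} {T S B : ℕ → ℝ}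
    (hT : Monotone T) (hS : Monotone S) (hL : L.Learns κ₁ κ₂ X T S B) {n : ℕ} {A : Fin n → ℝ}
    (hA : ∀ i, A i ∈ Icc (0 : ℝ) 1) :
    ∃ σ, Exec (envOf 20 L A) sortProgram.toCmd (envOf 20 L A).init σ ∧
      σ.out.Pairwise (· ≤ ·) ∧ σ.out.Perm (List.ofFn A) ∧
      σ.time ≤ (params T S B n false).runTime n ∧
      (A ∉ badEvent n L → σ.time ≤ (params T S B n true).runTime n) ∧
      σ.peak ≤ ⌊S (Nat.sqrt n)⌋₊ := by
  obtain ⟨σ, h1, h2, h3, h4⟩ := exec_sortProgram (wide_envOf L A)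
    (regime_params hA hT hS hL false (by simp)) rfl
  refine ⟨σ, h1, ?_, ?_, h3, fun hbad => ?_, h4⟩
  · rw [h2]; exact Env.sorted_pairwise _ _
  · rw [h2]; exact sorted_range_perm L A
  · obtain ⟨σ', k1, -, k3, -⟩ := exec_sortProgram (wide_envOf L A)
      (regime_params hA hT hS hL true fun _ => hbad) rfl
    rw [h1.det k1]
    exact k3

/-- For `n ≥ 4` there are at most `31 * n` registers and memory cells, with words of at most `40 *
log_2 n` bits; 1240 is the product. -/
theorem space_le {n : ℕ} (hn : 4 ≤ n) {L : Learner} {A : Fin n → ℝ} {σ : State 24} {s : ℝ}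
    (hs : 0 ≤ s) (h : σ.peak ≤ ⌊s⌋₊) :
    ((envOf 20 L A).space σ : ℝ) ≤ 1240 * (s + n * Real.logb 2 n) := by
  have h1 : (σ.peak : ℝ) ≤ s := (Nat.cast_le.2 h).trans (Nat.floor_le hs)
  have h2 := two_le_logb hn
  have hn' : (4 : ℝ) ≤ n := by exact_mod_cast hn
  have h3 : (Nat.log 2 n : ℝ) ≤ Real.logb 2 n := Real.natLog_le_logb n 2
  set y := Real.logb 2 n with hy
  have h4 : ((envOf 20 L A).space σ : ℝ) =
      (24 + (20 * n + 20)) * (20 * (Nat.log 2 n + 1) + 20) + σ.peak := by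
    simp [Env.space, envOf]
  rw [h4]
  have h5 : (24 + (20 * (n : ℝ) + 20)) ≤ 31 * n := by linarith
  have h6 : (20 * ((Nat.log 2 n : ℝ) + 1) + 20) ≤ 40 * y := by linarith
  have h7 : (24 + (20 * (n : ℝ) + 20)) * (20 * ((Nat.log 2 n : ℝ) + 1) + 20) ≤ 31 * n * (40 * y) := by
    gcongr
  nlinarith

section bounds
variable {n : ℕ} {T S B : ℕ → ℝ}

theorem depth_real_le (hn : 4 ≤ n) : (depth n : ℝ) ≤ 5 * Real.logb 2 (Real.logb 2 n) :=
  (Nat.cast_le.2 (depth_le (by omega))).trans (terms_le hn)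

/-- `tree_le` with `x = n ^ ((4/5) ^ i / 2)`, the root of the scale: at most `n / x ^ 2` nodes,
which cost at most `x * B ⌊x⌋ + O(x ^ 2)` each. -/
theorem params_tree_le (hn : 4 ≤ n) (hB : Monotone fun m : ℕ => (m : ℝ) * B m)
    (hB0 : ∀ m, 1 ≤ m → 0 ≤ B m) (b : Bool) :
    ((params T S B n b).tree (root n) : ℝ) ≤ 20000 * terms n * n +
      ∑ i ∈ Finset.range (terms n), (n : ℝ) ^ (1 - (1 / 2 : ℝ) * (4 / 5 : ℝ) ^ i) *
        B ⌊(n : ℝ) ^ ((1 / 2 : ℝ) * (4 / 5 : ℝ) ^ i)⌋₊ := by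
  have hn0 : (0 : ℝ) < n := by exact_mod_cast (by omega : 0 < n)
  have hn1 : (1 : ℝ) ≤ n := by exact_mod_cast (by omega : 1 ≤ n)
  have hx1 : ∀ i, (1 : ℝ) ≤ (n : ℝ) ^ ((1 / 2 : ℝ) * (4 / 5 : ℝ) ^ i) := fun i =>
    Real.one_le_rpow hn1 (by positivity)
  have hpos : ∀ i, 0 ≤ B ⌊(n : ℝ) ^ ((1 / 2 : ℝ) * (4 / 5 : ℝ) ^ i)⌋₊ := fun i =>
    hB0 _ (Nat.le_floor (by simpa using hx1 i))
  have hmain := tree_le (n := n) (by omega) (c := fun u => ⌊((u ^ 5 : ℕ) : ℝ) * B (u ^ 5)⌋₊ + 20000 * u ^ 10)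
    (f := fun i => 20000 * n + (n : ℝ) ^ (1 - (1 / 2 : ℝ) * (4 / 5 : ℝ) ^ i) *
        B ⌊(n : ℝ) ^ ((1 / 2 : ℝ) * (4 / 5 : ℝ) ^ i)⌋₊) (threshold n)
    (fun i => add_nonneg (by positivity) (mul_nonneg (by positivity) (hpos i))) ?_
    (root_pow_le_scale n)
  · rw [scale, pow_zero, Real.rpow_one] at hmain
    have := le_of_mul_le_mul_right hmain hn0
    refine this.trans (le_of_eq ?_)
    rw [← Finset.range_eq_Ico, Finset.sum_add_distrib, Finset.sum_const, Finset.card_range,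
      nsmul_eq_mul]
    ring
  · intro u i hu _ h
    set x : ℝ := (n : ℝ) ^ ((1 / 2 : ℝ) * (4 / 5 : ℝ) ^ i) with hx
    have hxs : x ^ 2 = scale n i := by
      rw [hx, scale, ← Real.rpow_natCast, ← Real.rpow_mul hn0.le]
      congr 1
      push_cast
      ring
    have hxp : 0 < x := lt_of_lt_of_le one_pos (hx1 i)
    have h5 : (u : ℝ) ^ 5 ≤ x := by
      refine le_of_sq_le_sq ?_ hxp.le
      rw [hxs]
      refine le_trans (le_of_eq ?_) h
      ring
    have h6 : u ^ 5 ≤ ⌊x⌋₊ := Nat.le_floor (by push_cast; exact h5)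
    -- The sample may be smaller than `⌊x⌋`; it is the monotonicity of the total training cost, not
    -- of `B`, that is used.
    have h7 : ((u ^ 5 : ℕ) : ℝ) * B (u ^ 5) ≤ x * B ⌊x⌋₊ := (hB h6).trans
      (mul_le_mul_of_nonneg_right (Nat.floor_le hxp.le) (hpos i))
    have h8 : 0 ≤ ((u ^ 5 : ℕ) : ℝ) * B (u ^ 5) :=
      mul_nonneg (Nat.cast_nonneg _) (hB0 _ (Nat.one_le_pow _ _ (by omega)))
    have h9 : (n : ℝ) ^ (1 - (1 / 2 : ℝ) * (4 / 5 : ℝ) ^ i) * x = n := by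
      rw [hx, ← Real.rpow_add hn0]
      simp
    have h10 : ((⌊((u ^ 5 : ℕ) : ℝ) * B (u ^ 5)⌋₊ + 20000 * u ^ 10 : ℕ) : ℝ) ≤
        x * B ⌊x⌋₊ + 20000 * x ^ 2 := by
      push_cast
      rw [hxs]
      refine add_le_add ((Nat.floor_le (by push_cast at h8; exact h8)).trans (by push_cast at h7; exact h7)) (by gcongr)
    rw [← hxs]
    calc _ ≤ (x * B ⌊x⌋₊ + 20000 * x ^ 2) * n := by gcongr
      _ = 20000 * n * x ^ 2 + (n : ℝ) * x * B ⌊x⌋₊ := by ring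
      _ = 20000 * n * x ^ 2 + ((n : ℝ) ^ (1 - (1 / 2 : ℝ) * (4 / 5 : ℝ) ^ i) * x) * x * B ⌊x⌋₊ := by
          rw [h9]
      _ = _ := by ring

theorem sum_nonneg (hB0 : ∀ m, 1 ≤ m → 0 ≤ B m) (hn : 1 ≤ n) :
    0 ≤ ∑ i ∈ Finset.range (terms n), (n : ℝ) ^ (1 - (1 / 2 : ℝ) * (4 / 5 : ℝ) ^ i) *
        B ⌊(n : ℝ) ^ ((1 / 2 : ℝ) * (4 / 5 : ℝ) ^ i)⌋₊ :=
  Finset.sum_nonneg fun i _ => mul_nonneg (by positivity) (hB0 _ (Nat.le_floor (by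
    simpa using Real.one_le_rpow (Nat.one_le_cast.2 hn : (1 : ℝ) ≤ n) (by positivity))))

/-- Depth, leaf logarithms and constants are all multiples of `log_2 log_2 n ≥ 1`, and `1 ≤ T`
merges them with the query time. The training cost of the root is covered by the term `i = 0` of the
sum. -/
theorem runTime_true_le (hn : 4 ≤ n) (hT : 1 ≤ T (Nat.sqrt n))
    (hB : Monotone fun m : ℕ => (m : ℝ) * B m) (hB0 : ∀ m, 1 ≤ m → 0 ≤ B m) :
    ((params T S B n true).runTime n : ℝ) ≤ 500000 * timeBound T B n := by
  have h1 := one_le_logb_logb hn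
  have h2 := depth_real_le hn
  have h3 := clog_threshold_le hn
  have h4 := params_tree_le (T := T) (S := S) hn hB hB0 true
  have h5 := terms_le hn
  have hn' : (4 : ℝ) ≤ n := by exact_mod_cast hn
  have hs0 : 0 ≤ Real.sqrt n * B (Nat.sqrt n) := mul_nonneg (Real.sqrt_nonneg _)
    (hB0 _ (Nat.sqrt_pos.2 (by omega)))
  have hsum := sum_nonneg hB0 (by omega : 1 ≤ n)
  rw [timeBound, ← terms]
  set y := Real.logb 2 (Real.logb 2 n) with hy
  set total := ∑ i ∈ Finset.range (terms n), (n : ℝ) ^ (1 - (1 / 2 : ℝ) * (4 / 5 : ℝ) ^ i) *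
        B ⌊(n : ℝ) ^ ((1 / 2 : ℝ) * (4 / 5 : ℝ) ^ i)⌋₊ with htotal
  set t := T (Nat.sqrt n) with ht
  have hft : (⌊t⌋₊ : ℝ) ≤ t := Nat.floor_le (by linarith)
  have hrate : ((params T S B n true).rate (root n) : ℝ) =
      1000 * depth n * (⌊t⌋₊ + 3 + 1) +
        2000 * (13 * depth n + 10 + 10 * Nat.clog 2 (threshold n) + 1) := by
    simp [Params.rate, params, depth, ht]
  have hty : y ≤ t * y := by nlinarith
  have hr : ((params T S B n true).rate (root n) : ℝ) ≤ 330000 * (t * y) := by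
    rw [hrate]
    have g1 : (1000 * depth n * (⌊t⌋₊ + 3 + 1) : ℝ) ≤ 1000 * (5 * y) * (5 * t) := by
      gcongr
      linarith
    nlinarith
  have hnty : (n : ℝ) ≤ n * (t * y) := by nlinarith
  have htree : (20000 * terms n * n : ℝ) ≤ 100000 * (n * (t * y)) := by
    have : (terms n : ℝ) ≤ 5 * (t * y) := by linarith
    nlinarith
  rw [Params.runTime]
  push_cast
  have hr' : (n : ℝ) * (params T S B n true).rate (root n) ≤ n * (330000 * (t * y)) := by gcongr
  nlinarith

/-- The trees coincide; only the deviation 3 becomes `n`, once per level, and the logarithm at the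
leaves becomes `n`. -/
theorem runTime_false_le (hn : 4 ≤ n) :
    ((params T S B n false).runTime n : ℝ) ≤ (params T S B n true).runTime n +
      n * (9000 * (n * Real.logb 2 (Real.logb 2 n))) := by
  have h1 := one_le_logb_logb hn
  have h2 := depth_real_le hn
  have hn' : (4 : ℝ) ≤ n := by exact_mod_cast hn
  set y := Real.logb 2 (Real.logb 2 n) with hy
  have htree : (params T S B n false).tree (root n) = (params T S B n true).tree (root n) := rfl
  have hrate : ((params T S B n false).rate (root n) : ℝ) =
      1000 * depth n * (⌊T (Nat.sqrt n)⌋₊ + n + 1) + 2000 * (n + 1) := by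
    simp [Params.rate, params, depth]
  have hrate' : ((params T S B n true).rate (root n) : ℝ) =
      1000 * depth n * (⌊T (Nat.sqrt n)⌋₊ + 3 + 1) +
        2000 * (13 * depth n + 10 + 10 * Nat.clog 2 (threshold n) + 1) := by
    simp [Params.rate, params, depth]
  have hr : ((params T S B n false).rate (root n) : ℝ) ≤ (params T S B n true).rate (root n) +
      9000 * (n * y) := by
    rw [hrate, hrate']
    have g1 : (depth n : ℝ) * n ≤ 5 * y * n := by gcongr
    have g2 : (0 : ℝ) ≤ Nat.clog 2 (threshold n) := Nat.cast_nonneg _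
    have g3 : (0 : ℝ) ≤ depth n := Nat.cast_nonneg _
    have g4 : (n : ℝ) ≤ n * y := by nlinarith
    nlinarith
  rw [Params.runTime, Params.runTime, htree]
  push_cast
  have hr' := mul_le_mul_of_nonneg_left hr (by linarith : (0 : ℝ) ≤ n)
  linarith

end bounds

/-- The parameters bound natural numbers; the sample that is constantly 0 serves as an instance. -/
theorem Learner.Learns.param_nonneg {L : Learner} {κ₁ κ₂ : ℝ} {X : Set (ProbabilityMeasure ℝ)}
    {T S B : ℕ → ℝ} (hL : L.Learns κ₁ κ₂ X T S B) {m : ℕ} (hm : 1 ≤ m) : 0 ≤ B m ∧ 0 ≤ S m := by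
  have h0 : ∀ i : Fin m, (fun _ => (0 : ℝ)) i ∈ Icc (0 : ℝ) 1 := fun _ => by simp
  have hm' : (0 : ℝ) < m := by exact_mod_cast hm
  refine ⟨?_, (Nat.cast_nonneg _).trans (hL.space m hm _ h0)⟩
  exact nonneg_of_mul_nonneg_right ((Nat.cast_nonneg _).trans (hL.training m hm _ h0)) hm'

/-- The exceptional set is replaced by its measurable hull, and `f` is only bounded from above, so
neither has to be measurable. -/
theorem lintegral_le_of_badEvent {α : Type*} [MeasurableSpace α] (μ : Measure α)
    [IsProbabilityMeasure μ] {s : Set α} {f : α → ℝ≥0∞} {a b ε : ℝ} (ha : 0 ≤ a) (hb : 0 ≤ b)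
    (hε : 0 ≤ ε) (hs : μ s ≤ ENNReal.ofReal ε) (h : ∀ x, f x ≤ ENNReal.ofReal (a + b))
    (h' : ∀ x ∉ s, f x ≤ ENNReal.ofReal a) :
    ∫⁻ x, f x ∂μ ≤ ENNReal.ofReal (a + b * ε) := by
  have h1 : ∀ x, f x ≤ ENNReal.ofReal a +
      (toMeasurable μ s).indicator (fun _ => ENNReal.ofReal b) x := by
    intro x
    by_cases hx : x ∈ toMeasurable μ s
    · rw [indicator_of_mem hx, ← ENNReal.ofReal_add ha hb]
      exact h x
    · exact (h' x fun hx' => hx (subset_toMeasurable μ s hx')).trans (le_add_right le_rfl)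
  refine (lintegral_mono h1).trans ?_
  rw [lintegral_add_left measurable_const, lintegral_const, measure_univ, mul_one,
    lintegral_indicator_const (measurableSet_toMeasurable μ s), measure_toMeasurable,
    ENNReal.ofReal_add ha (by positivity), ENNReal.ofReal_mul hb]
  gcongr

end LearnedSort

theorem mainTheorem6 (κ₁ κ₂ : ℝ) (hκ₁ : 0 < κ₁) (hκ₂ : 0 < κ₂) :
    ∃ (k : ℕ) (P : LearnedSort.Cmd (k + 1)) (c : ℕ) (C : ℝ), 0 < C ∧
      ∀ (X : Set (ProbabilityMeasure ℝ)) (T S B : ℕ → ℝ) (L : LearnedSort.Learner),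
        (∀ χ ∈ X, (χ : Measure ℝ) (Icc (0 : ℝ) 1) = 1) →
        Monotone T → (∀ m, 1 ≤ T m) → Monotone S → Monotone (fun m : ℕ => (m : ℝ) * B m) →
        L.Learns κ₁ κ₂ (LearnedSort.condClosure X) T S B →
        ∀ n : ℕ, ∃ time : (Fin n → ℝ) → ℕ,
          (∀ A : Fin n → ℝ, (∀ i, A i ∈ Icc (0 : ℝ) 1) →
            ∃ σ : LearnedSort.State (k + 1),
              LearnedSort.Exec (LearnedSort.envOf c L A) P (LearnedSort.envOf c L A).init σ ∧
              σ.out.Pairwise (· ≤ ·) ∧ σ.out.Perm (List.ofFn A) ∧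
              σ.time = time A ∧
              (4 ≤ n → ((LearnedSort.envOf c L A).space σ : ℝ) ≤
                C * LearnedSort.spaceBound S n)) ∧
          (4 ≤ n → ∀ χ ∈ X,
            ∫⁻ A, (time A : ℝ≥0∞) ∂(Measure.pi fun _ : Fin n => (χ : Measure ℝ)) ≤
              ENNReal.ofReal (C * LearnedSort.timeBound T B n)) := by
  refine ⟨23, LearnedSort.sortProgram.toCmd, 20, 500000 + 9000 * LearnedSort.failConst κ₁ κ₂, ?_, ?_⟩
  · unfold LearnedSort.failConst
    positivity
  intro X T S B L _ hT hT1 hS hB hL n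
  have hrun : ∀ A : Fin n → ℝ, ∃ t : ℕ,
      ((∀ i, A i ∈ Icc (0 : ℝ) 1) → ∃ σ : LearnedSort.State (23 + 1),
        LearnedSort.Exec (LearnedSort.envOf 20 L A) LearnedSort.sortProgram.toCmd
          (LearnedSort.envOf 20 L A).init σ ∧
        σ.out.Pairwise (· ≤ ·) ∧ σ.out.Perm (List.ofFn A) ∧ σ.time = t ∧
        σ.peak ≤ ⌊S (Nat.sqrt n)⌋₊) ∧
      t ≤ (LearnedSort.params T S B n false).runTime n ∧
      (A ∉ LearnedSort.badEvent n L → t ≤ (LearnedSort.params T S B n true).runTime n) := by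
    intro A
    by_cases hA : ∀ i, A i ∈ Icc (0 : ℝ) 1
    · obtain ⟨σ, h1, h2, h3, h4, h5, h6⟩ := LearnedSort.exec_envOf hT hS hL hA
      exact ⟨σ.time, fun _ => ⟨σ, h1, h2, h3, rfl, h6⟩, h4, h5⟩
    -- Outside the cube nothing is claimed about runs, and the value 0 satisfies both bounds.
    · exact ⟨0, fun h => (hA h).elim, Nat.zero_le _, fun _ => Nat.zero_le _⟩
  choose time h1 h2 h3 using hrun
  have hF : 0 ≤ LearnedSort.failConst κ₁ κ₂ := by
    unfold LearnedSort.failConst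
    positivity
  refine ⟨time, fun A hA => ?_, fun hn χ hχ => ?_⟩
  · obtain ⟨σ, k1, k2, k3, k4, k5⟩ := h1 A hA
    refine ⟨σ, k1, k2, k3, k4, fun hn => ?_⟩
    have hs := (hL.param_nonneg (Nat.sqrt_pos.2 (by omega : 0 < n))).2
    refine (LearnedSort.space_le hn hs k5).trans ?_
    have := LearnedSort.two_le_logb hn
    have h0 : 0 ≤ LearnedSort.spaceBound S n := by
      unfold LearnedSort.spaceBound
      positivity
    exact mul_le_mul_of_nonneg_right (by linarith) h0
  · have hB0 : ∀ m, 1 ≤ m → 0 ≤ B m := fun m hm => (hL.param_nonneg hm).1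
    have hn0 : (0 : ℝ) < n := by exact_mod_cast (by omega : 0 < n)
    have hy := LearnedSort.one_le_logb_logb hn
    have g1 := LearnedSort.runTime_true_le (S := S) hn (hT1 (Nat.sqrt n)) hB hB0
    have g2 := LearnedSort.runTime_false_le (T := T) (S := S) (B := B) hn
    have g3 : n * Real.logb 2 (Real.logb 2 n) ≤ LearnedSort.timeBound T B n := by
      have k1 := hT1 (Nat.sqrt n)
      have k2 : 0 ≤ Real.sqrt n * B (Nat.sqrt n) := mul_nonneg (Real.sqrt_nonneg _)
        (hB0 _ (Nat.sqrt_pos.2 (by omega)))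
      have k3 := LearnedSort.sum_nonneg hB0 (by omega : 1 ≤ n)
      have k4 : 0 ≤ n * Real.logb 2 (Real.logb 2 n) := by positivity
      rw [LearnedSort.timeBound, ← LearnedSort.terms]
      nlinarith
    refine (LearnedSort.lintegral_le_of_badEvent _ (a := (LearnedSort.params T S B n true).runTime n)
      (b := n * (9000 * (n * Real.logb 2 (Real.logb 2 n)))) (Nat.cast_nonneg _) (by positivity)
      (by positivity) (LearnedSort.measure_badEvent_le hκ₁ hκ₂ hL hχ (by omega)) (fun A => ?_)
      fun A hA => ?_).trans (ENNReal.ofReal_le_ofReal ?_)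
    · rw [← ENNReal.ofReal_natCast]
      exact ENNReal.ofReal_le_ofReal ((Nat.cast_le.2 (h2 A)).trans g2)
    · rw [← ENNReal.ofReal_natCast]
      exact ENNReal.ofReal_le_ofReal (Nat.cast_le.2 (h3 A hA))
    -- The probability `failConst / n` cancels one factor `n` of the excess, which leaves a multiple
    -- of `n * log_2 log_2 n`.
    · have g4 : (n : ℝ) * (9000 * (n * Real.logb 2 (Real.logb 2 n))) *
          (LearnedSort.failConst κ₁ κ₂ / n) =
          9000 * LearnedSort.failConst κ₁ κ₂ * (n * Real.logb 2 (Real.logb 2 n)) := by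
        field_simp
      rw [g4, add_mul]
      gcongr
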